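/- Let $n\ge 2$, let $S_n(1)=\{x\in\mathbb R^n: x\ge 0,\ \sum_i x_i=1\}$, and let $M,\varepsilon>0$, $\mu=\varepsilon/(2M)$, $\mu_0>\mu$. Let $U$ be the open $\mu_0$-neighbourhood of $S_n(1)$ in the $\ell_1$ norm. Let $\eta$ be a random element, and for $x\in U$ let $f(x;\eta)$ be an integrable random variable; put $f(x)=E_\eta[f(x;\eta)]$ and $f_*=\min_{x\in S_n(1)}f(x)$. Write $\nabla_x f(x;\eta)$ for subgradients at $x$ of $f(\cdot\,;\eta)$ on $U$. Suppose that 1. almost surely, $f(\cdot\,;\eta)$ is convex on $U$; 2. for every $x\in U$, $E_\eta[\nabla_x f(x;\eta)]=\nabla f(x)$, that is, the expectations of the integrable measurable selectors of the subdifferential of $f(\cdot\,;\eta)$ at $x$ are exactly the subgradients of $f$ at $x$; 3.a. for every $x\in U$, $E_\eta\big[\|\nabla_x f(x;\eta)\|_\infty^2\big]\le M^2$, where $\nabla_x f(x;\eta)$ ranges over all subgradients (the expectation of the supremum of $\|g\|_\infty^2$ over all subgradients $g$ of $f(\cdot\,;\eta)$ at $x$ is at most $M^2$). In each iteration $k=1,2,\dots$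 one draws a direction $e^k$, uniformly distributed (with respect to the surface measure) on the sphere $\{e\in\mathbb R^n:\|e\|_1=1\}$. An oracle draws a realization $\eta^k$ with the law of $\eta$ and returns two values on this same realization, $f(x^k;\eta^k)+a^k$ and $f(x^k+\mu e^k;\eta^k)+b^k$, where the random noises satisfy $|a^k|,|b^k|\le\delta$ almost surely and $\delta\le\varepsilon/4$. Here $\eta^k$ is independent of $(e^j,\eta^j,a^j,b^j)_{j<k}$, and the noise does not depend on the queried points in the sense that $e^k$ is independent of $\big((e^j,\eta^j,a^j,b^j)_{j<k},\,\eta^k,a^k,b^k\big)$. Set $$g^k=\frac n\mu\Big(f(x^k+\mu e^k;\eta^k)+b^k-\big(f(x^k;\eta^k)+a^k\big)\Big)\,(\operatorname{sign}e^k_1,\dots,\operatorname{sign}e^k_n)^{T},$$ $x^1_i=1/n$, and for $t\ge1$ $$x^{t+1}_i=\frac{\exp\big(-\frac1{\beta_{t+1}}\sum_{k=1}^t g^k_i\big)}{\sum_{l=1}^n\exp\big(-\frac1{\beta_{t+1}}\sum_{k=1}^t g^k_l\big)},\quad i=1,\dots,n,\qquad \beta_t=\frac{2Mn\sqrt t}{\sqrt{\ln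 n}}.$$ Put $\bar x^N=\frac1N\sum_{k=1}^N x^k$. Then the minimum $f_*$ is attained and the following holds. (i) For $N=\Big\lceil \dfrac{64M^2n^2\ln n}{\varepsilon^2}\Big\rceil$, the random variable $f(\bar x^N)$ is integrable and $E\big[f(\bar x^N)\big]-f_*\le\varepsilon$. (ii) Suppose in addition that (condition 3), almost surely, $\|g\|_\infty\le M$ for all $x\in U$ and all subgradients $g$ of $f(\cdot\,;\eta)$ at $x$. Then for every $\sigma\in(0,1)$ and $N=\Big\lceil \dfrac{128M^2n^2}{\varepsilon^2}\big(\ln n+8\ln(\sigma^{-1})\big)\Big\rceil$, the inequality $f(\bar x^N)-f_*\le\varepsilon$ holds with probability at least $1-\sigma$. -/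

import Mathlib

open MeasureTheory ProbabilityTheory
open scoped ENNReal

noncomputable section

namespace GradientFree

/-- The open neighbourhood of radius `r`, in the ℓ¹ norm, of the unit simplex of `ℝⁿ`. -/
def simplexNhd (n : ℕ) (r : ℝ) : Set (Fin n → ℝ) :=
  {x | ∃ y ∈ stdSimplex ℝ (Fin n), ∑ i, |x i - y i| < r}

/-- The subdifferential at `x` of a function `φ` given on the set `U`. -/
def subdifferential {n : ℕ} (U : Set (Fin n → ℝ)) (φ : (Fin n → ℝ) → ℝ) (x : Fin n → ℝ) :
    Set (Fin n → ℝ) :=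
  {g | ∀ y ∈ U, φ x + ∑ i, g i * (y i - x i) ≤ φ y}

section Problem

variable {n : ℕ} {H : Type*} [MeasurableSpace H]

/-- The objective `f(x) = E_η f(x; η)`, where `η` has law `ν`. -/
def objective (F : (Fin n → ℝ) → H → ℝ) (ν : Measure H) (x : Fin n → ℝ) : ℝ :=
  ∫ h, F x h ∂ν

/-- The values `f(x; η)` are integrable random variables for every `x ∈ U`. -/
def IntegrableValues (U : Set (Fin n → ℝ)) (F : (Fin n → ℝ) → H → ℝ) (ν : Measure H) : Prop :=
  ∀ x ∈ U, Measurable (F x) ∧ Integrable (F x) ν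

/-- Convexity: `f(·; η)` is convex on `U`, almost surely. -/
def ConvexRealizations (U : Set (Fin n → ℝ)) (F : (Fin n → ℝ) → H → ℝ) (ν : Measure H) : Prop :=
  ∀ᵐ h ∂ν, ConvexOn ℝ U (fun x => F x h)

/-- Interchange of subgradient and expectation: `E_η ∇ₓ f(x; η) = ∇ₓ E_η f(x; η)` for all `x ∈ U`. The left-hand side is the set of
expectations of the (integrable) measurable selectors of the stochastic subdifferential, and the
right-hand side is the subdifferential of the objective. -/
def ExpectedSubgradients (U : Set (Fin n → ℝ)) (F : (Fin n → ℝ) → H → ℝ) (ν : Measure H) : Prop :=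
  ∀ x ∈ U,
    {v : Fin n → ℝ | ∃ G : H → Fin n → ℝ, Measurable G ∧ Integrable G ν ∧
      (∀ᵐ h ∂ν, G h ∈ subdifferential U (fun z => F z h) x) ∧ v = ∫ h, G h ∂ν}
    = subdifferential U (objective F ν) x

/-- Uniform bound: almost surely, all the subgradients of `f(·; η)` at all the points of `U` are
bounded by `M`. The norm of `Fin n → ℝ` is the ℓ^∞ norm. -/
def BoundedSubgradients (U : Set (Fin n → ℝ)) (F : (Fin n → ℝ) → H → ℝ) (ν : Measure H)
    (M : ℝ) : Prop :=
  ∀ᵐ h ∂ν, ∀ x ∈ U, ∀ g ∈ subdifferential U (fun z => F z h) x, ‖g‖ ≤ M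

/-- Mean-square bound: `E_η ‖∇ₓ f(x; η)‖_∞² ≤ M²` for all `x ∈ U`, where `∇ₓ f(x; η)` runs over all the
elements of the subdifferential of `f(·; η)` at `x`. The norm of `Fin n → ℝ` is the ℓ^∞ norm. -/
def SquareBoundedSubgradients (U : Set (Fin n → ℝ)) (F : (Fin n → ℝ) → H → ℝ) (ν : Measure H)
    (M : ℝ) : Prop :=
  ∀ x ∈ U, ∫⁻ h, (⨆ g ∈ subdifferential U (fun z => F z h) x, ‖g‖ₑ ^ 2) ∂ν ≤ ENNReal.ofReal (M ^ 2)

end Problem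

/-- The uniform distribution on the unit ℓ¹ sphere of `ℝⁿ`: the normalized surface measure, that
is, the `(n - 1)`-dimensional Hausdorff measure of Euclidean space restricted to the sphere. -/
def uniformL1Sphere (n : ℕ) : Measure (Fin n → ℝ) :=
  (ProbabilityTheory.cond (Measure.hausdorffMeasure ((n : ℝ) - 1))
    {x : EuclideanSpace ℝ (Fin n) | ∑ i, |x i| = 1}).map (fun x i => x i)

/-- The random data of the runs of the method. In iteration `k` it draws a direction `e k`, and the
oracle draws a realization `η k` of law `ν` and answers the two queries, at the current point and at
the shifted point, with the values `f(·; η k)` up to the additive noises `a k` and `b k`.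
* The noises are at most `δ` in absolute value.
* `η k` is independent of the past (of all that was drawn in the earlier iterations).
* The noises do not depend on the queried points: the direction `e k`, uniform on the unit
  ℓ¹ sphere, is independent of the past, `η k`, `a k` and `b k` together. The noises may otherwise
  depend on `η k`, on each other, and on additional randomness. -/
structure IsNoisyOracleRun {n : ℕ} {H Ω : Type*} [MeasurableSpace H] [MeasurableSpace Ω]
    (ν : Measure H) (δ : ℝ) (P : Measure Ω) (e : ℕ → Ω → Fin n → ℝ) (η : ℕ → Ω → H)
    (a b : ℕ → Ω → ℝ) : Prop where
  measurable_e : ∀ k, Measurable (e k)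
  measurable_η : ∀ k, Measurable (η k)
  measurable_a : ∀ k, Measurable (a k)
  measurable_b : ∀ k, Measurable (b k)
  law_e : ∀ k, P.map (e k) = uniformL1Sphere n
  law_η : ∀ k, P.map (η k) = ν
  noise_le : ∀ k, ∀ᵐ ω ∂P, |a k ω| ≤ δ ∧ |b k ω| ≤ δ
  indep_η : ∀ k, IndepFun (η k) (fun ω (j : Fin k) => (e j ω, η j ω, a j ω, b j ω)) P
  indep_e : ∀ k, IndepFun (e k)
    (fun ω => ((fun j : Fin k => (e j ω, η j ω, a j ω, b j ω)), η k ω, a k ω, b k ω)) P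

section Method

variable {n : ℕ} {H : Type*}

/-- The noisy two-point estimator
`(n / μ) (f(x + μ e; h) + b - (f(x; h) + a)) (sign e₁, …, sign eₙ)`. -/
def estimator (F : (Fin n → ℝ) → H → ℝ) (μ : ℝ) (x e : Fin n → ℝ) (h : H) (a b : ℝ) : Fin n → ℝ :=
  fun i => (n : ℝ) / μ * ((F (x + μ • e) h + b) - (F x h + a)) * Real.sign (e i)

/-- The point of the simplex whose coordinates are proportional to `exp (-sᵢ / β)`. -/
def entropicPoint (β : ℝ) (s : Fin n → ℝ) : Fin n → ℝ :=
  fun i => Real.exp (-(1 / β) * s i) / ∑ l, Real.exp (-(1 / β) * s l)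

/-- The parameter `β_t = 2 M n √t / √(ln n)`. -/
def stepParam (n : ℕ) (M : ℝ) (t : ℕ) : ℝ :=
  2 * M * n * √(t : ℝ) / √(Real.log n)

/-- The sum of the first `t` estimators along a run. The draws are indexed from `0`: those of the
iteration number `k + 1` are `e k`, `h k`, `a k`, `b k`. -/
def dualSum (F : (Fin n → ℝ) → H → ℝ) (M μ : ℝ) (e : ℕ → Fin n → ℝ) (h : ℕ → H) (a b : ℕ → ℝ) :
    ℕ → Fin n → ℝ
  | 0 => 0
  | t + 1 => dualSum F M μ e h a b t +
      estimator F μ (entropicPoint (stepParam n M (t + 1)) (dualSum F M μ e h a b t))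
        (e t) (h t) (a t) (b t)

/-- The point `x^{t+1}` of the method; in particular `iterate _ _ _ _ _ _ _ 0` is the starting point
`x¹ = (1/n, …, 1/n)`. -/
def iterate (F : (Fin n → ℝ) → H → ℝ) (M μ : ℝ) (e : ℕ → Fin n → ℝ) (h : ℕ → H) (a b : ℕ → ℝ)
    (t : ℕ) : Fin n → ℝ :=
  entropicPoint (stepParam n M (t + 1)) (dualSum F M μ e h a b t)

/-- The averaged point `(1/N) (x¹ + ⋯ + x^N)`. -/
def averagedPoint (F : (Fin n → ℝ) → H → ℝ) (M μ : ℝ) (e : ℕ → Fin n → ℝ) (h : ℕ → H)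
    (a b : ℕ → ℝ) (N : ℕ) : Fin n → ℝ :=
  (1 / (N : ℝ)) • ∑ t ∈ Finset.range N, iterate F M μ e h a b t

end Method

end GradientFree

end

/-! The unit ℓ¹ sphere has outer normal `sign e / √n` almost everywhere, of constant Euclidean
length. By the divergence theorem the mean of `(n / μ) f(x + μ e) sign eᵢ` over the sphere is
therefore the mean of `∂ᵢ f(x + μ v)` over the unit ℓ¹ ball, that is, the `i`-th partial derivative
of the ball average `f_μ` of `f` (`integral_mul_sign_uniformL1Sphere`). As `f_μ` is convex and `f ≤
f_μ ≤ f + M μ`, the mean estimator `G` at `x` satisfies `⟨G, x - y⟩ ≥ f(x) - f(y) - M μ`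
(`sub_le_sum_integral_estimator`), and `M μ = ε / 2`. The noise adds no bias: it is independent of
the direction, jointly with the past, and `sign eᵢ` has mean zero.

The method is dual averaging with entropy, so `∑ ⟨gᵏ, xᵏ - y⟩ ≤ β_N ln n + ∑ ‖gᵏ‖² / (2 β_k)` on
every run (`regret_le`). The mean-square bound on subgradients gives a mean-square Lipschitz
property in the ℓ¹ norm (`lintegral_sq_sub_le`): increments over a step `μ e` have second moment at
most `(M μ)²`. The noise difference is at most `ε / 2 = M μ` too, so `E ‖gᵏ‖² ≤ (2 M n)²`, and the
regret per step is at most `4 M n √(ln n / N) ≤ ε / 2` in the mean.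

It remains to control the deviations of `⟨gᵏ, xᵏ - y⟩` from their conditional means. They have mean
zero, which proves (i) (`IsNoisyOracleRun.integral_averagedPoint_le`). Under the uniform bound they
are martingale differences bounded by `8 M n`, and Azuma-Hoeffding proves (ii)
(`IsNoisyOracleRun.le_measureReal_averagedPoint`).

Two replacements make this rigorous: a jointly measurable version of `F`, which almost surely leaves
the run unchanged, and a Lipschitz extension `g` of the objective to the whole space. -/

namespace GradientFree

/-! ### Convex functions on the neighbourhood of the simplex -/

section Convexity

variable {n : ℕ}

theorem continuous_l1Norm : Continuous fun x : Fin n → ℝ => ∑ i, |x i| := by fun_prop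

theorem isOpen_simplexNhd (r : ℝ) : IsOpen (simplexNhd n r) := by
  have : simplexNhd n r =
      ⋃ y ∈ stdSimplex ℝ (Fin n), {x : Fin n → ℝ | ∑ i, |x i - y i| < r} := by
    ext x; simp [simplexNhd]
  rw [this]
  refine isOpen_biUnion fun y _ => isOpen_lt ?_ continuous_const
  fun_prop

theorem convex_simplexNhd (r : ℝ) : Convex ℝ (simplexNhd n r) := by
  rintro x ⟨x', hx', hx⟩ y ⟨y', hy', hy⟩ s t hs ht hst
  refine ⟨s • x' + t • y', convex_stdSimplex ℝ (Fin n) hx' hy' hs ht hst, ?_⟩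
  have h : ∑ i, |(s • x + t • y) i - (s • x' + t • y') i|
      ≤ s * ∑ i, |x i - x' i| + t * ∑ i, |y i - y' i| := by
    rw [Finset.mul_sum, Finset.mul_sum, ← Finset.sum_add_distrib]
    refine Finset.sum_le_sum fun i _ => ?_
    have : (s • x + t • y) i - (s • x' + t • y') i = s * (x i - x' i) + t * (y i - y' i) := by
      simp only [Pi.add_apply, Pi.smul_apply, smul_eq_mul]; ring
    rw [this]
    refine (abs_add_le _ _).trans ?_
    rw [abs_mul, abs_mul, abs_of_nonneg hs, abs_of_nonneg ht]
  refine h.trans_lt ?_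
  have : s * r + t * r = r := by rw [← add_mul, hst, one_mul]
  rcases hs.eq_or_lt with rfl | hs'
  · have : t = 1 := by linarith
    subst this; simpa using hy
  · have := mul_lt_mul_of_pos_left hx hs'
    have := mul_le_mul_of_nonneg_left hy.le ht
    linarith

theorem add_mem_simplexNhd {r : ℝ} {x d : Fin n → ℝ} (hx : x ∈ stdSimplex ℝ (Fin n))
    (hd : ∑ i, |d i| < r) : x + d ∈ simplexNhd n r :=
  ⟨x, hx, by simpa using hd⟩

theorem stdSimplex_subset_simplexNhd {r : ℝ} (hr : 0 < r) :
    stdSimplex ℝ (Fin n) ⊆ simplexNhd n r := fun x hx => ⟨x, hx, by simpa using hr⟩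

theorem abs_sum_mul_le (g d : Fin n → ℝ) : |∑ i, g i * d i| ≤ ‖g‖ * ∑ i, |d i| := by
  refine (Finset.abs_sum_le_sum_abs _ _).trans ?_
  rw [Finset.mul_sum]
  refine Finset.sum_le_sum fun i _ => ?_
  rw [abs_mul]
  exact mul_le_mul_of_nonneg_right (norm_le_pi_norm g i) (abs_nonneg _)

/-- A convex function on an open set has a subgradient at each point. -/
theorem subdifferential_nonempty {U : Set (Fin n → ℝ)} (hU : IsOpen U) {φ : (Fin n → ℝ) → ℝ}
    (hφ : ConvexOn ℝ U φ) {x : Fin n → ℝ} (hx : x ∈ U) : (subdifferential U φ x).Nonempty := by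
  have hc : ContinuousOn φ U := hφ.continuousOn hU
  have hopen : IsOpen {p : (Fin n → ℝ) × ℝ | p.1 ∈ U ∧ φ p.1 < p.2} := by
    rw [isOpen_iff_mem_nhds]
    rintro ⟨y, t⟩ ⟨hy, hyt⟩
    have h1 : ∀ᶠ p : (Fin n → ℝ) × ℝ in nhds (y, t), p.1 ∈ U :=
      continuous_fst.continuousAt.eventually (hU.mem_nhds hy)
    have h2 : ContinuousAt (fun p : (Fin n → ℝ) × ℝ => φ p.1) (y, t) :=
      ContinuousAt.comp (f := fun p : (Fin n → ℝ) × ℝ => p.1) (hc.continuousAt (hU.mem_nhds hy))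
        continuous_fst.continuousAt
    exact h1.and (h2.eventually_lt continuous_snd.continuousAt hyt)
  -- A hyperplane separates the graph point at `x` from the open strict epigraph. It is not vertical
  -- (`c < 0`), and its slope is the subgradient.
  obtain ⟨l, hl⟩ := geometric_hahn_banach_open_point (x := (x, φ x)) hφ.convex_strict_epigraph hopen
    (by simp)
  set c := l (0, 1) with hcdef
  have hsplit : ∀ (y : Fin n → ℝ) (t : ℝ), l (y, t) = l (y, 0) + t * c := by
    intro y t
    have : (y, t) = (y, (0 : ℝ)) + t • ((0 : Fin n → ℝ), (1 : ℝ)) := by ext <;> simp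
    rw [this, map_add, map_smul, smul_eq_mul]
  have hc0 : c < 0 := by
    have := hl (x, φ x + 1) ⟨hx, by simp⟩
    rw [hsplit x (φ x + 1), hsplit x (φ x)] at this
    linarith
  have hle : ∀ y ∈ U, l (y, 0) + φ y * c ≤ l (x, 0) + φ x * c := by
    intro y hy
    -- Separation is known only strictly above the graph; a point at height `r / -c` above it costs
    -- exactly `r`, which is arbitrary.
    refine le_of_forall_pos_le_add fun r hr => ?_
    have hs : 0 < r / -c := div_pos hr (neg_pos.2 hc0)
    have := hl (y, φ y + r / -c) ⟨hy, by simpa using hs⟩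
    rw [hsplit y, hsplit x (φ x)] at this
    have h3 : r / -c * c = -r := by rw [div_neg, neg_mul, div_mul_cancel₀ _ hc0.ne]
    nlinarith
  refine ⟨fun i => l (Pi.single i 1, 0) / -c, fun y hy => ?_⟩
  have hlin : ∑ i, l (Pi.single i 1, 0) / -c * (y i - x i) = (l (y, 0) - l (x, 0)) / -c := by
    have h4 : l (y, 0) - l (x, 0) = ∑ i, (y i - x i) * l (Pi.single i 1, 0) := by
      rw [← map_sub]
      have : ((y, 0) - (x, 0) : (Fin n → ℝ) × ℝ)
          = ∑ i, (y i - x i) • ((Pi.single i 1 : Fin n → ℝ), (0 : ℝ)) := by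
        ext j
        · simp [Prod.fst_sum, Finset.sum_apply, Pi.single_apply]
        · simp [Prod.snd_sum]
      rw [this, map_sum]
      exact Finset.sum_congr rfl fun i _ => by rw [map_smul, smul_eq_mul]
    rw [h4, Finset.sum_div]
    exact Finset.sum_congr rfl fun i _ => by ring
  rw [hlin, ← le_sub_iff_add_le', div_le_iff₀ (neg_pos.2 hc0)]
  have := hle y hy
  linarith

/-- By convexity the difference quotients along the segment from `z` to `y` are at most `φ y - φ z`,
and the bound passes to the limit. -/
theorem add_fderiv_le {U : Set (Fin n → ℝ)} {φ : (Fin n → ℝ) → ℝ}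
    (hφ : ConvexOn ℝ U φ) {z y : Fin n → ℝ} (hz : z ∈ U) (hy : y ∈ U)
    (hd : DifferentiableAt ℝ φ z) : φ z + fderiv ℝ φ z (y - z) ≤ φ y := by
  have hline : HasDerivAt (fun t : ℝ => φ (z + t • (y - z))) (fderiv ℝ φ z (y - z)) 0 :=
    hd.hasFDerivAt.hasLineDerivAt (y - z)
  have ht := hline.tendsto_slope_zero_right
  have : fderiv ℝ φ z (y - z) ≤ φ y - φ z := by
    refine le_of_tendsto ht ?_
    filter_upwards [Ioo_mem_nhdsGT (show (0 : ℝ) < 1 by norm_num)] with t ht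
    have h := hφ.2 hz hy (sub_nonneg.2 ht.2.le) ht.1.le (sub_add_cancel 1 t)
    have h2 : (1 - t) • z + t • y = z + t • (y - z) := by
      rw [sub_smul, one_smul, smul_sub]; abel
    rw [h2] at h
    simp only [zero_add, zero_smul, add_zero, smul_eq_mul] at h ⊢
    rw [inv_mul_le_iff₀ ht.1]
    linarith
  linarith

end Convexity

/-! ### Surface measure of the ℓ¹ sphere in coordinates -/

section Sphere

open Measure Set

variable {m : ℕ}

/-- The linear graph map `u ↦ (u, ∑ wⱼ uⱼ)`, the last value being inserted at position `i`. -/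
def graphMap (i : Fin (m + 1)) (w : Fin m → ℝ) :
    (Fin m → ℝ) →ₗ[ℝ] EuclideanSpace ℝ (Fin (m + 1)) where
  toFun u := WithLp.toLp 2 (i.insertNth (∑ j, w j * u j) u)
  map_add' u v := by
    ext k
    refine Fin.succAboveCases i ?_ (fun j => ?_) k
    · simp [mul_add, Finset.sum_add_distrib]
    · simp
  map_smul' c u := by
    ext k
    refine Fin.succAboveCases i ?_ (fun j => ?_) k
    · simp [Finset.mul_sum, mul_left_comm]
    · simp

@[simp] theorem graphMap_self (i : Fin (m + 1)) (w u : Fin m → ℝ) :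
    graphMap i w u i = ∑ j, w j * u j := by simp [graphMap]

@[simp] theorem graphMap_succAbove (i : Fin (m + 1)) (w u : Fin m → ℝ) (j : Fin m) :
    graphMap i w u (i.succAbove j) = u j := by simp [graphMap]

theorem graphMap_injective (i : Fin (m + 1)) (w : Fin m → ℝ) :
    Function.Injective (graphMap i w) := fun u v h => by
  ext j
  rw [← graphMap_succAbove i w u j, h, graphMap_succAbove]

theorem continuous_graphMap (i : Fin (m + 1)) (w : Fin m → ℝ) : Continuous (graphMap i w) :=
  (graphMap i w).continuous_of_finiteDimensional

theorem isometry_mul_of_abs_eq_one {ι : Type*} [Fintype ι] {c : ι → ℝ} (hc : ∀ k, |c k| = 1) :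
    Isometry fun x : ι → ℝ => fun k => c k * x k := by
  refine Isometry.of_dist_eq fun x y => ?_
  simp only [dist_pi_def]
  congr 2 with k
  simp [nndist_eq_nnnorm, ← mul_sub, hc]

theorem isometry_toLp_mul_of_abs_eq_one {ι : Type*} [Fintype ι] {c : ι → ℝ}
    (hc : ∀ k, |c k| = 1) :
    Isometry fun x : EuclideanSpace ℝ ι => (WithLp.toLp 2 fun k => c k * x k :
      EuclideanSpace ℝ ι) := by
  refine Isometry.of_dist_eq fun x y => ?_
  simp only [EuclideanSpace.dist_eq, Real.dist_eq, ← mul_sub, abs_mul, hc, one_mul]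

/-- The measure of the image under a graph map with coefficients `±1` is a multiple, common to all
these maps, of the volume. -/
theorem exists_hausdorffMeasure_graphMap_image (i : Fin (m + 1)) :
    ∃ C : ℝ≥0∞, ∀ w : Fin m → ℝ, (∀ j, |w j| = 1) → ∀ A : Set (Fin m → ℝ), MeasurableSet A →
      μH[(m : ℝ)] (graphMap i w '' A) = C * volume A := by
  have hvol : (μH[(m : ℝ)] : Measure (Fin m → ℝ)) = volume := by
    simpa using hausdorffMeasure_pi_real (ι := Fin m)
  have hemb : MeasurableEmbedding (graphMap i (1 : Fin m → ℝ)) :=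
    ((continuous_graphMap i 1).measurableEmbedding (graphMap_injective i 1))
  -- The pulled-back Hausdorff measure is translation invariant and, the graph map being Lipschitz,
  -- finite on compact sets, hence a multiple of Lebesgue measure.
  let κ : Measure (Fin m → ℝ) := (μH[(m : ℝ)]).comap (graphMap i (1 : Fin m → ℝ))
  have hinv : κ.IsAddLeftInvariant :=
    IsAddLeftInvariant.comap μH[(m : ℝ)] (f := (graphMap i (1 : Fin m → ℝ)).toAddMonoidHom) hemb
  have hfin : IsFiniteMeasureOnCompacts κ := by
    constructor
    intro K hK
    rw [hemb.comap_apply]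
    refine (((graphMap i (1 : Fin m → ℝ)).toContinuousLinearMap.lipschitz
      ).hausdorffMeasure_image_le (Nat.cast_nonneg m) K).trans_lt ?_
    rw [hvol, ENNReal.rpow_natCast]
    exact ENNReal.mul_lt_top (ENNReal.pow_lt_top ENNReal.coe_lt_top) hK.measure_lt_top
  refine ⟨κ.addHaarScalarFactor volume, fun w hw A hA => ?_⟩
  have hκ := isAddLeftInvariant_eq_smul κ volume
  let D : (Fin m → ℝ) → Fin m → ℝ := fun u j => w j * u j
  have hww : ∀ j, w j * w j = 1 := fun j => by rw [← abs_mul_abs_self, hw, one_mul]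
  have hD : Isometry D := isometry_mul_of_abs_eq_one hw
  have hc : ∀ k, |(i.insertNth 1 w : Fin (m + 1) → ℝ) k| = 1 := fun k =>
    Fin.succAboveCases i (by simp) (fun j => by simp [hw]) k
  -- Sign changes reduce every `w` to `w = 1`: one in the domain, preserving the volume, and one in
  -- the Euclidean target, an isometry. Hence the constant does not depend on `w`.
  have hcomp : graphMap i w '' A = (fun x : EuclideanSpace ℝ (Fin (m + 1)) =>
      (WithLp.toLp 2 fun k => (i.insertNth 1 w : Fin (m + 1) → ℝ) k * x k :
        EuclideanSpace ℝ (Fin (m + 1)))) '' (graphMap i 1 '' (D '' A)) := by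
    simp only [image_image]
    refine image_congr fun u _ => ?_
    ext k
    refine Fin.succAboveCases i ?_ (fun j => ?_) k
    · simp [D]
    · simp [D, ← mul_assoc, hww]
  rw [hcomp, (isometry_toLp_mul_of_abs_eq_one hc).hausdorffMeasure_image
    (Or.inl (Nat.cast_nonneg m)), ← hemb.comap_apply]
  have hDvol : volume (D '' A) = volume A := by
    rw [← hvol, hD.hausdorffMeasure_image (Or.inl (Nat.cast_nonneg m))]
  change κ (D '' A) = _
  conv_lhs => rw [hκ]
  rw [Measure.smul_apply, hDvol]
  rfl

/-- The open unit ball of the ℓ¹ norm. -/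
def l1Ball (m : ℕ) : Set (Fin m → ℝ) := {u | ∑ j, |u j| < 1}

theorem measurableSet_l1Ball (m : ℕ) : MeasurableSet (l1Ball m) :=
  (isOpen_lt continuous_l1Norm continuous_const).measurableSet

/-- The point of the unit ℓ¹ sphere over the point `u` of the unit ball, for `τ = ± 1`. -/
def sphereLift (i : Fin (m + 1)) (τ : ℝ) (u : Fin m → ℝ) : Fin (m + 1) → ℝ :=
  i.insertNth (τ * (1 - ∑ j, |u j|)) u

@[simp] theorem sphereLift_self (i : Fin (m + 1)) (τ : ℝ) (u : Fin m → ℝ) :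
    sphereLift i τ u i = τ * (1 - ∑ j, |u j|) := by simp [sphereLift]

@[simp] theorem sphereLift_succAbove (i : Fin (m + 1)) (τ : ℝ) (u : Fin m → ℝ) (j : Fin m) :
    sphereLift i τ u (i.succAbove j) = u j := by simp [sphereLift]

theorem continuous_sphereLift (i : Fin (m + 1)) (τ : ℝ) : Continuous (sphereLift i τ) := by
  refine continuous_pi fun k => ?_
  refine Fin.succAboveCases i ?_ (fun j => ?_) k
  · simp only [sphereLift_self]; fun_prop
  · simp only [sphereLift_succAbove]; fun_prop

theorem sum_abs_sphereLift {i : Fin (m + 1)} {τ : ℝ} (hτ : |τ| = 1) {u : Fin m → ℝ}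
    (hu : u ∈ l1Ball m) : ∑ k, |sphereLift i τ u k| = 1 := by
  have : 0 < 1 - ∑ j, |u j| := sub_pos.2 hu
  rw [Fin.sum_univ_succAbove _ i]
  simp [abs_mul, hτ, abs_of_pos this]

/-- Over each orthant of the remaining coordinates the half sphere is a translate of a linear graph
with coefficients `±1`. All these faces have the same density `C`, so dropping the coordinate `i`
turns surface measure into `C` times Lebesgue measure on the ball. -/
theorem hausdorffMeasure_halfSphere (i : Fin (m + 1)) {C : ℝ≥0∞}
    (hC : ∀ w : Fin m → ℝ, (∀ j, |w j| = 1) → ∀ A : Set (Fin m → ℝ), MeasurableSet A →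
      μH[(m : ℝ)] (graphMap i w '' A) = C * volume A) {τ : ℝ} (hτ : τ = 1 ∨ τ = -1) :
    (μH[(m : ℝ)] : Measure (EuclideanSpace ℝ (Fin (m + 1)))).restrict
        ({x | ∑ k, |x k| = 1} ∩ {x | 0 < τ * x i})
      = C • (volume.restrict (l1Ball m)).map (fun u => WithLp.toLp 2 (sphereLift i τ u)) := by
  have hττ : τ * τ = 1 := by rcases hτ with rfl | rfl <;> norm_num
  have hτa : |τ| = 1 := by rcases hτ with rfl | rfl <;> norm_num
  let p : EuclideanSpace ℝ (Fin (m + 1)) → Fin m → ℝ := fun x j => x (i.succAbove j)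
  have hp : Measurable p := by fun_prop
  set R := (μH[(m : ℝ)] : Measure (EuclideanSpace ℝ (Fin (m + 1)))).restrict
        ({x | ∑ k, |x k| = 1} ∩ {x | 0 < τ * x i}) with hR
  have hSm : MeasurableSet ({x : EuclideanSpace ℝ (Fin (m + 1)) | ∑ k, |x k| = 1}
      ∩ {x | 0 < τ * x i}) :=
    (isClosed_eq (by fun_prop) continuous_const).measurableSet.inter
      (isOpen_lt continuous_const (by fun_prop)).measurableSet
  have hT : Measurable fun u : Fin m → ℝ =>
      (WithLp.toLp 2 (sphereLift i τ u) : EuclideanSpace ℝ (Fin (m + 1))) :=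
    ((PiLp.continuous_toLp 2 _).comp (continuous_sphereLift i τ)).measurable
  have hpT : ∀ x : EuclideanSpace ℝ (Fin (m + 1)), ∑ k, |x k| = 1 → 0 < τ * x i →
      WithLp.toLp 2 (sphereLift i τ (p x)) = x := by
    intro x hx hi
    rw [Fin.sum_univ_succAbove _ i] at hx
    have hxi : |x i| = τ * x i := by
      rw [← abs_of_pos hi, abs_mul, hτa, one_mul]
    ext k
    refine Fin.succAboveCases i ?_ (fun j => ?_) k
    · have : τ * (1 - ∑ j, |p x j|) = x i := by
        rw [← hx]; simp only [p, add_sub_cancel_right]; rw [hxi, ← mul_assoc, hττ, one_mul]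
      simpa using this
    · simp [p]
  have hmap : R.map p = C • volume.restrict (l1Ball m) := by
    let Q : (Fin m → Bool) → Set (Fin m → ℝ) := fun s => {u | ∀ j, (0 ≤ u j ↔ s j = true)}
    have hQ : ∀ s, MeasurableSet (Q s) := fun s => by
      have : Q s = ⋂ j, {u | 0 ≤ u j ↔ s j = true} := by ext u; simp [Q]
      rw [this]
      refine MeasurableSet.iInter fun j => ?_
      cases s j
      · simpa using measurableSet_lt (measurable_pi_apply j) measurable_const
      · simpa using measurableSet_le measurable_const (measurable_pi_apply j)
    have hcov : ⋃ s, Q s = univ := by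
      refine eq_univ_of_forall fun u => mem_iUnion.2 ⟨fun j => decide (0 ≤ u j), fun j => by simp⟩
    rw [ext_iff_of_iUnion_eq_univ hcov]
    intro s
    ext A hA
    have hAQ := hA.inter (hQ s)
    rw [restrict_apply hA, restrict_apply hA, map_apply hp hAQ, hR, restrict_apply (hp hAQ),
      Measure.smul_apply, restrict_apply hAQ, smul_eq_mul]
    -- On the orthant `s` the lift is affine: `τ (1 - ∑ |uⱼ|) = τ + ∑ wⱼ uⱼ`.
    let w : Fin m → ℝ := fun j => if s j then -τ else τ
    have hw : ∀ j, |w j| = 1 := fun j => by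
      by_cases h : s j <;> simp [w, h, hτa]
    have hwu : ∀ u ∈ Q s, ∀ j, w j * u j = - τ * |u j| := by
      intro u hu j
      by_cases h : s j
      · simp [w, h, abs_of_nonneg ((hu j).2 h)]
      · have : u j < 0 := not_le.1 fun h' => h ((hu j).1 h')
        simp [w, h, abs_of_neg this]
    rw [← hC w hw _ (hAQ.inter (measurableSet_l1Ball m)),
      ← measure_preimage_add _ (-(EuclideanSpace.single i τ)) (graphMap i w '' _)]
    congr 1
    have hkey : ∀ u ∈ Q s, EuclideanSpace.single i τ + graphMap i w u
        = WithLp.toLp 2 (sphereLift i τ u) := by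
      intro u hu
      ext k
      refine Fin.succAboveCases i ?_ (fun j => ?_) k
      · simp only [PiLp.add_apply, PiLp.single_apply, if_true, graphMap_self,
          sphereLift_self, hwu u hu, ← Finset.mul_sum]
        ring
      · simp [Fin.succAbove_ne]
    ext x
    constructor
    · rintro ⟨⟨hxA, hxQ⟩, hxS, hxi⟩
      refine ⟨p x, ⟨⟨hxA, hxQ⟩, ?_⟩, ?_⟩
      · have h := hxS
        simp only [mem_ofPred_eq] at h hxi
        rw [Fin.sum_univ_succAbove _ i] at h
        have : 0 < |x i| := abs_pos.2 fun h0 => by simp [h0] at hxi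
        change ∑ j, |x (i.succAbove j)| < 1
        linarith
      · have := hkey _ hxQ
        rw [hpT x hxS hxi] at this
        exact eq_neg_add_of_add_eq this
    · rintro ⟨u, ⟨⟨huA, huQ⟩, huB⟩, hu⟩
      have hx : x = WithLp.toLp 2 (sphereLift i τ u) := by
        rw [← hkey u huQ, hu, add_neg_cancel_left]
      have hpu : p x = u := by ext j; simp [p, hx]
      refine ⟨by rw [mem_preimage, hpu]; exact ⟨huA, huQ⟩, ?_, ?_⟩
      · simpa [hx] using sum_abs_sphereLift (i := i) hτa huB
      · have : 0 < 1 - ∑ j, |u j| := sub_pos.2 huB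
        simpa [hx, ← mul_assoc, hττ] using this
  have hRT : R = (R.map p).map fun u => WithLp.toLp 2 (sphereLift i τ u) := by
    rw [map_map hT hp]
    conv_lhs => rw [← Measure.map_id (μ := R)]
    refine Measure.map_congr ?_
    rw [hR]
    filter_upwards [ae_restrict_mem hSm] with x hx
    exact (hpT x hx.1 hx.2).symm
  rw [hRT, hmap, Measure.map_smul]

/-- The level set is an affine subspace missing the origin, so it is proper; this also covers `l =
0`. -/
theorem volume_linearMap_eq_of_ne_zero (l : (Fin m → ℝ) →ₗ[ℝ] ℝ) {r : ℝ} (hr : r ≠ 0) :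
    volume {u | l u = r} = 0 := by
  let A : AffineSubspace ℝ (Fin m → ℝ) :=
    { carrier := {u | l u = r}
      smul_vsub_vadd_mem' := fun c p q t hp hq ht => by
        simp only [mem_ofPred_eq] at hp hq ht ⊢
        simp [hp, hq, ht] }
  refine addHaar_affineSubspace volume A fun h => ?_
  have : (0 : Fin m → ℝ) ∈ A := h ▸ AffineSubspace.mem_top ℝ _ _
  exact hr (by simpa using (show l 0 = r from this).symm)

/-- The equator lies in finitely many translated graphs over the null sets `∑ ± uⱼ = 1`, so the two
open half spheres carry all the mass. -/
theorem hausdorffMeasure_sphere_equator (i : Fin (m + 1)) {C : ℝ≥0∞}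
    (hC : ∀ w : Fin m → ℝ, (∀ j, |w j| = 1) → ∀ A : Set (Fin m → ℝ), MeasurableSet A →
      μH[(m : ℝ)] (graphMap i w '' A) = C * volume A) :
    μH[(m : ℝ)] ({x : EuclideanSpace ℝ (Fin (m + 1)) | ∑ k, |x k| = 1} ∩ {x | x i = 0}) = 0 := by
  let N : (Fin m → Bool) → Set (Fin m → ℝ) := fun s =>
    {u | ∑ j, (if s j then (1 : ℝ) else -1) * u j = 1}
  have hsub : {x : EuclideanSpace ℝ (Fin (m + 1)) | ∑ k, |x k| = 1} ∩ {x | x i = 0} ⊆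
      ⋃ s : Fin m → Bool, (fun x => -(EuclideanSpace.single i 1) + x) ⁻¹'
        (graphMap i (fun j => -(if s j then (1 : ℝ) else -1)) '' N s) := by
    rintro x ⟨hx, hxi⟩
    simp only [mem_ofPred_eq] at hx hxi
    rw [Fin.sum_univ_succAbove _ i, hxi, abs_zero, zero_add] at hx
    have hsum : ∑ j, (if decide (0 ≤ x (i.succAbove j)) then (1 : ℝ) else -1) * x (i.succAbove j)
        = 1 := by
      refine Eq.trans (Finset.sum_congr rfl fun j _ => ?_) hx
      rcases le_or_gt 0 (x (i.succAbove j)) with h | h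
      · rw [decide_eq_true h, if_pos rfl, one_mul, abs_of_nonneg h]
      · rw [decide_eq_false (not_le.2 h), if_neg (by simp), neg_one_mul, abs_of_neg h]
    refine mem_iUnion.2 ⟨fun j => decide (0 ≤ x (i.succAbove j)),
      fun j => x (i.succAbove j), hsum, ?_⟩
    ext k
    refine Fin.succAboveCases i ?_ (fun j => ?_) k
    · simp only [graphMap_self, neg_mul, Finset.sum_neg_distrib, hsum]
      simp [hxi]
    · simp [Fin.succAbove_ne]
  refine measure_mono_null hsub (measure_iUnion_null fun s => ?_)
  have hN : MeasurableSet (N s) := (isClosed_eq (by fun_prop) continuous_const).measurableSet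
  rw [measure_preimage_add, hC _ (fun j => by by_cases h : s j <;> simp [h]) _ hN]
  let l : (Fin m → ℝ) →ₗ[ℝ] ℝ := Fintype.linearCombination ℝ fun j => if s j then (1 : ℝ) else -1
  have hl : N s = {u | l u = 1} := by
    ext u; simp only [N, l, Fintype.linearCombination_apply, smul_eq_mul, mul_comm]
  rw [hl, volume_linearMap_eq_of_ne_zero l one_ne_zero, mul_zero]

/-- The uniform distribution on the unit ℓ¹ sphere, in terms of the projection that drops the
coordinate `i`. -/
theorem uniformL1Sphere_eq (h : IsProbabilityMeasure (uniformL1Sphere (m + 1)))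
    (i : Fin (m + 1)) : uniformL1Sphere (m + 1) =
      (2 * volume (l1Ball m))⁻¹ • ((volume.restrict (l1Ball m)).map (sphereLift i 1) +
        (volume.restrict (l1Ball m)).map (sphereLift i (-1))) := by
  obtain ⟨C, hC⟩ := exists_hausdorffMeasure_graphMap_image i
  set S : Set (EuclideanSpace ℝ (Fin (m + 1))) := {x | ∑ k, |x k| = 1} with hS
  have hSm : MeasurableSet S := (isClosed_eq (by fun_prop) continuous_const).measurableSet
  have hT : ∀ τ, Measurable fun u : Fin m → ℝ =>
      (WithLp.toLp 2 (sphereLift i τ u) : EuclideanSpace ℝ (Fin (m + 1))) := fun τ =>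
    ((PiLp.continuous_toLp 2 _).comp (continuous_sphereLift i τ)).measurable
  have hneg : MeasurableSet {x : EuclideanSpace ℝ (Fin (m + 1)) | 0 < -1 * x i} :=
    (isOpen_lt continuous_const (by fun_prop)).measurableSet
  have hsplit : (μH[(m : ℝ)] : Measure (EuclideanSpace ℝ (Fin (m + 1)))).restrict S
      = (μH[(m : ℝ)]).restrict (S ∩ {x | 0 < 1 * x i})
        + (μH[(m : ℝ)]).restrict (S ∩ {x | 0 < -1 * x i}) := by
    have hdisj : Disjoint (S ∩ {x | 0 < 1 * x i}) (S ∩ {x | 0 < -1 * x i}) := by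
      refine disjoint_left.2 fun x hx hx' => ?_
      have h1 : 0 < 1 * x i := hx.2
      have h2 : 0 < -1 * x i := hx'.2
      linarith
    rw [← restrict_union hdisj (hSm.inter hneg)]
    refine restrict_congr_set ?_
    filter_upwards [compl_mem_ae_iff.2 (hausdorffMeasure_sphere_equator i hC)] with x hx
    refine propext ⟨fun h => ?_, fun h => h.elim (fun h => h.1) fun h => h.1⟩
    rcases lt_trichotomy (x i) 0 with h0 | h0 | h0
    · exact Or.inr ⟨h, by change 0 < -1 * x i; linarith⟩
    · exact absurd ⟨h, h0⟩ hx
    · exact Or.inl ⟨h, by change 0 < 1 * x i; linarith⟩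
  have hmap : (μH[(m : ℝ)].restrict S).map (fun x k => x k) = C •
      ((volume.restrict (l1Ball m)).map (sphereLift i 1) +
        (volume.restrict (l1Ball m)).map (sphereLift i (-1))) := by
    have hof : Measurable fun (x : EuclideanSpace ℝ (Fin (m + 1))) (k : Fin (m + 1)) => x k := by
      fun_prop
    rw [hsplit, hausdorffMeasure_halfSphere i hC (Or.inl rfl),
      hausdorffMeasure_halfSphere i hC (Or.inr rfl), ← smul_add, Measure.map_smul,
      Measure.map_add _ _ hof, map_map hof (hT 1), map_map hof (hT (-1))]
    rfl
  have hσ : uniformL1Sphere (m + 1) = ((μH[(m : ℝ)] S)⁻¹ * C) •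
      ((volume.restrict (l1Ball m)).map (sphereLift i 1) +
        (volume.restrict (l1Ball m)).map (sphereLift i (-1))) := by
    have hdim : (((m + 1 : ℕ) : ℝ) - 1) = m := by push_cast; ring
    rw [uniformL1Sphere, hdim, ProbabilityTheory.cond, Measure.map_smul, ← hS, hmap, smul_smul]
  -- The surface constant is never computed: total mass one determines it.
  have h1 := h.measure_univ
  rw [hσ, Measure.smul_apply, Measure.add_apply,
    map_apply (continuous_sphereLift i 1).measurable MeasurableSet.univ,
    map_apply (continuous_sphereLift i (-1)).measurable MeasurableSet.univ, preimage_univ,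
    preimage_univ, restrict_apply_univ, ← two_mul, smul_eq_mul] at h1
  rw [hσ, ENNReal.eq_inv_of_mul_eq_one_left h1]

end Sphere

/-! ### From sphere means to gradients of ball averages -/

section Smoothing

open Measure Set

theorem measurable_realSign : Measurable Real.sign := by
  have : Real.sign = fun r : ℝ => if r < 0 then -1 else if 0 < r then 1 else 0 := rfl
  rw [this]
  exact Measurable.ite measurableSet_Iio measurable_const
    (Measurable.ite measurableSet_Ioi measurable_const measurable_const)

theorem volume_l1Ball (m : ℕ) : volume (l1Ball m) = ENNReal.ofReal (2 ^ m / m.factorial) := by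
  have h := volume_sum_rpow_lt_one (Fin m) (p := 1) le_rfl
  simp only [Real.rpow_one, Fintype.card_fin, div_one, Real.Gamma_nat_eq_factorial] at h
  have h2 : Real.Gamma (1 + 1) = 1 := by rw [one_add_one_eq_two, Real.Gamma_two]
  rw [h2, mul_one] at h
  exact h

theorem volume_real_l1Ball (m : ℕ) : volume.real (l1Ball m) = 2 ^ m / m.factorial := by
  rw [measureReal_def, volume_l1Ball, ENNReal.toReal_ofReal (by positivity)]

theorem volume_real_l1Ball_pos (m : ℕ) : 0 < volume.real (l1Ball m) := by
  rw [volume_real_l1Ball]; positivity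

/-- The source of the factor `n` in the estimator: it converts the normalization on the sphere into
the one on the ball. -/
theorem volume_real_l1Ball_succ (m : ℕ) :
    (m + 1) * volume.real (l1Ball (m + 1)) = 2 * volume.real (l1Ball m) := by
  rw [volume_real_l1Ball, volume_real_l1Ball, Nat.factorial_succ]
  have : (m.factorial : ℝ) ≠ 0 := by positivity
  push_cast
  field_simp
  ring

theorem l1Ball_subset_closedBall (m : ℕ) : l1Ball m ⊆ Metric.closedBall 0 1 := fun u hu => by
  rw [mem_closedBall_zero_iff, pi_norm_le_iff_of_nonneg zero_le_one]
  intro i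
  exact (Finset.single_le_sum (f := fun j => |u j|) (fun j _ => abs_nonneg _)
    (Finset.mem_univ i)).trans (le_of_lt hu)

theorem _root_.Continuous.integrableOn_l1Ball {m : ℕ} {g : (Fin m → ℝ) → ℝ} (hg : Continuous g) :
    IntegrableOn g (l1Ball m) :=
  (hg.locallyIntegrable.integrableOn_isCompact (isCompact_closedBall 0 1)).mono_set
    (l1Ball_subset_closedBall m)

variable {m : ℕ}

theorem insertNth_mem_l1Ball {i : Fin (m + 1)} {t : ℝ} {u : Fin m → ℝ} :
    (i.insertNth t u : Fin (m + 1) → ℝ) ∈ l1Ball (m + 1) ↔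
      t ∈ Ioo (-(1 - ∑ j, |u j|)) (1 - ∑ j, |u j|) := by
  have : ∑ k, |(i.insertNth t u : Fin (m + 1) → ℝ) k| = |t| + ∑ j, |u j| := by
    rw [Fin.sum_univ_succAbove _ i]; simp
  rw [mem_Ioo, ← abs_lt, l1Ball, mem_ofPred_eq, this, lt_sub_iff_add_lt]

/-- The divergence theorem on the ℓ¹ ball, for one partial derivative. -/
theorem setIntegral_lineDeriv_l1Ball {q : (Fin (m + 1) → ℝ) → ℝ} {K : NNReal}
    (hq : LipschitzWith K q) (i : Fin (m + 1)) :
    ∫ v in l1Ball (m + 1), lineDeriv ℝ q v (Pi.single i 1)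
      = ∫ u in l1Ball m, (q (sphereLift i 1 u) - q (sphereLift i (-1) u)) := by
  have hB := measurableSet_l1Ball (m + 1)
  set D : (Fin (m + 1) → ℝ) → ℝ := fun v => lineDeriv ℝ q v (Pi.single i 1) with hD
  have hDm : Measurable D := measurable_lineDeriv hq.continuous
  have hDint : IntegrableOn D (l1Ball (m + 1)) := by
    refine Measure.integrableOn_of_bounded (M := K * ‖(Pi.single i 1 : Fin (m + 1) → ℝ)‖) ?_
      hDm.aestronglyMeasurable (Filter.Eventually.of_forall fun v => ?_)
    · rw [volume_l1Ball]; exact ENNReal.ofReal_ne_top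
    · exact norm_lineDeriv_le_of_lipschitz ℝ hq
  have hmp := (volume_preserving_piFinSuccAbove (fun _ : Fin (m + 1) => ℝ) i).symm
  have hline : ∀ (u : Fin m → ℝ) (t : ℝ),
      D (i.insertNth t u) = deriv (fun s => q (i.insertNth s u)) t := by
    intro u t
    have h1 : ∀ s, (i.insertNth t u + s • Pi.single i 1 : Fin (m + 1) → ℝ)
        = i.insertNth (t + s) u := by
      intro s
      ext k
      refine Fin.succAboveCases i ?_ (fun j => ?_) k
      · simp
      · simp [Fin.succAbove_ne]
    simp only [hD, lineDeriv, h1]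
    rw [deriv_comp_const_add (f := fun s => q (i.insertNth s u)) t 0, add_zero]
  rw [← integral_indicator hB, ← hmp.integral_comp', ← integral_indicator (measurableSet_l1Ball m)]
  have hint : Integrable (fun p : ℝ × (Fin m → ℝ) => (l1Ball (m + 1)).indicator D
      ((MeasurableEquiv.piFinSuccAbove (fun _ : Fin (m + 1) => ℝ) i).symm p)) :=
    hmp.integrable_comp_of_integrable (hDint.integrable_indicator hB)
  rw [show (volume : Measure (ℝ × (Fin m → ℝ))) = volume.prod volume from rfl] at hint ⊢
  -- Fubini with the coordinate `i` innermost: each line in that direction meets the ball in an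
  -- interval whose endpoints are the two lifts of `u`, or not at all.
  rw [integral_prod_symm _ hint]
  congr 1
  ext u
  have hins : ∀ t, (MeasurableEquiv.piFinSuccAbove (fun _ : Fin (m + 1) => ℝ) i).symm (t, u)
    = i.insertNth t u := fun t => rfl
  simp only [hins]
  have hind : ∀ t, (l1Ball (m + 1)).indicator D (i.insertNth t u)
      = (Ioo (-(1 - ∑ j, |u j|)) (1 - ∑ j, |u j|)).indicator
        (fun t => deriv (fun s => q (i.insertNth s u)) t) t := by
    intro t
    simp only [indicator, insertNth_mem_l1Ball, hline]
  simp only [hind]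
  rw [integral_indicator measurableSet_Ioo]
  by_cases hu : u ∈ l1Ball m
  · rw [indicator_of_mem hu]
    have hpos : 0 < 1 - ∑ j, |u j| := sub_pos.2 hu
    have hlip : LipschitzWith K fun s : ℝ => q (i.insertNth s u) := by
      have : LipschitzWith 1 fun s : ℝ => (i.insertNth s u : Fin (m + 1) → ℝ) := by
        refine LipschitzWith.of_dist_le_mul fun s t => ?_
        rw [NNReal.coe_one, one_mul, dist_pi_le_iff dist_nonneg]
        intro k
        refine Fin.succAboveCases i ?_ (fun j => ?_) k
        · simp
        · simp [dist_nonneg]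
      simpa [Function.comp_def] using hq.comp this
    -- A Lipschitz function is absolutely continuous, so the fundamental theorem of calculus holds
    -- without differentiability everywhere.
    rw [← integral_Ioc_eq_integral_Ioo, ← intervalIntegral.integral_of_le (by linarith),
      (hlip.lipschitzOnWith.absolutelyContinuousOnInterval).integral_deriv_eq_sub]
    simp [sphereLift]
  · rw [indicator_of_notMem hu, Ioo_eq_empty, setIntegral_empty]
    have : 1 ≤ ∑ j, |u j| := not_lt.1 hu
    linarith

/-- The mean of `q(e) sign(eᵢ)` over the ℓ¹ sphere is the mean of the partial derivative of `q` over
the ℓ¹ ball, up to the factor `1 / n`. -/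
theorem integral_mul_sign_uniformL1Sphere (hσ : IsProbabilityMeasure (uniformL1Sphere (m + 1)))
    {q : (Fin (m + 1) → ℝ) → ℝ} {K : NNReal} (hq : LipschitzWith K q) (i : Fin (m + 1)) :
    (m + 1) * ∫ e, q e * Real.sign (e i) ∂(uniformL1Sphere (m + 1))
      = (volume.real (l1Ball (m + 1)))⁻¹ *
        ∫ v in l1Ball (m + 1), lineDeriv ℝ q v (Pi.single i 1) := by
  have hmeas : Measurable fun e : Fin (m + 1) → ℝ => q e * Real.sign (e i) :=
    hq.continuous.measurable.mul (measurable_realSign.comp (measurable_pi_apply i))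
  have hcomp : ∀ τ : ℝ, (τ = 1 ∨ τ = -1) →
      Integrable (fun e => q e * Real.sign (e i))
        ((volume.restrict (l1Ball m)).map (sphereLift i τ)) ∧
      ∫ e, q e * Real.sign (e i) ∂((volume.restrict (l1Ball m)).map (sphereLift i τ))
        = ∫ u in l1Ball m, q (sphereLift i τ u) * τ := by
    intro τ hτ
    have hae : (fun u => q (sphereLift i τ u) * Real.sign (sphereLift i τ u i))
        =ᵐ[volume.restrict (l1Ball m)] fun u => q (sphereLift i τ u) * τ := by
      filter_upwards [ae_restrict_mem (measurableSet_l1Ball m)] with u hu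
      have : 0 < 1 - ∑ j, |u j| := sub_pos.2 hu
      rcases hτ with rfl | rfl
      · rw [sphereLift_self, one_mul, Real.sign_of_pos this]
      · rw [sphereLift_self, neg_one_mul, Real.sign_of_neg (neg_neg_of_pos this)]
    constructor
    · rw [integrable_map_measure hmeas.aestronglyMeasurable
        (continuous_sphereLift i τ).aemeasurable]
      refine Integrable.congr ?_ hae.symm
      exact ((hq.continuous.comp (continuous_sphereLift i τ)).mul
        continuous_const).integrableOn_l1Ball
    · rw [integral_map (continuous_sphereLift i τ).aemeasurable hmeas.aestronglyMeasurable]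
      exact integral_congr_ae hae
  have hi : ∀ τ, IntegrableOn (fun u => q (sphereLift i τ u)) (l1Ball m) := fun τ =>
    (hq.continuous.comp (continuous_sphereLift i τ)).integrableOn_l1Ball
  rw [setIntegral_lineDeriv_l1Ball hq i, integral_sub (hi 1) (hi (-1)),
    uniformL1Sphere_eq hσ i, integral_smul_measure,
    integral_add_measure (hcomp 1 (Or.inl rfl)).1 (hcomp (-1) (Or.inr rfl)).1,
    (hcomp 1 (Or.inl rfl)).2, (hcomp (-1) (Or.inr rfl)).2]
  have hV : ((2 * volume (l1Ball m))⁻¹).toReal = (2 * volume.real (l1Ball m))⁻¹ := by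
    rw [ENNReal.toReal_inv, ENNReal.toReal_mul, measureReal_def]; rfl
  rw [hV, ← volume_real_l1Ball_succ]
  have h1 := volume_real_l1Ball_pos (m + 1)
  simp only [mul_one, mul_neg, integral_neg, smul_eq_mul]
  have : (m + 1 : ℝ) ≠ 0 := by positivity
  field_simp
  ring

/-- The case `q = 1` of the sphere formula. This zero mean is what removes the noise and the value
at the unshifted point. -/
theorem integral_sign_uniformL1Sphere (hσ : IsProbabilityMeasure (uniformL1Sphere (m + 1)))
    (i : Fin (m + 1)) : ∫ e, Real.sign (e i) ∂(uniformL1Sphere (m + 1)) = 0 := by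
  have h := integral_mul_sign_uniformL1Sphere hσ (LipschitzWith.const (1 : ℝ)) i
  have h0 : ∀ v, lineDeriv ℝ (fun _ : Fin (m + 1) → ℝ => (1 : ℝ)) v (Pi.single i 1) = 0 :=
    fun v => by simp [lineDeriv]
  simp only [one_mul, h0, integral_zero, mul_zero] at h
  exact (mul_eq_zero.1 h).resolve_left (by positivity)

theorem ae_uniformL1Sphere (hσ : IsProbabilityMeasure (uniformL1Sphere (m + 1))) :
    ∀ᵐ e ∂(uniformL1Sphere (m + 1)), ∑ i, |e i| = 1 := by
  have hm : MeasurableSet {e : Fin (m + 1) → ℝ | ∑ i, |e i| = 1} :=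
    (isClosed_eq continuous_l1Norm continuous_const).measurableSet
  rw [uniformL1Sphere_eq hσ 0]
  refine ae_smul_measure (ae_add_measure_iff.2 ⟨?_, ?_⟩) _
  · rw [ae_map_iff (continuous_sphereLift 0 1).aemeasurable hm]
    filter_upwards [ae_restrict_mem (measurableSet_l1Ball m)] with u hu
    exact sum_abs_sphereLift (by simp) hu
  · rw [ae_map_iff (continuous_sphereLift 0 (-1)).aemeasurable hm]
    filter_upwards [ae_restrict_mem (measurableSet_l1Ball m)] with u hu
    exact sum_abs_sphereLift (by simp) hu

/-- The mean of the one-point estimator is an approximate subgradient. -/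
theorem sub_le_sum_integral_estimator (hσ : IsProbabilityMeasure (uniformL1Sphere (m + 1)))
    {U : Set (Fin (m + 1) → ℝ)} {g : (Fin (m + 1) → ℝ) → ℝ} {K : NNReal}
    (hg : LipschitzWith K g) (hconv : ConvexOn ℝ U g) {M μ : ℝ} (hμ : 0 < μ)
    {x y : Fin (m + 1) → ℝ} (hx : ∀ d : Fin (m + 1) → ℝ, ∑ i, |d i| < 1 → x + μ • d ∈ U)
    (hy : ∀ d : Fin (m + 1) → ℝ, ∑ i, |d i| < 1 → y + μ • d ∈ U)
    (hlip : ∀ d : Fin (m + 1) → ℝ, ∑ i, |d i| < 1 → g (y + μ • d) ≤ g y + M * μ) :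
    g x - g y - M * μ ≤ ∑ i, ((m + 1) / μ *
      ∫ e, g (x + μ • e) * Real.sign (e i) ∂(uniformL1Sphere (m + 1))) * (x i - y i) := by
  set B := l1Ball (m + 1) with hBdef
  have hB : MeasurableSet B := measurableSet_l1Ball (m + 1)
  set V := volume.real B with hV
  have hVpos : 0 < V := volume_real_l1Ball_pos (m + 1)
  have hBfin : volume B ≠ ⊤ := by rw [hBdef, volume_l1Ball]; exact ENNReal.ofReal_ne_top
  set q : (Fin (m + 1) → ℝ) → ℝ := fun v => g (x + μ • v) with hq
  obtain ⟨L, hqL⟩ : ∃ L, LipschitzWith L q := by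
    refine ⟨K * (0 + ‖μ‖₊), hg.comp ((LipschitzWith.const x).add ?_)⟩
    exact lipschitzWith_smul μ
  set q' : (Fin (m + 1) → ℝ) → ℝ := fun v => g (y + μ • v) with hq'
  have hq'c : Continuous q' := hg.continuous.comp (by fun_prop)
  have hD : ∀ i, IntegrableOn (fun v => lineDeriv ℝ q v (Pi.single i 1)) B := fun i =>
    Measure.integrableOn_of_bounded (M := L * ‖(Pi.single i 1 : Fin (m + 1) → ℝ)‖) hBfin
      (measurable_lineDeriv hqL.continuous).aestronglyMeasurable
      (Filter.Eventually.of_forall fun v => norm_lineDeriv_le_of_lipschitz ℝ hqL)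
  -- By Rademacher's theorem `q` is differentiable almost everywhere. The gradient inequality at `v`
  -- is applied with endpoint `v + (y - x) / μ`, where `q` takes the value `g (y + μ v)`.
  have hkey : ∀ᵐ v ∂(volume.restrict B),
      ∑ i, lineDeriv ℝ q v (Pi.single i 1) * ((y i - x i) / μ) ≤ q' v - q v := by
    filter_upwards [ae_restrict_of_ae hqL.ae_differentiableAt, ae_restrict_mem hB] with v hv hvB
    have hconv' : ConvexOn ℝ {w | x + μ • w ∈ U} q := by
      have := hconv.comp_affineMap
        (AffineMap.const ℝ (Fin (m + 1) → ℝ) x + (μ • LinearMap.id).toAffineMap)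
      exact this
    have hdir : ∑ i, lineDeriv ℝ q v (Pi.single i 1) * ((y i - x i) / μ)
        = fderiv ℝ q v ((v + μ⁻¹ • (y - x)) - v) := by
      rw [add_sub_cancel_left]
      conv_rhs => rw [pi_eq_sum_univ' (μ⁻¹ • (y - x)), _root_.map_sum]
      refine Finset.sum_congr rfl fun i _ => ?_
      rw [map_smul, hv.lineDeriv_eq_fderiv, smul_eq_mul, mul_comm]
      congr 1
      simp only [Pi.smul_apply, Pi.sub_apply, smul_eq_mul]
      ring
    have hxy : x + μ • (v + μ⁻¹ • (y - x)) = y + μ • v := by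
      rw [smul_add, smul_inv_smul₀ hμ.ne']; abel
    have := add_fderiv_le hconv' (z := v) (y := v + μ⁻¹ • (y - x)) (hx v hvB)
      (by rw [mem_ofPred_eq, hxy]; exact hy v hvB) hv
    rw [hdir, le_sub_iff_add_le']
    refine this.trans_eq ?_
    simp only [hq, hq', hxy]
  have hqi : IntegrableOn q B := hqL.continuous.integrableOn_l1Ball
  have hq'i : IntegrableOn q' B := hq'c.integrableOn_l1Ball
  have hsum : ∑ i, ((m + 1) / μ * ∫ e, g (x + μ • e) * Real.sign (e i)
      ∂(uniformL1Sphere (m + 1))) * (x i - y i)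
      = - (V⁻¹ * ∫ v in B, ∑ i, lineDeriv ℝ q v (Pi.single i 1) * ((y i - x i) / μ)) := by
    rw [integral_finsetSum _ fun i _ => (hD i).mul_const _, Finset.mul_sum,
      ← Finset.sum_neg_distrib]
    refine Finset.sum_congr rfl fun i _ => ?_
    rw [integral_mul_const, ← mul_assoc, ← integral_mul_sign_uniformL1Sphere hσ hqL i]
    ring
  have hint : ∫ v in B, ∑ i, lineDeriv ℝ q v (Pi.single i 1) * ((y i - x i) / μ)
      ≤ (∫ v in B, q' v) - ∫ v in B, q v := by
    rw [← integral_sub hq'i hqi]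
    exact integral_mono_ae (integrable_finsetSum _ fun i _ => (hD i).mul_const _)
      (hq'i.sub hqi) hkey
  have hupper : ∫ v in B, q' v ≤ V * (g y + M * μ) := by
    have := setIntegral_mono_on hq'i (integrableOn_const hBfin) hB fun v hv => hlip v hv
    rwa [setIntegral_const, smul_eq_mul] at this
  -- The ball is symmetric and `x` is the midpoint of `x + μ v` and `x - μ v`, so by convexity
  -- averaging does not decrease the value.
  have hlower : V * g x ≤ ∫ v in B, q v := by
    have hneg : ∫ v in B, q (-v) = ∫ v in B, q v := by
      have hpre : (fun v : Fin (m + 1) → ℝ => -v) ⁻¹' B = B := by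
        ext v; simp [hBdef, l1Ball]
      have := (Measure.measurePreserving_neg (volume : Measure (Fin (m + 1) → ℝ))
        ).setIntegral_preimage_emb (Homeomorph.neg _).measurableEmbedding q B
      rwa [hpre] at this
    have hqn : IntegrableOn (fun v => q (-v)) B :=
      (hqL.continuous.comp continuous_neg).integrableOn_l1Ball
    have h2 : ∫ _ in B, 2 * g x ≤ ∫ v in B, (q v + q (-v)) := by
      refine setIntegral_mono_on (integrableOn_const hBfin) (hqi.add hqn) hB fun v hv => ?_
      have h := hconv.2 (hx v hv) (hx (-v) (by simpa using (show ∑ i, |v i| < 1 from hv)))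
        (show (0 : ℝ) ≤ 1 / 2 by norm_num) (show (0 : ℝ) ≤ 1 / 2 by norm_num) (by norm_num)
      have hmid : (1 / 2 : ℝ) • (x + μ • v) + (1 / 2 : ℝ) • (x + μ • -v) = x := by
        ext i; simp; ring
      rw [hmid] at h
      simp only [hq, smul_eq_mul] at h ⊢
      linarith
    rw [setIntegral_const, smul_eq_mul, integral_add hqi hqn, hneg] at h2
    linarith
  rw [hsum]
  have : V⁻¹ * ∫ v in B, ∑ i, lineDeriv ℝ q v (Pi.single i 1) * ((y i - x i) / μ)
      ≤ g y + M * μ - g x := by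
    rw [inv_mul_le_iff₀ hVpos]
    linarith
  linarith

end Smoothing

/-! ### Mean-square Lipschitz property of the realizations -/

section MeanSquare

variable {n : ℕ} {H : Type*} [MeasurableSpace H]

theorem sub_le_of_mem_subdifferential {U : Set (Fin n → ℝ)} {φ : (Fin n → ℝ) → ℝ}
    {z y g : Fin n → ℝ} (hg : g ∈ subdifferential U φ z) (hy : y ∈ U) :
    φ z - φ y ≤ ‖g‖ * ∑ i, |y i - z i| := by
  have h1 := hg y hy
  have h2 := neg_le_of_abs_le (abs_sum_mul_le g fun i => y i - z i)
  linarith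

/-- A convex function cannot be smaller at both endpoints than at the midpoint, so at most one of
the two drops is positive. This saves a factor `2`; the cases `p = z` and `r = z` serve the ends of
a chain. -/
theorem sq_posPart_add_sq_posPart_le {U : Set (Fin n → ℝ)} {φ : (Fin n → ℝ) → ℝ}
    (hφ : ConvexOn ℝ U φ) {p z r g : Fin n → ℝ} (hp : p ∈ U) (hr : r ∈ U)
    (hz : p = z ∨ r = z ∨ z = (1 / 2 : ℝ) • p + (1 / 2 : ℝ) • r)
    (hg : g ∈ subdifferential U φ z) {l : ℝ} (hpl : ∑ i, |p i - z i| ≤ l)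
    (hrl : ∑ i, |r i - z i| ≤ l) :
    max 0 (φ z - φ p) ^ 2 + max 0 (φ z - φ r) ^ 2 ≤ l ^ 2 * ‖g‖ ^ 2 := by
  have hl : 0 ≤ l := (Finset.sum_nonneg fun i _ => abs_nonneg _).trans hpl
  have hgl : 0 ≤ l * ‖g‖ := mul_nonneg hl (norm_nonneg g)
  have h1 : max 0 (φ z - φ p) ≤ l * ‖g‖ := max_le hgl
    ((sub_le_of_mem_subdifferential hg hp).trans
      ((mul_le_mul_of_nonneg_left hpl (norm_nonneg g)).trans_eq (mul_comm _ _)))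
  have h2 : max 0 (φ z - φ r) ≤ l * ‖g‖ := max_le hgl
    ((sub_le_of_mem_subdifferential hg hr).trans
      ((mul_le_mul_of_nonneg_left hrl (norm_nonneg g)).trans_eq (mul_comm _ _)))
  have h3 : max 0 (φ z - φ p) = 0 ∨ max 0 (φ z - φ r) = 0 := by
    rcases hz with rfl | rfl | hz
    · left; simp
    · right; simp
    · have := hφ.2 hp hr (show (0 : ℝ) ≤ 1 / 2 by norm_num) (show (0 : ℝ) ≤ 1 / 2 by norm_num)
        (by norm_num)
      rw [← hz] at this
      simp only [smul_eq_mul] at this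
      rcases le_total (φ z) (φ p) with h | h
      · left; rw [max_eq_left]; linarith
      · right; rw [max_eq_left]; linarith
  rw [← mul_pow]
  rcases h3 with h | h <;> rw [h]
  · simpa using pow_le_pow_left₀ (le_max_left _ _) h2 2
  · simpa using pow_le_pow_left₀ (le_max_left _ _) h1 2

/-- Cauchy-Schwarz over the `m` increments, each then charged to its higher endpoint. The
truncations `0 - 1 = 0` and `min (m + 1) m = m` make the terms beyond both ends vanish. -/
theorem sq_sub_le_mul_sum_posPart (m : ℕ) (c : ℕ → ℝ) :
    (c m - c 0) ^ 2 ≤ ∑ j ∈ Finset.range (m + 1),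
      m * (max 0 (c j - c (j - 1)) ^ 2 + max 0 (c j - c (min (j + 1) m)) ^ 2) := by
  have h0 : ∀ a : ℝ, a ^ 2 = max 0 a ^ 2 + max 0 (-a) ^ 2 := by
    intro a
    rcases le_total 0 a with h | h
    · rw [max_eq_right h, max_eq_left (by linarith)]; ring
    · rw [max_eq_left h, max_eq_right (by linarith)]; ring
  rw [← Finset.mul_sum, Finset.sum_add_distrib, Finset.sum_range_succ',
    Finset.sum_range_succ (fun j => max 0 (c j - c (min (j + 1) m)) ^ 2)]
  have h1 : ∑ j ∈ Finset.range m, max 0 (c j - c (min (j + 1) m)) ^ 2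
      = ∑ j ∈ Finset.range m, max 0 (-(c (j + 1) - c j)) ^ 2 :=
    Finset.sum_congr rfl fun j hj => by
      rw [min_eq_left (Nat.succ_le_of_lt (Finset.mem_range.1 hj)), neg_sub]
  rw [h1, ← Finset.sum_range_sub]
  simp only [Nat.add_sub_cancel, Nat.zero_sub, sub_self, max_self,
    min_eq_right (Nat.le_succ m), ne_eq, OfNat.ofNat_ne_zero, not_false_eq_true, zero_pow, add_zero]
  rw [← Finset.sum_add_distrib, ← Finset.sum_congr rfl fun j _ => h0 (c (j + 1) - c j)]
  simpa using sq_sum_le_card_mul_sum_sq (s := Finset.range m) (f := fun j => c (j + 1) - c j)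

/-- The mean-square Lipschitz property, a consequence of the mean-square bound on subgradients. -/
theorem lintegral_sq_sub_le {U : Set (Fin n → ℝ)} (hU : IsOpen U) (hUc : Convex ℝ U)
    {F : (Fin n → ℝ) → H → ℝ} {ν : Measure H} {M : ℝ} (hF : ∀ x ∈ U, Measurable (F x))
    (h1 : ConvexRealizations U F ν) (h3 : SquareBoundedSubgradients U F ν M)
    {x y : Fin n → ℝ} (hx : x ∈ U) (hy : y ∈ U) :
    ∫⁻ h, ENNReal.ofReal ((F y h - F x h) ^ 2) ∂ν
      ≤ ENNReal.ofReal ((M * ∑ i, |y i - x i|) ^ 2) := by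
  set L := ∑ i, |y i - x i| with hL
  have hL0 : 0 ≤ L := Finset.sum_nonneg fun i _ => abs_nonneg _
  -- The moment bound holds point by point, so the segment is cut by `m + 1` equally spaced nodes.
  -- Each node contributes `m (L / m)² M²`, in total `(M L)² (1 + 1 / m)`, and `m → ∞` gives the
  -- sharp constant.
  have key : ∀ k : ℕ, ∫⁻ h, ENNReal.ofReal ((F y h - F x h) ^ 2) ∂ν
      ≤ ENNReal.ofReal ((M * L) ^ 2 * (1 + 1 / ((k : ℝ) + 1))) := by
    intro k
    set m := k + 1 with hm
    have hm0 : (0 : ℝ) < m := by positivity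
    let z : ℕ → Fin n → ℝ := fun j => x + ((j : ℝ) / m) • (y - x)
    have hz : ∀ j ≤ m, z j ∈ U := fun j hj =>
      hUc.add_smul_sub_mem hx hy ⟨by positivity, (div_le_one hm0).2 (by exact_mod_cast hj)⟩
    have hz0 : z 0 = x := by simp [z]
    have hzm : z m = y := by simp [z]
    have hdist : ∀ j, ∑ i, |z (j + 1) i - z j i| ≤ L / m := by
      intro j
      have : ∀ i, |z (j + 1) i - z j i| = (1 / m) * |y i - x i| := by
        intro i
        rw [← abs_of_pos (show (0 : ℝ) < 1 / m by positivity), ← abs_mul]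
        congr 1
        simp only [z, Pi.add_apply, Pi.smul_apply, Pi.sub_apply, smul_eq_mul]
        push_cast; field_simp; ring
      rw [Finset.sum_congr rfl fun i _ => this i, ← Finset.mul_sum, ← hL, one_div_mul_eq_div]
    have hLm : 0 ≤ L / m := by positivity
    let T : ℕ → H → ℝ := fun j h => m * (max 0 (F (z j) h - F (z (j - 1)) h) ^ 2 +
      max 0 (F (z j) h - F (z (min (j + 1) m)) h) ^ 2)
    have hTm : ∀ j ∈ Finset.range (m + 1), Measurable fun h => ENNReal.ofReal (T j h) := by
      intro j hj
      have hj' : j ≤ m := Nat.lt_succ_iff.1 (Finset.mem_range.1 hj)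
      have m1 := hF _ (hz j hj')
      have m2 := hF _ (hz (j - 1) (by omega))
      have m3 := hF _ (hz (min (j + 1) m) (by omega))
      fun_prop
    have hT : ∀ j ∈ Finset.range (m + 1), ∫⁻ h, ENNReal.ofReal (T j h) ∂ν
        ≤ ENNReal.ofReal (m * (L / m) ^ 2) * ENNReal.ofReal (M ^ 2) := by
      intro j hj
      have hj' : j ≤ m := Nat.lt_succ_iff.1 (Finset.mem_range.1 hj)
      refine le_trans ?_ (mul_le_mul_right (h3 (z j) (hz j hj')) _)
      -- This form, for a finite constant, requires no measurability of the supremum over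
      -- subgradients.
      rw [← lintegral_const_mul' _ _ ENNReal.ofReal_ne_top]
      refine lintegral_mono_ae ?_
      filter_upwards [h1] with h hh
      obtain ⟨g, hg⟩ := subdifferential_nonempty hU hh (hz j hj')
      have hle : T j h ≤ m * (L / m) ^ 2 * ‖g‖ ^ 2 := by
        rw [mul_assoc]
        refine mul_le_mul_of_nonneg_left ?_ hm0.le
        refine sq_posPart_add_sq_posPart_le hh (hz (j - 1) (by omega))
          (hz (min (j + 1) m) (by omega)) ?_ hg ?_ ?_
        · rcases Nat.eq_zero_or_pos j with rfl | hpos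
          · left; rfl
          · rcases hj'.eq_or_lt with rfl | hlt
            · right; left; rw [min_eq_right (Nat.le_succ _)]
            · right; right
              obtain ⟨j, rfl⟩ := Nat.exists_eq_add_of_lt hpos
              rw [min_eq_left hlt]
              ext i
              simp only [z, Pi.add_apply, Pi.smul_apply, Pi.sub_apply, smul_eq_mul, zero_add,
                Nat.add_sub_cancel]
              push_cast; field_simp; ring
        · rcases Nat.eq_zero_or_pos j with rfl | hpos
          · simpa using hLm
          · obtain ⟨j, rfl⟩ := Nat.exists_eq_add_of_lt hpos
            simp only [zero_add, Nat.add_sub_cancel]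
            simpa only [abs_sub_comm] using hdist j
        · rcases hj'.eq_or_lt with rfl | hlt
          · simpa using hLm
          · rw [min_eq_left hlt]; exact hdist j
      calc ENNReal.ofReal (T j h) ≤ ENNReal.ofReal (m * (L / m) ^ 2 * ‖g‖ ^ 2) :=
            ENNReal.ofReal_le_ofReal hle
        _ = ENNReal.ofReal (m * (L / m) ^ 2) * ‖g‖ₑ ^ 2 := by
            rw [ENNReal.ofReal_mul (by positivity), ENNReal.ofReal_pow (norm_nonneg g),
              ofReal_norm]
        _ ≤ _ := mul_le_mul_right (le_iSup₂ (f := fun (g : Fin n → ℝ)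
            (_ : g ∈ subdifferential U (fun x => F x h) (z j)) => ‖g‖ₑ ^ 2) g hg) _
    calc ∫⁻ h, ENNReal.ofReal ((F y h - F x h) ^ 2) ∂ν
        ≤ ∫⁻ h, ∑ j ∈ Finset.range (m + 1), ENNReal.ofReal (T j h) ∂ν := by
          refine lintegral_mono fun h => ?_
          rw [← ENNReal.ofReal_sum_of_nonneg fun j _ => by positivity]
          refine ENNReal.ofReal_le_ofReal ?_
          have := sq_sub_le_mul_sum_posPart m fun j => F (z j) h
          simpa only [hz0, hzm] using this
      _ = ∑ j ∈ Finset.range (m + 1), ∫⁻ h, ENNReal.ofReal (T j h) ∂ν :=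
          lintegral_finsetSum' _ fun j hj => (hTm j hj).aemeasurable
      _ ≤ ∑ _j ∈ Finset.range (m + 1),
            ENNReal.ofReal (m * (L / m) ^ 2) * ENNReal.ofReal (M ^ 2) := Finset.sum_le_sum hT
      _ = ENNReal.ofReal ((M * L) ^ 2 * (1 + 1 / ((k : ℝ) + 1))) := by
          rw [Finset.sum_const, Finset.card_range, nsmul_eq_mul,
            ← ENNReal.ofReal_mul (by positivity), ← ENNReal.ofReal_natCast,
            ← ENNReal.ofReal_mul (by positivity)]
          congr 1
          rw [hm]; push_cast; field_simp
  have hlim : Filter.Tendsto (fun k : ℕ => ENNReal.ofReal ((M * L) ^ 2 * (1 + 1 / ((k : ℝ) + 1))))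
      Filter.atTop (nhds (ENNReal.ofReal ((M * L) ^ 2))) := by
    refine ENNReal.tendsto_ofReal ?_
    have := (tendsto_one_div_add_atTop_nhds_zero_nat (𝕜 := ℝ)).const_add 1
    simpa using this.const_mul ((M * L) ^ 2)
  exact ge_of_tendsto' hlim key

theorem integral_sq_le_of_lintegral_le {Ω : Type*} [MeasurableSpace Ω] {P : Measure Ω} {D : Ω → ℝ}
    (hD : Measurable D) {c : ℝ} (h : ∫⁻ ω, ENNReal.ofReal (D ω ^ 2) ∂P ≤ ENNReal.ofReal (c ^ 2)) :
    Integrable (fun ω => D ω ^ 2) P ∧ ∫ ω, D ω ^ 2 ∂P ≤ c ^ 2 := by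
  have hi : Integrable (fun ω => D ω ^ 2) P := by
    refine ⟨(hD.pow_const 2).aestronglyMeasurable, ?_⟩
    rw [hasFiniteIntegral_iff_ofReal (Filter.Eventually.of_forall fun ω => sq_nonneg _)]
    exact h.trans_lt ENNReal.ofReal_lt_top
  refine ⟨hi, ?_⟩
  rw [← ENNReal.ofReal_le_ofReal_iff (sq_nonneg c), ofReal_integral_eq_lintegral_ofReal hi
    (Filter.Eventually.of_forall fun ω => sq_nonneg _)]
  exact h

/-- Nonnegativity of the variance. -/
theorem abs_integral_le_of_integral_sq_le {Ω : Type*} [MeasurableSpace Ω] {P : Measure Ω}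
    [IsProbabilityMeasure P] {D : Ω → ℝ} (hD : Integrable D P)
    (hi : Integrable (fun ω => D ω ^ 2) P) {c : ℝ} (hc : 0 ≤ c) (h : ∫ ω, D ω ^ 2 ∂P ≤ c ^ 2) :
    |∫ ω, D ω ∂P| ≤ c := by
  refine abs_le_of_sq_le_sq ?_ hc
  have := variance_nonneg D P
  rw [variance_eq_sub ((memLp_two_iff_integrable_sq hD.aestronglyMeasurable).2 hi)] at this
  simp only [Pi.pow_apply] at this
  linarith

theorem abs_objective_sub_le {U : Set (Fin n → ℝ)} (hU : IsOpen U) (hUc : Convex ℝ U)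
    {F : (Fin n → ℝ) → H → ℝ} {ν : Measure H} [IsProbabilityMeasure ν] {M : ℝ} (hM : 0 ≤ M)
    (hF : IntegrableValues U F ν) (h1 : ConvexRealizations U F ν)
    (h3 : SquareBoundedSubgradients U F ν M) {x y : Fin n → ℝ} (hx : x ∈ U) (hy : y ∈ U) :
    |objective F ν y - objective F ν x| ≤ M * ∑ i, |y i - x i| := by
  have h := integral_sq_le_of_lintegral_le ((hF y hy).1.sub (hF x hx).1)
    (lintegral_sq_sub_le hU hUc (fun z hz => (hF z hz).1) h1 h3 hx hy)
  rw [objective, objective, ← integral_sub (hF y hy).2 (hF x hx).2]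
  exact abs_integral_le_of_integral_sq_le ((hF y hy).2.sub (hF x hx).2) h.1
    (mul_nonneg hM (Finset.sum_nonneg fun i _ => abs_nonneg _)) h.2

theorem convexOn_objective {U : Set (Fin n → ℝ)} (hUc : Convex ℝ U)
    {F : (Fin n → ℝ) → H → ℝ} {ν : Measure H} (hF : IntegrableValues U F ν)
    (h1 : ConvexRealizations U F ν) : ConvexOn ℝ U (objective F ν) := by
  refine ⟨hUc, fun x hx y hy s t hs ht hst => ?_⟩
  simp only [objective, smul_eq_mul]
  rw [← integral_const_mul, ← integral_const_mul,
    ← integral_add ((hF x hx).2.const_mul s) ((hF y hy).2.const_mul t)]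
  refine integral_mono_ae (hF _ (hUc hx hy hs ht hst)).2
    (((hF x hx).2.const_mul s).add ((hF y hy).2.const_mul t)) ?_
  filter_upwards [h1] with h hh
  exact hh.2 hx hy hs ht hst

end MeanSquare

/-! ### Regret of entropic dual averaging -/

section Regret

variable {n : ℕ}

theorem entropicPoint_mem_stdSimplex [NeZero n] (β : ℝ) (s : Fin n → ℝ) :
    entropicPoint β s ∈ stdSimplex ℝ (Fin n) := by
  have hpos : 0 < ∑ l, Real.exp (-(1 / β) * s l) :=
    Finset.sum_pos (fun l _ => Real.exp_pos _) Finset.univ_nonempty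
  refine ⟨fun i => div_nonneg (Real.exp_pos _).le hpos.le, ?_⟩
  simp only [entropicPoint]
  rw [← Finset.sum_div, div_self hpos.ne']

/-- Hoeffding's lemma for a finite distribution. -/
theorem sum_mul_exp_le {x : Fin n → ℝ} (hx : x ∈ stdSimplex ℝ (Fin n)) {g : Fin n → ℝ} {c : ℝ}
    (hg : ∀ i, |g i| ≤ c) :
    ∑ i, x i * Real.exp (g i) ≤ Real.exp (∑ i, x i * g i + c ^ 2 / 2) := by
  let P : Measure (Fin n) := ∑ i, ENNReal.ofReal (x i) • Measure.dirac i
  have hP : IsProbabilityMeasure P := by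
    constructor
    simp only [P, Measure.coe_finsetSum, Finset.sum_apply, Measure.smul_apply, measure_univ,
      smul_eq_mul, mul_one]
    rw [← ENNReal.ofReal_sum_of_nonneg fun i _ => hx.1 i, hx.2, ENNReal.ofReal_one]
  have hint : ∀ q : Fin n → ℝ, ∫ i, q i ∂P = ∑ i, x i * q i := by
    intro q
    rw [integral_finsetSum_measure fun i _ =>
      (integrable_dirac (enorm_lt_top)).smul_measure ENNReal.ofReal_ne_top]
    refine Finset.sum_congr rfl fun i _ => ?_
    rw [integral_smul_measure, integral_dirac, ENNReal.toReal_ofReal (hx.1 i), smul_eq_mul]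
  have hc : 0 ≤ c ∨ n = 0 := by
    rcases Nat.eq_zero_or_pos n with h | h
    · exact Or.inr h
    · exact Or.inl ((abs_nonneg _).trans (hg ⟨0, h⟩))
  rcases hc with hc | rfl
  swap
  · simpa using (Real.exp_pos _).le
  -- Under the law with weights `x`, the centred `g` is sub-Gaussian with variance proxy `c²`; its
  -- moment generating function is used at `1`.
  have hsub := hasSubgaussianMGF_of_mem_Icc (μ := P) (X := g) (a := -c) (b := c)
    (Measurable.of_discrete).aemeasurable (Filter.Eventually.of_forall fun i => abs_le.1 (hg i))
  have h := hsub.mgf_le 1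
  rw [mgf, hint, hint] at h
  have hcc : (((‖c - -c‖₊ / 2) ^ 2 : NNReal) : ℝ) = c ^ 2 := by
    push_cast
    rw [sub_neg_eq_add, ← two_mul, norm_mul, Real.norm_of_nonneg hc, Real.norm_two]
    ring
  rw [hcc] at h
  simp only [one_mul, Real.exp_sub, one_pow, mul_one] at h
  simp only [mul_div_assoc', ← Finset.sum_div] at h
  rw [div_le_iff₀ (Real.exp_pos _), ← Real.exp_add] at h
  rwa [add_comm] at h

/-- The entropic potential, `β log` of the mean of `exp (-sᵢ / β)`. -/
noncomputable def potential (β : ℝ) (s : Fin n → ℝ) : ℝ :=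
  β * Real.log ((1 / n) * ∑ i, Real.exp (-(1 / β) * s i))

theorem potential_zero [NeZero n] (β : ℝ) : potential β (0 : Fin n → ℝ) = 0 := by
  have : (n : ℝ) ≠ 0 := Nat.cast_ne_zero.2 (NeZero.ne n)
  simp [potential, this]

/-- The potential increases by `β log ∑ pᵢ exp (-gᵢ / β)`, where `p` is the entropic point, and
Hoeffding's lemma with bound `c / β` applies. -/
theorem potential_add_le [NeZero n] {β : ℝ} (hβ : 0 < β) (s : Fin n → ℝ) {g : Fin n → ℝ} {c : ℝ}
    (hg : ∀ i, |g i| ≤ c) :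
    potential β (s + g) ≤ potential β s - ∑ i, g i * entropicPoint β s i + c ^ 2 / (2 * β) := by
  have hn : (0 : ℝ) < 1 / n := one_div_pos.2 (Nat.cast_pos.2 (NeZero.pos n))
  set Z := ∑ l, Real.exp (-(1 / β) * s l) with hZ
  have hpos : 0 < Z := Finset.sum_pos (fun l _ => Real.exp_pos _) Finset.univ_nonempty
  have h := sum_mul_exp_le (entropicPoint_mem_stdSimplex β s) (g := fun i => -(1 / β) * g i)
    (c := 1 / β * c) fun i => by
      rw [abs_mul, abs_neg, abs_of_pos (one_div_pos.2 hβ)]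
      exact mul_le_mul_of_nonneg_left (hg i) (one_div_pos.2 hβ).le
  have hsum : ∑ i, Real.exp (-(1 / β) * (s + g) i)
      = Z * ∑ i, entropicPoint β s i * Real.exp (-(1 / β) * g i) := by
    rw [Finset.mul_sum]
    refine Finset.sum_congr rfl fun i _ => ?_
    rw [entropicPoint, ← hZ, Pi.add_apply, mul_add, Real.exp_add]
    field_simp
  have hexp : ∑ i, entropicPoint β s i * (-(1 / β) * g i) + (1 / β * c) ^ 2 / 2
      = (1 / β) * (-∑ i, g i * entropicPoint β s i + c ^ 2 / (2 * β)) := by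
    rw [mul_add, mul_neg, Finset.mul_sum, ← Finset.sum_neg_distrib]
    congr 1
    · exact Finset.sum_congr rfl fun i _ => by ring
    · field_simp
  rw [hexp] at h
  have hlog : Real.log ((1 / n) * ∑ i, Real.exp (-(1 / β) * (s + g) i))
      ≤ Real.log ((1 / n) * Z) + (1 / β) * (-∑ i, g i * entropicPoint β s i + c ^ 2 / (2 * β)) := by
    rw [hsum, ← mul_assoc]
    refine (Real.log_le_log ?_ (mul_le_mul_of_nonneg_left h (by positivity))).trans_eq ?_
    · refine mul_pos (by positivity) (Finset.sum_pos (fun i _ => ?_) Finset.univ_nonempty)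
      exact mul_pos (div_pos (Real.exp_pos _) hpos) (Real.exp_pos _)
    · rw [Real.log_mul (by positivity) (Real.exp_pos _).ne', Real.log_exp]
  rw [potential, potential, ← hZ]
  refine (mul_le_mul_of_nonneg_left hlog hβ.le).trans_eq ?_
  field_simp
  ring

/-- `exp` of the potential is the power mean of order `1 / β` of the numbers `exp (-sᵢ)`, and power
means increase with the order. This pays for changing the parameter between iterations. -/
theorem potential_antitone [NeZero n] {β γ : ℝ} (hβ : 0 < β) (h : β ≤ γ) (s : Fin n → ℝ) :
    potential γ s ≤ potential β s := by
  have hn : (0 : ℝ) < 1 / n := one_div_pos.2 (Nat.cast_pos.2 (NeZero.pos n))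
  have hγ := hβ.trans_le h
  have hpm := Real.rpow_arith_mean_le_arith_mean_rpow Finset.univ (fun _ : Fin n => 1 / (n : ℝ))
    (fun i => Real.exp (-(1 / γ) * s i)) (fun _ _ => hn.le)
    (by simp [NeZero.ne n]) (fun i _ => (Real.exp_pos _).le)
    (p := γ / β) ((one_le_div hβ).2 h)
  have hexp : ∀ i, Real.exp (-(1 / γ) * s i) ^ (γ / β) = Real.exp (-(1 / β) * s i) := by
    intro i
    rw [← Real.exp_mul]
    congr 1
    field_simp
  simp only [hexp, ← Finset.mul_sum] at hpm
  have hpos : ∀ b : ℝ, 0 < (1 / (n : ℝ)) * ∑ l, Real.exp (-(1 / b) * s l) := fun b =>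
    mul_pos hn (Finset.sum_pos (fun l _ => Real.exp_pos _) Finset.univ_nonempty)
  have hlog := Real.log_le_log (Real.rpow_pos_of_pos (hpos γ) _) hpm
  rw [Real.log_rpow (hpos γ), div_mul_eq_mul_div, div_le_iff₀ hβ] at hlog
  rw [potential, potential]
  linarith

/-- Log-sum-exp dominates the maximum, hence every average with weights `y`; the normalization `1 /
n` costs `β log n`. -/
theorem neg_sum_mul_sub_le_potential [NeZero n] {β : ℝ} (hβ : 0 < β) (s : Fin n → ℝ)
    {y : Fin n → ℝ} (hy : y ∈ stdSimplex ℝ (Fin n)) :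
    -∑ i, s i * y i - β * Real.log n ≤ potential β s := by
  have hn : (0 : ℝ) < n := Nat.cast_pos.2 (NeZero.pos n)
  have hpos : 0 < ∑ l, Real.exp (-(1 / β) * s l) :=
    Finset.sum_pos (fun l _ => Real.exp_pos _) Finset.univ_nonempty
  have h1 : ∀ i, -(s i) ≤ β * Real.log (∑ l, Real.exp (-(1 / β) * s l)) := by
    intro i
    have := Real.log_le_log (Real.exp_pos _) (Finset.single_le_sum
      (f := fun l => Real.exp (-(1 / β) * s l)) (fun l _ => (Real.exp_pos _).le)
      (Finset.mem_univ i))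
    rw [Real.log_exp] at this
    have := mul_le_mul_of_nonneg_left this hβ.le
    refine le_trans (le_of_eq ?_) this
    field_simp
  have h2 : -∑ i, s i * y i ≤ β * Real.log (∑ l, Real.exp (-(1 / β) * s l)) := by
    calc -∑ i, s i * y i = ∑ i, y i * -(s i) := by
          rw [← Finset.sum_neg_distrib]; exact Finset.sum_congr rfl fun i _ => by ring
      _ ≤ ∑ i, y i * (β * Real.log (∑ l, Real.exp (-(1 / β) * s l))) :=
          Finset.sum_le_sum fun i _ => mul_le_mul_of_nonneg_left (h1 i) (hy.1 i)
      _ = _ := by rw [← Finset.sum_mul, hy.2, one_mul]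
  rw [potential, Real.log_mul (one_div_pos.2 hn).ne' hpos.ne', one_div, Real.log_inv, mul_add]
  linarith

/-- The regret bound of dual averaging with the entropic regularization. -/
theorem regret_le [NeZero n] {β : ℕ → ℝ} (hβ : ∀ t, 0 < β t) (hmono : Monotone β)
    {s g : ℕ → Fin n → ℝ} (hs0 : s 0 = 0) (hs : ∀ t, s (t + 1) = s t + g t) {c : ℕ → ℝ}
    (hg : ∀ t i, |g t i| ≤ c t) {y : Fin n → ℝ} (hy : y ∈ stdSimplex ℝ (Fin n)) (N : ℕ) :
    ∑ t ∈ Finset.range (N + 1), ∑ i, g t i * (entropicPoint (β t) (s t) i - y i)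
      ≤ β N * Real.log n + ∑ t ∈ Finset.range (N + 1), c t ^ 2 / (2 * β t) := by
  -- The potential starts at zero. Each step first adds `g t` at the parameter `β t`, and only then
  -- moves to `β (t + 1)`; hence `β N` goes with `s (N + 1)`.
  have hpot : ∀ N, potential (β N) (s (N + 1)) ≤ ∑ t ∈ Finset.range (N + 1),
      (-∑ i, g t i * entropicPoint (β t) (s t) i + c t ^ 2 / (2 * β t)) := by
    intro N
    induction N with
    | zero =>
      have := potential_add_le (hβ 0) (s 0) (hg 0)
      rw [← hs, hs0, potential_zero] at this
      simp only [zero_add, Finset.range_one, Finset.sum_singleton, hs0] at this ⊢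
      linarith
    | succ N ih =>
      have h1 := potential_add_le (hβ (N + 1)) (s (N + 1)) (hg (N + 1))
      rw [← hs] at h1
      have h2 := potential_antitone (hβ N) (hmono (Nat.le_succ N)) (s (N + 1))
      rw [Finset.sum_range_succ]
      linarith
  have hsum : ∀ N i, s N i = ∑ t ∈ Finset.range N, g t i := by
    intro N i
    induction N with
    | zero => simp [hs0]
    | succ N ih => rw [hs, Finset.sum_range_succ, Pi.add_apply, ih]
  have hlow := neg_sum_mul_sub_le_potential (hβ N) (s (N + 1)) hy
  have hsy : ∑ i, s (N + 1) i * y i = ∑ t ∈ Finset.range (N + 1), ∑ i, g t i * y i := by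
    rw [Finset.sum_comm]
    exact Finset.sum_congr rfl fun i _ => by rw [hsum, Finset.sum_mul]
  have := hpot N
  simp only [mul_sub, Finset.sum_sub_distrib]
  rw [Finset.sum_add_distrib, Finset.sum_neg_distrib] at this
  linarith

theorem sum_one_div_sqrt_le (N : ℕ) :
    ∑ t ∈ Finset.range N, 1 / √((t : ℝ) + 1) ≤ 2 * √(N : ℝ) := by
  induction N with
  | zero => simp
  | succ N ih =>
    rw [Finset.sum_range_succ]
    have h1 : 0 < √((N : ℝ) + 1) := Real.sqrt_pos.2 (by positivity)
    have h2 : √((N : ℝ) + 1) ^ 2 = N + 1 := Real.sq_sqrt (by positivity)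
    have h3 : √(N : ℝ) ^ 2 = N := Real.sq_sqrt (by positivity)
    have h4 : 1 / √((N : ℝ) + 1) ≤ 2 * √((N : ℝ) + 1) - 2 * √(N : ℝ) := by
      rw [div_le_iff₀ h1]
      nlinarith [sq_nonneg (√((N : ℝ) + 1) - √(N : ℝ))]
    push_cast
    linarith

end Regret

/-! ### Jointly measurable version of the oracle -/

section JointMeasurability

variable {n : ℕ} {H : Type*} [MeasurableSpace H]

/-- Random convex functions have a jointly measurable version. -/
theorem exists_measurable_version {U : Set (Fin n → ℝ)} (hU : IsOpen U)
    {F : (Fin n → ℝ) → H → ℝ} {ν : Measure H} (hF : ∀ x ∈ U, Measurable (F x))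
    (h1 : ConvexRealizations U F ν) :
    ∃ F' : (Fin n → ℝ) → H → ℝ, Measurable (fun p : (Fin n → ℝ) × H => F' p.1 p.2) ∧
      ∀ᵐ h ∂ν, ∀ x ∈ U, F' x h = F x h := by
  classical
  -- On a measurable set `S` of full measure the realizations are convex, hence continuous on `U`;
  -- off `S` they are replaced by zero. Continuity in `x` with measurability in `h` gives joint
  -- measurability.
  obtain ⟨S, hSν, hSm, hS⟩ := Filter.Eventually.exists_measurable_mem h1
  let G : U → H → ℝ := fun x h => if h ∈ S then F x h else 0
  have hG : Measurable (Function.uncurry G) := by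
    refine measurable_uncurry_of_continuous_of_measurable (fun h => ?_) fun x => ?_
    · by_cases hh : h ∈ S
      · simp only [G, if_pos hh]
        exact continuousOn_iff_continuous_domRestrict.1 ((hS h hh).continuousOn hU)
      · simp only [G, if_neg hh]
        exact continuous_const
    · exact Measurable.ite hSm (hF x x.2) measurable_const
  refine ⟨fun x h => if hx : x ∈ U then G ⟨x, hx⟩ h else 0, ?_, ?_⟩
  · have hUm : MeasurableSet {p : (Fin n → ℝ) × H | p.1 ∈ U} := measurable_fst hU.measurableSet
    refine measurable_of_restrict_of_restrict_compl hUm ?_ ?_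
    · have : Measurable fun p : {p : (Fin n → ℝ) × H | p.1 ∈ U} =>
          Function.uncurry G (⟨p.1.1, p.2⟩, p.1.2) := hG.comp (by fun_prop)
      convert this using 2 with p
      exact dif_pos p.2
    · convert measurable_const (a := (0 : ℝ)) using 2 with p
      exact dif_neg p.2
  · filter_upwards [hSν] with h hh x hx
    simp only [dif_pos hx, G, if_pos hh]

end JointMeasurability

/-! ### Measurable dependence on the past -/

section Recursion

variable {V X : Type*} [MeasurableSpace V] [MeasurableSpace X]

/-- The state of a recursion after `k` steps is a measurable function of its first `k` inputs. -/
theorem exists_measurable_eq_of_recursion {step : ℕ → V → X → V}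
    (hstep : ∀ k, Measurable fun p : V × X => step k p.1 p.2) (v : V) (k : ℕ) :
    ∃ S : (Fin k → X) → V, Measurable S ∧ ∀ (r : ℕ → X) (s : ℕ → V), s 0 = v →
      (∀ j, s (j + 1) = step j (s j) (r j)) → s k = S fun j : Fin k => r j := by
  induction k with
  | zero => exact ⟨fun _ => v, measurable_const, fun r s h0 _ => h0⟩
  | succ k ih =>
    obtain ⟨S, hS, h⟩ := ih
    refine ⟨fun z => step k (S fun j => z j.castSucc) (z (Fin.last k)), ?_, fun r s h0 hs => ?_⟩
    · exact (hstep k).comp ((hS.comp (measurable_pi_lambda _ fun j =>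
        measurable_pi_apply j.castSucc)).prodMk (measurable_pi_apply (Fin.last k)))
    · rw [hs, h r s h0 hs]
      rfl

end Recursion

/-! ### Conditional moments of one estimator -/

section OneStep

variable {m : ℕ} {H Ω Z : Type*} [MeasurableSpace H] [MeasurableSpace Ω] [MeasurableSpace Z]

theorem map_prod_of_indepFun {E' : Type*} [MeasurableSpace E'] {P : Measure Ω}
    [IsProbabilityMeasure P] {E : Ω → E'} {Y : Ω → H} {T : Ω → Z} (hE : Measurable E)
    (hY : Measurable Y) (hT : Measurable T) (hYT : IndepFun Y T P)
    (hETY : IndepFun E (fun ω => (T ω, Y ω)) P) :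
    P.map (fun ω => (E ω, T ω, Y ω)) = (P.map E).prod ((P.map T).prod (P.map Y)) := by
  rw [(indepFun_iff_map_prod_eq_prod_map_map hE.aemeasurable (hT.prodMk hY).aemeasurable).1 hETY,
    (indepFun_iff_map_prod_eq_prod_map_map hT.aemeasurable hY.aemeasurable).1 hYT.symm]

/-- The mean of `g(x + μ e) sign(eᵢ)` over the directions `e`. -/
noncomputable def meanSign (μ : ℝ) (g : (Fin (m + 1) → ℝ) → ℝ) (i : Fin (m + 1))
    (x : Fin (m + 1) → ℝ) : ℝ :=
  ∫ e, g (x + μ • e) * Real.sign (e i) ∂(uniformL1Sphere (m + 1))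

theorem abs_sign_le_one (r : ℝ) : |Real.sign r| ≤ 1 := by
  rcases Real.sign_apply_eq r with h | h | h <;> simp [h]

theorem measurable_meanSign (hσ : IsProbabilityMeasure (uniformL1Sphere (m + 1))) (μ : ℝ)
    {g : (Fin (m + 1) → ℝ) → ℝ} (hg : Continuous g) (i : Fin (m + 1)) :
    Measurable (meanSign μ g i) := by
  have : Measurable fun p : (Fin (m + 1) → ℝ) × (Fin (m + 1) → ℝ) =>
      g (p.1 + μ • p.2) * Real.sign (p.2 i) :=
    (hg.comp (by fun_prop)).measurable.mul
      (measurable_realSign.comp ((measurable_pi_apply i).comp measurable_snd))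
  exact (this.stronglyMeasurable.integral_prod_right').measurable

/-- Subtracting `g x` is free because the sign has mean zero; the mean then depends only on
increments, which are of order `μ`. -/
theorem meanSign_eq (hσ : IsProbabilityMeasure (uniformL1Sphere (m + 1))) {μ : ℝ}
    {g : (Fin (m + 1) → ℝ) → ℝ} (hg : Continuous g) (i : Fin (m + 1)) (x : Fin (m + 1) → ℝ)
    {c : ℝ} (hc : ∀ e : Fin (m + 1) → ℝ, ∑ i, |e i| = 1 → |g (x + μ • e) - g x| ≤ c) :
    Integrable (fun e => (g (x + μ • e) - g x) * Real.sign (e i)) (uniformL1Sphere (m + 1)) ∧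
    meanSign μ g i x
      = ∫ e, (g (x + μ • e) - g x) * Real.sign (e i) ∂(uniformL1Sphere (m + 1)) := by
  have hs : Measurable fun e : Fin (m + 1) → ℝ => Real.sign (e i) :=
    measurable_realSign.comp (measurable_pi_apply i)
  have hm : Measurable fun e : Fin (m + 1) → ℝ => g (x + μ • e) :=
    (hg.comp (by fun_prop)).measurable
  have h1 : Integrable (fun e => (g (x + μ • e) - g x) * Real.sign (e i))
      (uniformL1Sphere (m + 1)) := by
    refine Integrable.of_bound ((hm.sub_const _).mul hs).aestronglyMeasurable c ?_
    filter_upwards [ae_uniformL1Sphere hσ] with e he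
    rw [Real.norm_eq_abs, abs_mul]
    exact (mul_le_of_le_one_right (abs_nonneg _) (abs_sign_le_one _)).trans (hc e he)
  have h2 : Integrable (fun e : Fin (m + 1) → ℝ => g x * Real.sign (e i))
      (uniformL1Sphere (m + 1)) :=
    (Integrable.of_bound hs.aestronglyMeasurable 1
      (Filter.Eventually.of_forall fun e => abs_sign_le_one _)).const_mul _
  refine ⟨h1, ?_⟩
  have : ∀ e : Fin (m + 1) → ℝ, g (x + μ • e) * Real.sign (e i)
      = (g (x + μ • e) - g x) * Real.sign (e i) + g x * Real.sign (e i) := fun e => by ring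
  simp only [meanSign, this]
  rw [integral_add h1 h2, integral_const_mul, integral_sign_uniformL1Sphere hσ, mul_zero, add_zero]

theorem abs_meanSign_le (hσ : IsProbabilityMeasure (uniformL1Sphere (m + 1))) {μ : ℝ}
    {g : (Fin (m + 1) → ℝ) → ℝ} (hg : Continuous g) (i : Fin (m + 1)) (x : Fin (m + 1) → ℝ)
    {c : ℝ} (hc : ∀ e : Fin (m + 1) → ℝ, ∑ i, |e i| = 1 → |g (x + μ • e) - g x| ≤ c) :
    |meanSign μ g i x| ≤ c := by
  rw [(meanSign_eq hσ hg i x hc).2, ← Real.norm_eq_abs]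
  refine (norm_integral_le_of_norm_le_const (C := c) ?_).trans_eq (by simp)
  filter_upwards [ae_uniformL1Sphere hσ] with e he
  rw [Real.norm_eq_abs, abs_mul]
  exact (mul_le_of_le_one_right (abs_nonneg _) (abs_sign_le_one _)).trans (hc e he)

/-- The expectation factors, and the sign has mean zero. No centring of `r` is needed, so `r` can be
a biased noise times a weight depending on the past. -/
theorem integral_mul_noise_mul_sign (hσ : IsProbabilityMeasure (uniformL1Sphere (m + 1)))
    {P : Measure Ω} {E : Ω → Fin (m + 1) → ℝ} (hE : Measurable E)
    (hlaw : P.map E = uniformL1Sphere (m + 1)) {r : Ω → ℝ} (hr : Measurable r)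
    (hind : IndepFun E r P) (i : Fin (m + 1)) : ∫ ω, r ω * Real.sign (E ω i) ∂P = 0 := by
  have hs : Measurable fun e : Fin (m + 1) → ℝ => Real.sign (e i) :=
    measurable_realSign.comp (measurable_pi_apply i)
  have h : IndepFun r (fun ω => Real.sign (E ω i)) P := (hind.comp hs measurable_id).symm
  rw [h.integral_fun_mul_eq_mul_integral hr.aestronglyMeasurable
    (hs.comp hE).aestronglyMeasurable]
  have := integral_map (μ := P) hE.aemeasurable hs.aestronglyMeasurable
  rw [hlaw, integral_sign_uniformL1Sphere hσ] at this
  rw [← this, mul_zero]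

variable {P : Measure Ω} [IsProbabilityMeasure P] {ν : Measure H} [IsProbabilityMeasure ν]
  {F : (Fin (m + 1) → ℝ) → H → ℝ} {μ c : ℝ} {E : Ω → Fin (m + 1) → ℝ} {Y : Ω → H} {T : Ω → Z}
  {x : Z → Fin (m + 1) → ℝ}

/-- With the past and the direction frozen, the two query points are deterministic and only the
fresh realization is averaged; Tonelli does the rest. -/
theorem lintegral_sq_difference_le (hσ : IsProbabilityMeasure (uniformL1Sphere (m + 1)))
    (hFm : Measurable fun p : (Fin (m + 1) → ℝ) × H => F p.1 p.2)
    (hE : Measurable E) (hY : Measurable Y) (hT : Measurable T)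
    (hlaw : P.map (fun ω => (E ω, T ω, Y ω))
      = (uniformL1Sphere (m + 1)).prod ((P.map T).prod ν))
    (hx : Measurable x)
    (hsq : ∀ z, ∀ e : Fin (m + 1) → ℝ, ∑ i, |e i| = 1 →
      ∫⁻ h, ENNReal.ofReal ((F (x z + μ • e) h - F (x z) h) ^ 2) ∂ν ≤ ENNReal.ofReal (c ^ 2)) :
    ∫⁻ ω, ENNReal.ofReal ((F (x (T ω) + μ • E ω) (Y ω) - F (x (T ω)) (Y ω)) ^ 2) ∂P
      ≤ ENNReal.ofReal (c ^ 2) := by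
  have : IsProbabilityMeasure (P.map T) := Measure.isProbabilityMeasure_map hT.aemeasurable
  let Φ : (Fin (m + 1) → ℝ) × Z × H → ℝ≥0∞ := fun p =>
    ENNReal.ofReal ((F (x p.2.1 + μ • p.1) p.2.2 - F (x p.2.1) p.2.2) ^ 2)
  have hΦ : Measurable Φ := by
    have h1 : Measurable fun p : (Fin (m + 1) → ℝ) × Z × H =>
        F (x p.2.1 + μ • p.1) p.2.2 :=
      hFm.comp (f := fun p : (Fin (m + 1) → ℝ) × Z × H => (x p.2.1 + μ • p.1, p.2.2)) (by fun_prop)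
    have h2 : Measurable fun p : (Fin (m + 1) → ℝ) × Z × H => F (x p.2.1) p.2.2 :=
      hFm.comp (f := fun p : (Fin (m + 1) → ℝ) × Z × H => (x p.2.1, p.2.2)) (by fun_prop)
    exact ((h1.sub h2).pow_const 2).ennreal_ofReal
  have h := lintegral_map (μ := P) hΦ (hE.prodMk (hT.prodMk hY))
  rw [hlaw, lintegral_prod _ hΦ.aemeasurable] at h
  change ∫⁻ ω, Φ (E ω, T ω, Y ω) ∂P ≤ _
  rw [← h]
  calc _ ≤ ∫⁻ _, ENNReal.ofReal (c ^ 2) ∂(uniformL1Sphere (m + 1)) := by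
        refine lintegral_mono_ae ?_
        filter_upwards [ae_uniformL1Sphere hσ] with e he
        rw [lintegral_prod (fun p => Φ (e, p)) (hΦ.comp (by fun_prop)).aemeasurable]
        refine (lintegral_mono fun z => hsq z e he).trans_eq (by simp)
    _ = _ := by simp

/-- A conditional expectation in weak form, with `w` a test function of the past. Integrating out
the realization replaces `F` by `g`; integrating out the direction then gives `meanSign`. -/
theorem integral_mul_difference_mul_sign (hσ : IsProbabilityMeasure (uniformL1Sphere (m + 1)))
    (hFm : Measurable fun p : (Fin (m + 1) → ℝ) × H => F p.1 p.2)
    (hE : Measurable E) (hY : Measurable Y) (hT : Measurable T)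
    (hlaw : P.map (fun ω => (E ω, T ω, Y ω))
      = (uniformL1Sphere (m + 1)).prod ((P.map T).prod ν))
    (hx : Measurable x)
    (hsq : ∀ z, ∀ e : Fin (m + 1) → ℝ, ∑ i, |e i| = 1 →
      ∫⁻ h, ENNReal.ofReal ((F (x z + μ • e) h - F (x z) h) ^ 2) ∂ν ≤ ENNReal.ofReal (c ^ 2))
    {g : (Fin (m + 1) → ℝ) → ℝ} (hg : Continuous g)
    (hmean : ∀ z, ∀ e : Fin (m + 1) → ℝ, ∑ i, |e i| = 1 →
      ∫ h, (F (x z + μ • e) h - F (x z) h) ∂ν = g (x z + μ • e) - g (x z))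
    (hgc : ∀ z, ∀ e : Fin (m + 1) → ℝ, ∑ i, |e i| = 1 → |g (x z + μ • e) - g (x z)| ≤ c)
    {w : Z → ℝ} (hw : Measurable w) {B : ℝ} (hB : ∀ z, |w z| ≤ B) (i : Fin (m + 1)) :
    ∫ ω, w (T ω) * ((F (x (T ω) + μ • E ω) (Y ω) - F (x (T ω)) (Y ω)) * Real.sign (E ω i)) ∂P
      = ∫ ω, w (T ω) * meanSign μ g i (x (T ω)) ∂P := by
  have : IsProbabilityMeasure (P.map T) := Measure.isProbabilityMeasure_map hT.aemeasurable
  let D : (Fin (m + 1) → ℝ) × Z × H → ℝ := fun p =>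
    F (x p.2.1 + μ • p.1) p.2.2 - F (x p.2.1) p.2.2
  have hD : Measurable D := by
    have h1 : Measurable fun p : (Fin (m + 1) → ℝ) × Z × H =>
        F (x p.2.1 + μ • p.1) p.2.2 :=
      hFm.comp (f := fun p : (Fin (m + 1) → ℝ) × Z × H => (x p.2.1 + μ • p.1, p.2.2)) (by fun_prop)
    have h2 : Measurable fun p : (Fin (m + 1) → ℝ) × Z × H => F (x p.2.1) p.2.2 :=
      hFm.comp (f := fun p : (Fin (m + 1) → ℝ) × Z × H => (x p.2.1, p.2.2)) (by fun_prop)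
    exact h1.sub h2
  have hs : Measurable fun p : (Fin (m + 1) → ℝ) × Z × H => Real.sign (p.1 i) :=
    measurable_realSign.comp ((measurable_pi_apply i).comp measurable_fst)
  let Φ : (Fin (m + 1) → ℝ) × Z × H → ℝ := fun p => w p.2.1 * (D p * Real.sign (p.1 i))
  have hΦ : Measurable Φ := (hw.comp (by fun_prop)).mul (hD.mul hs)
  have hETY : Measurable fun ω => (E ω, T ω, Y ω) := hE.prodMk (hT.prodMk hY)
  have hDint : Integrable D ((uniformL1Sphere (m + 1)).prod ((P.map T).prod ν)) := by
    rw [← hlaw, integrable_map_measure hD.aestronglyMeasurable hETY.aemeasurable]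
    have h2 := integral_sq_le_of_lintegral_le (P := P) (D := D ∘ fun ω => (E ω, T ω, Y ω))
      (hD.comp hETY) (c := c) (lintegral_sq_difference_le hσ hFm hE hY hT hlaw hx hsq)
    exact ((memLp_two_iff_integrable_sq (hD.comp hETY).aestronglyMeasurable).2 h2.1).integrable
      (by norm_num)
  have hΦint : Integrable Φ ((uniformL1Sphere (m + 1)).prod ((P.map T).prod ν)) := by
    refine (hDint.mul_bdd (c := 1) hs.aestronglyMeasurable
      (Filter.Eventually.of_forall fun p => abs_sign_le_one _)).bdd_mul (c := B) ?_ ?_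
    · exact (hw.comp (by fun_prop)).aestronglyMeasurable
    · exact Filter.Eventually.of_forall fun p => hB _
  have h := integral_map (μ := P) hETY.aemeasurable hΦ.aestronglyMeasurable
  rw [hlaw, integral_prod _ hΦint] at h
  change ∫ ω, Φ (E ω, T ω, Y ω) ∂P = _
  rw [← h]
  have hinner : ∀ᵐ e ∂(uniformL1Sphere (m + 1)), ∫ p, Φ (e, p) ∂((P.map T).prod ν)
      = ∫ z, w z * ((g (x z + μ • e) - g (x z)) * Real.sign (e i)) ∂(P.map T) := by
    filter_upwards [hΦint.prod_right_ae, ae_uniformL1Sphere hσ] with e he he1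
    rw [integral_prod _ he]
    refine integral_congr_ae (Filter.Eventually.of_forall fun z => ?_)
    change ∫ h, w z * ((F (x z + μ • e) h - F (x z) h) * Real.sign (e i)) ∂ν = _
    rw [integral_const_mul, integral_mul_const, hmean z e he1]
  rw [integral_congr_ae hinner, integral_integral_swap]
  · rw [integral_map (μ := P) (φ := T) hT.aemeasurable]
    · refine integral_congr_ae (Filter.Eventually.of_forall fun ω => ?_)
      change ∫ e, _ ∂_ = _
      rw [integral_const_mul, ← (meanSign_eq hσ hg i (x (T ω)) (hgc (T ω))).2]
    · have : Measurable fun z => w z * meanSign μ g i (x z) :=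
        hw.mul ((measurable_meanSign hσ μ hg i).comp hx)
      refine this.aestronglyMeasurable.congr (Filter.Eventually.of_forall fun z => ?_)
      change _ = ∫ e, _ ∂_
      rw [integral_const_mul, ← (meanSign_eq hσ hg i (x z) (hgc z)).2]
  · have hm : Measurable (Function.uncurry fun (e : Fin (m + 1) → ℝ) (z : Z) =>
        w z * ((g (x z + μ • e) - g (x z)) * Real.sign (e i))) := by
      have h1 : Measurable fun p : (Fin (m + 1) → ℝ) × Z => g (x p.2 + μ • p.1) :=
        hg.measurable.comp (by fun_prop)
      have h2 : Measurable fun p : (Fin (m + 1) → ℝ) × Z => g (x p.2) :=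
        hg.measurable.comp (by fun_prop)
      exact (hw.comp measurable_snd).mul ((h1.sub h2).mul
        (measurable_realSign.comp ((measurable_pi_apply i).comp measurable_fst)))
    refine Integrable.of_bound hm.aestronglyMeasurable (B * c) ?_
    have hae := Measure.quasiMeasurePreserving_fst (μ := uniformL1Sphere (m + 1))
      (ν := P.map T) |>.ae (ae_uniformL1Sphere hσ)
    filter_upwards [hae] with p hp
    rw [Function.uncurry, Real.norm_eq_abs, abs_mul, abs_mul]
    refine mul_le_mul (hB _) ?_ (by positivity) ((abs_nonneg _).trans (hB p.2))
    exact (mul_le_of_le_one_right (abs_nonneg _) (abs_sign_le_one _)).trans (hgc p.2 p.1 hp)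

end OneStep

/-! ### Azuma-Hoeffding inequality -/

section Concentration

variable {Ω : Type*} [MeasurableSpace Ω] {P : Measure Ω} [IsProbabilityMeasure P]

/-- The Azuma-Hoeffding inequality. -/
theorem measureReal_sum_ge_le {D : ℕ → Ω → ℝ} (hD : ∀ k, Measurable (D k)) {c : ℝ} (hc : 0 < c)
    (hDc : ∀ k, ∀ᵐ ω ∂P, |D k ω| ≤ c)
    -- Orthogonality to bounded functions of the partial sum suffices, since the only weight needed
    -- is `exp (l S_k)`.
    (hmart : ∀ k, ∀ w : ℝ → ℝ, Measurable w → (∃ B, ∀ s, |w s| ≤ B) →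
      ∫ ω, w (∑ j ∈ Finset.range k, D j ω) * D k ω ∂P = 0) {N : ℕ} (hN : 0 < N) {r : ℝ}
    (hr : 0 ≤ r) :
    P.real {ω | r ≤ ∑ j ∈ Finset.range N, D j ω} ≤ Real.exp (-(r ^ 2 / (2 * N * c ^ 2))) := by
  have hSm : ∀ k, Measurable fun ω => ∑ j ∈ Finset.range k, D j ω := fun k => by fun_prop
  have hSb : ∀ k : ℕ, ∀ᵐ ω ∂P, ∑ j ∈ Finset.range k, D j ω ≤ k * c := by
    intro k
    filter_upwards [ae_all_iff.2 hDc] with ω hω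
    refine (Finset.sum_le_card_nsmul _ _ c fun j _ => (le_abs_self _).trans (hω j)).trans_eq ?_
    simp
  have hexp : ∀ l : ℝ, 0 ≤ l → ∀ k : ℕ,
      Integrable (fun ω => Real.exp (l * ∑ j ∈ Finset.range k, D j ω)) P := by
    intro l hl k
    refine Integrable.of_bound (Real.measurable_exp.comp
      ((hSm k).const_mul l)).aestronglyMeasurable (Real.exp (l * (k * c))) ?_
    filter_upwards [hSb k] with ω hω
    rw [Real.norm_of_nonneg (Real.exp_pos _).le]
    exact Real.exp_le_exp.2 (mul_le_mul_of_nonneg_left hω hl)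
  have hmgf : ∀ l : ℝ, 0 ≤ l → ∀ k : ℕ,
      ∫ ω, Real.exp (l * ∑ j ∈ Finset.range k, D j ω) ∂P ≤ Real.exp (k * ((l * c) ^ 2 / 2)) := by
    intro l hl k
    induction k with
    | zero => simp
    | succ k ih =>
      -- The truncation makes the weight bounded everywhere; almost surely it changes nothing.
      let w : ℝ → ℝ := fun s => Real.exp (l * min s (k * c))
      have hwm : Measurable w := by fun_prop
      have hwb : ∀ s, |w s| ≤ Real.exp (l * (k * c)) := fun s => by
        rw [abs_of_pos (Real.exp_pos _)]
        exact Real.exp_le_exp.2 (mul_le_mul_of_nonneg_left (min_le_right _ _) hl)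
      have hw : ∀ᵐ ω ∂P, w (∑ j ∈ Finset.range k, D j ω)
          = Real.exp (l * ∑ j ∈ Finset.range k, D j ω) := by
        filter_upwards [hSb k] with ω hω
        simp only [w, min_eq_left hω]
      have hint2 : Integrable (fun ω => w (∑ j ∈ Finset.range k, D j ω) * D k ω) P := by
        refine Integrable.bdd_mul (c := Real.exp (l * (k * c))) ?_
          (hwm.comp (hSm k)).aestronglyMeasurable (Filter.Eventually.of_forall fun ω => hwb _)
        exact Integrable.of_bound (hD k).aestronglyMeasurable c (hDc k)
      have hle : ∀ᵐ ω ∂P, Real.exp (l * ∑ j ∈ Finset.range (k + 1), D j ω)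
          ≤ Real.exp (l * ∑ j ∈ Finset.range k, D j ω) * Real.cosh (l * c) +
            w (∑ j ∈ Finset.range k, D j ω) * D k ω * (Real.sinh (l * c) / c) := by
        filter_upwards [hw, hDc k] with ω hω hωc
        rw [hω, Finset.sum_range_succ, mul_add, Real.exp_add, mul_assoc, ← mul_add]
        refine mul_le_mul_of_nonneg_left ?_ (Real.exp_pos _).le
        -- The chord of `exp` over `[-l c, l c]`: its linear part integrates to zero by `hmart`.
        have h1 := Real.exp_mul_le_cosh_add_mul_sinh (t := D k ω / c)
          (by rw [abs_div, abs_of_pos hc]; exact (div_le_one hc).2 hωc) (l * c)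
        have h2 : D k ω / c * (l * c) = l * D k ω := by field_simp
        rw [h2] at h1
        refine h1.trans_eq ?_
        ring
      have hint3 := (hexp l hl k).mul_const (Real.cosh (l * c))
      have hint4 := hint2.mul_const (Real.sinh (l * c) / c)
      refine (integral_mono_ae (hexp l hl (k + 1)) (hint3.add hint4) hle).trans ?_
      simp only [Pi.add_apply]
      rw [integral_add hint3 hint4, integral_mul_const, integral_mul_const,
        hmart k w hwm ⟨_, hwb⟩, zero_mul, add_zero]
      refine (mul_le_mul ih (Real.cosh_le_exp_half_sq _) (Real.cosh_pos _).le
        (Real.exp_pos _).le).trans_eq ?_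
      rw [← Real.exp_add]
      congr 1
      push_cast
      ring
  have hNc : 0 < N * c ^ 2 := by positivity
  -- This `l` minimizes the Chernoff exponent `-l r + N (l c)² / 2`.
  have hl : 0 ≤ r / (N * c ^ 2) := div_nonneg hr hNc.le
  have h := measure_ge_le_exp_mul_mgf (μ := P) (X := fun ω => ∑ j ∈ Finset.range N, D j ω) r hl
    (hexp _ hl N)
  refine h.trans ((mul_le_mul_of_nonneg_left (hmgf _ hl N) (Real.exp_pos _).le).trans_eq ?_)
  rw [← Real.exp_add]
  congr 1
  field_simp
  ring

end Concentration

/-! ### State of a run as a function of its draws -/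

section Run

theorem iterate_mem_stdSimplex {m : ℕ} {H : Type*} (F : (Fin (m + 1) → ℝ) → H → ℝ) (M μ : ℝ)
    (e : ℕ → Fin (m + 1) → ℝ) (h : ℕ → H) (a b : ℕ → ℝ) (k : ℕ) :
    iterate F M μ e h a b k ∈ stdSimplex ℝ (Fin (m + 1)) :=
  entropicPoint_mem_stdSimplex _ _

variable {m : ℕ} {H Ω : Type*} [MeasurableSpace H] [MeasurableSpace Ω]

/-- The properties of the oracle that the analysis of the method uses: `g` extends the objective,
and `c` bounds the increments over one probing step. -/
structure IsRegularOracle (ν : Measure H) (F : (Fin (m + 1) → ℝ) → H → ℝ) (μ c : ℝ)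
    (g : (Fin (m + 1) → ℝ) → ℝ) : Prop where
  measurable : Measurable fun p : (Fin (m + 1) → ℝ) × H => F p.1 p.2
  continuous : Continuous g
  lintegral_sq_le : ∀ x ∈ stdSimplex ℝ (Fin (m + 1)), ∀ e : Fin (m + 1) → ℝ, ∑ i, |e i| = 1 →
    ∫⁻ h, ENNReal.ofReal ((F (x + μ • e) h - F x h) ^ 2) ∂ν ≤ ENNReal.ofReal (c ^ 2)
  integral_sub : ∀ x ∈ stdSimplex ℝ (Fin (m + 1)), ∀ e : Fin (m + 1) → ℝ, ∑ i, |e i| = 1 →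
    ∫ h, (F (x + μ • e) h - F x h) ∂ν = g (x + μ • e) - g x
  abs_sub_le : ∀ x ∈ stdSimplex ℝ (Fin (m + 1)), ∀ e : Fin (m + 1) → ℝ, ∑ i, |e i| = 1 →
    |g (x + μ • e) - g x| ≤ c

/-- The mean of `⟨g, x - y⟩` over the estimators `g` at the point `x`. -/
noncomputable def meanGap (μ : ℝ) (g : (Fin (m + 1) → ℝ) → ℝ) (y x : Fin (m + 1) → ℝ) : ℝ :=
  ∑ i, ((m + 1) / μ * meanSign μ g i x) * (x i - y i)

/-- The deviation of `⟨g, x - y⟩` from its mean, in the iteration `k`. -/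
noncomputable def gapDeviation (F : (Fin (m + 1) → ℝ) → H → ℝ) (M μ : ℝ)
    (g : (Fin (m + 1) → ℝ) → ℝ) (y : Fin (m + 1) → ℝ) (e : ℕ → Fin (m + 1) → ℝ) (h : ℕ → H)
    (a b : ℕ → ℝ) (k : ℕ) : ℝ :=
  meanGap μ g y (iterate F M μ e h a b k) -
    ∑ i, estimator F μ (iterate F M μ e h a b k) (e k) (h k) (a k) (b k) i *
      (iterate F M μ e h a b k i - y i)

/-- The increment of the realized objective over one probing step. -/
noncomputable def increment (F : (Fin (m + 1) → ℝ) → H → ℝ) (M μ : ℝ) (e : ℕ → Fin (m + 1) → ℝ) (h : ℕ → H)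
    (a b : ℕ → ℝ) (k : ℕ) : ℝ :=
  F (iterate F M μ e h a b k + μ • e k) (h k) - F (iterate F M μ e h a b k) (h k)

theorem measurable_entropicPoint (β : ℝ) :
    Measurable (entropicPoint β : (Fin (m + 1) → ℝ) → Fin (m + 1) → ℝ) := by
  unfold entropicPoint
  fun_prop

theorem measurable_estimator {F : (Fin (m + 1) → ℝ) → H → ℝ}
    (hF : Measurable fun p : (Fin (m + 1) → ℝ) × H => F p.1 p.2) (μ : ℝ) :
    Measurable fun p : (Fin (m + 1) → ℝ) × (Fin (m + 1) → ℝ) × H × ℝ × ℝ =>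
      estimator F μ p.1 p.2.1 p.2.2.1 p.2.2.2.1 p.2.2.2.2 := by
  refine measurable_pi_lambda _ fun i => ?_
  have h1 : Measurable fun p : (Fin (m + 1) → ℝ) × (Fin (m + 1) → ℝ) × H × ℝ × ℝ =>
      F (p.1 + μ • p.2.1) p.2.2.1 :=
    hF.comp (f := fun p : (Fin (m + 1) → ℝ) × (Fin (m + 1) → ℝ) × H × ℝ × ℝ =>
      (p.1 + μ • p.2.1, p.2.2.1)) (by fun_prop)
  have h2 : Measurable fun p : (Fin (m + 1) → ℝ) × (Fin (m + 1) → ℝ) × H × ℝ × ℝ =>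
      F p.1 p.2.2.1 :=
    hF.comp (f := fun p : (Fin (m + 1) → ℝ) × (Fin (m + 1) → ℝ) × H × ℝ × ℝ =>
      (p.1, p.2.2.1)) (by fun_prop)
  have h3 : Measurable fun p : (Fin (m + 1) → ℝ) × (Fin (m + 1) → ℝ) × H × ℝ × ℝ =>
      Real.sign (p.2.1 i) := measurable_realSign.comp (by fun_prop)
  unfold estimator
  fun_prop

theorem measurable_meanGap (hσ : IsProbabilityMeasure (uniformL1Sphere (m + 1))) (μ : ℝ)
    {g : (Fin (m + 1) → ℝ) → ℝ} (hg : Continuous g) (y : Fin (m + 1) → ℝ) :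
    Measurable (meanGap μ g y) := by
  unfold meanGap
  have := measurable_meanSign hσ μ hg
  fun_prop

/-- The dual variable and the accumulated deviation are measurable functions of the past. -/
theorem exists_measurable_state (hσ : IsProbabilityMeasure (uniformL1Sphere (m + 1)))
    {F : (Fin (m + 1) → ℝ) → H → ℝ}
    (hF : Measurable fun p : (Fin (m + 1) → ℝ) × H => F p.1 p.2) (M μ : ℝ)
    {g : (Fin (m + 1) → ℝ) → ℝ} (hg : Continuous g) (y : Fin (m + 1) → ℝ) (k : ℕ) :
    ∃ S : (Fin k → (Fin (m + 1) → ℝ) × H × ℝ × ℝ) → (Fin (m + 1) → ℝ) × ℝ, Measurable S ∧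
      ∀ e h a b, (dualSum F M μ e h a b k,
        ∑ j ∈ Finset.range k, gapDeviation F M μ g y e h a b j)
          = S fun j : Fin k => (e j, h j, a j, b j) := by
  let pt : ℕ → (Fin (m + 1) → ℝ) → Fin (m + 1) → ℝ := fun k s =>
    entropicPoint (stepParam (m + 1) M (k + 1)) s
  let step : ℕ → (Fin (m + 1) → ℝ) × ℝ → (Fin (m + 1) → ℝ) × H × ℝ × ℝ →
      (Fin (m + 1) → ℝ) × ℝ := fun k v r =>
    (v.1 + estimator F μ (pt k v.1) r.1 r.2.1 r.2.2.1 r.2.2.2,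
      v.2 + (meanGap μ g y (pt k v.1) -
        ∑ i, estimator F μ (pt k v.1) r.1 r.2.1 r.2.2.1 r.2.2.2 i * (pt k v.1 i - y i)))
  have hstep : ∀ k, Measurable fun p : ((Fin (m + 1) → ℝ) × ℝ) × (Fin (m + 1) → ℝ) × H × ℝ × ℝ =>
      step k p.1 p.2 := by
    intro k
    have hpt : Measurable fun p : ((Fin (m + 1) → ℝ) × ℝ) × (Fin (m + 1) → ℝ) × H × ℝ × ℝ =>
        pt k p.1.1 := (measurable_entropicPoint _).comp (by fun_prop)
    have hest : Measurable fun p : ((Fin (m + 1) → ℝ) × ℝ) × (Fin (m + 1) → ℝ) × H × ℝ × ℝ =>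
        estimator F μ (pt k p.1.1) p.2.1 p.2.2.1 p.2.2.2.1 p.2.2.2.2 :=
      (measurable_estimator hF μ).comp (hpt.prodMk measurable_snd)
    have hgap := (measurable_meanGap hσ μ hg y).comp hpt
    simp only [Function.comp_def] at hgap
    have hsum : Measurable fun p : ((Fin (m + 1) → ℝ) × ℝ) × (Fin (m + 1) → ℝ) × H × ℝ × ℝ =>
        ∑ i, estimator F μ (pt k p.1.1) p.2.1 p.2.2.1 p.2.2.2.1 p.2.2.2.2 i *
          (pt k p.1.1 i - y i) :=
      Finset.measurable_fun_sum _ fun i _ =>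
        ((measurable_pi_apply i).comp hest).mul (((measurable_pi_apply i).comp hpt).sub_const _)
    exact (measurable_fst.fst.add hest).prodMk (measurable_fst.snd.add (hgap.sub hsum))
  obtain ⟨S, hS, h⟩ := exists_measurable_eq_of_recursion hstep (0, 0) k
  refine ⟨S, hS, fun e hh a b => ?_⟩
  refine h (fun j => (e j, hh j, a j, b j)) (fun k => (dualSum F M μ e hh a b k,
        ∑ j ∈ Finset.range k, gapDeviation F M μ g y e hh a b j)) (by simp [dualSum]) fun j => ?_
  rw [Finset.sum_range_succ]
  rfl

end Run

/-! ### Moments and orthogonality along a random run -/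

section StochasticRun

theorem IsNoisyOracleRun.isProbabilityMeasure {n : ℕ} {H Ω : Type*} [MeasurableSpace H]
    [MeasurableSpace Ω] {P : Measure Ω} [IsProbabilityMeasure P] {ν : Measure H} {δ : ℝ}
    {e : ℕ → Ω → Fin n → ℝ} {η : ℕ → Ω → H} {a b : ℕ → Ω → ℝ}
    (hrun : IsNoisyOracleRun ν δ P e η a b) : IsProbabilityMeasure (uniformL1Sphere n) :=
  hrun.law_e 0 ▸ Measure.isProbabilityMeasure_map (hrun.measurable_e 0).aemeasurable

theorem abs_sub_le_one_of_mem_stdSimplex {ι : Type*} [Fintype ι] {x y : ι → ℝ}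
    (hx : x ∈ stdSimplex ℝ ι) (hy : y ∈ stdSimplex ℝ ι) (i : ι) : |x i - y i| ≤ 1 := by
  have h1 := mem_Icc_of_mem_stdSimplex hx i
  have h2 := mem_Icc_of_mem_stdSimplex hy i
  rw [abs_sub_le_iff]
  constructor <;> linarith [h1.1, h1.2, h2.1, h2.2]

variable {m : ℕ} {H Ω : Type*} [MeasurableSpace H] [MeasurableSpace Ω]
  {P : Measure Ω} [IsProbabilityMeasure P] {ν : Measure H}
  {F : (Fin (m + 1) → ℝ) → H → ℝ} {M μ c δ : ℝ} {g : (Fin (m + 1) → ℝ) → ℝ}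
  {e : ℕ → Ω → Fin (m + 1) → ℝ} {η : ℕ → Ω → H} {a b : ℕ → Ω → ℝ} {y : Fin (m + 1) → ℝ}

theorem IsNoisyOracleRun.measurable_iterate (hrun : IsNoisyOracleRun ν δ P e η a b)
    (hO : IsRegularOracle ν F μ c g) (k : ℕ) :
    Measurable fun ω => iterate F M μ (e · ω) (η · ω) (a · ω) (b · ω) k := by
  -- Only the dual component of the state is used, so the reference point `0` is arbitrary.
  obtain ⟨S, hS, h⟩ := exists_measurable_state hrun.isProbabilityMeasure hO.measurable M μ
    hO.continuous (0 : Fin (m + 1) → ℝ) k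
  have hT : Measurable fun ω (j : Fin k) => (e j ω, η j ω, a j ω, b j ω) :=
    measurable_pi_lambda _ fun j => (hrun.measurable_e j).prodMk ((hrun.measurable_η j).prodMk
      ((hrun.measurable_a j).prodMk (hrun.measurable_b j)))
  have hdual : (fun ω => dualSum F M μ (e · ω) (η · ω) (a · ω) (b · ω) k) =
      fun ω => (S fun j : Fin k => (e j ω, η j ω, a j ω, b j ω)).1 :=
    funext fun ω => congrArg Prod.fst (h (e · ω) (η · ω) (a · ω) (b · ω))
  have hm : Measurable fun ω => dualSum F M μ (e · ω) (η · ω) (a · ω) (b · ω) k :=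
    hdual ▸ measurable_fst.comp (hS.comp hT)
  exact (measurable_entropicPoint _).comp hm

theorem IsNoisyOracleRun.measurable_increment (hrun : IsNoisyOracleRun ν δ P e η a b)
    (hO : IsRegularOracle ν F μ c g) (k : ℕ) :
    Measurable fun ω => increment F M μ (e · ω) (η · ω) (a · ω) (b · ω) k := by
  have hx := hrun.measurable_iterate (M := M) hO k
  exact (hO.measurable.comp ((hx.add ((hrun.measurable_e k).const_smul μ)).prodMk
    (hrun.measurable_η k))).sub (hO.measurable.comp (hx.prodMk (hrun.measurable_η k)))

theorem IsNoisyOracleRun.measurable_gapDeviation (hrun : IsNoisyOracleRun ν δ P e η a b)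
    (hO : IsRegularOracle ν F μ c g) (y : Fin (m + 1) → ℝ) (k : ℕ) :
    Measurable fun ω => gapDeviation F M μ g y (e · ω) (η · ω) (a · ω) (b · ω) k := by
  have hx := hrun.measurable_iterate (M := M) hO k
  have hest := (measurable_estimator hO.measurable μ).comp (hx.prodMk
    ((hrun.measurable_e k).prodMk ((hrun.measurable_η k).prodMk
      ((hrun.measurable_a k).prodMk (hrun.measurable_b k)))))
  exact ((measurable_meanGap hrun.isProbabilityMeasure μ hO.continuous y).comp hx).sub
    (Finset.measurable_fun_sum _ fun i _ => ((measurable_pi_apply i).comp hest).mul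
      (((measurable_pi_apply i).comp hx).sub_const _))

theorem IsNoisyOracleRun.map_draw_eq (hrun : IsNoisyOracleRun ν δ P e η a b) (k : ℕ) :
    P.map (fun ω => (e k ω, fun j : Fin k => (e j ω, η j ω, a j ω, b j ω), η k ω))
      = (uniformL1Sphere (m + 1)).prod
        ((P.map fun ω (j : Fin k) => (e j ω, η j ω, a j ω, b j ω)).prod ν) := by
  have hT : Measurable fun ω (j : Fin k) => (e j ω, η j ω, a j ω, b j ω) :=
    measurable_pi_lambda _ fun j => (hrun.measurable_e j).prodMk ((hrun.measurable_η j).prodMk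
      ((hrun.measurable_a j).prodMk (hrun.measurable_b j)))
  have hind : IndepFun (e k)
      (fun ω => (fun j : Fin k => (e j ω, η j ω, a j ω, b j ω), η k ω)) P :=
    (hrun.indep_e k).comp (φ := id) (ψ := fun p : (Fin k → (Fin (m + 1) → ℝ) × H × ℝ × ℝ) × H × ℝ × ℝ => (p.1, p.2.1))
      measurable_id (by fun_prop)
  rw [map_prod_of_indepFun (hrun.measurable_e k) (hrun.measurable_η k) hT (hrun.indep_η k) hind,
    hrun.law_e, hrun.law_η]

variable [IsProbabilityMeasure ν]

theorem IsNoisyOracleRun.integral_increment_sq_le (hrun : IsNoisyOracleRun ν δ P e η a b)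
    (hO : IsRegularOracle ν F μ c g) (k : ℕ) :
    Integrable (fun ω => increment F M μ (e · ω) (η · ω) (a · ω) (b · ω) k ^ 2) P ∧
      ∫ ω, increment F M μ (e · ω) (η · ω) (a · ω) (b · ω) k ^ 2 ∂P ≤ c ^ 2 := by
  refine integral_sq_le_of_lintegral_le (hrun.measurable_increment hO k) ?_
  obtain ⟨S, hS, h⟩ := exists_measurable_state hrun.isProbabilityMeasure hO.measurable M μ
    hO.continuous (0 : Fin (m + 1) → ℝ) k
  have hT : Measurable fun ω (j : Fin k) => (e j ω, η j ω, a j ω, b j ω) :=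
    measurable_pi_lambda _ fun j => (hrun.measurable_e j).prodMk ((hrun.measurable_η j).prodMk
      ((hrun.measurable_a j).prodMk (hrun.measurable_b j)))
  have hx : ∀ ω, iterate F M μ (e · ω) (η · ω) (a · ω) (b · ω) k
      = entropicPoint (stepParam (m + 1) M (k + 1))
        (S fun j : Fin k => (e j ω, η j ω, a j ω, b j ω)).1 := fun ω => by
    rw [← h (e · ω) (η · ω) (a · ω) (b · ω)]; rfl
  simp only [increment, hx]
  exact lintegral_sq_difference_le hrun.isProbabilityMeasure hO.measurable (hrun.measurable_e k)
    (hrun.measurable_η k) hT (hrun.map_draw_eq k)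
    (x := fun z => entropicPoint (stepParam (m + 1) M (k + 1)) (S z).1)
    ((measurable_entropicPoint _).comp (measurable_fst.comp hS))
    fun z => hO.lintegral_sq_le _ (entropicPoint_mem_stdSimplex _ _)

/-- The deviations are integrable and orthogonal to the functions of the past deviations. -/
theorem IsNoisyOracleRun.integral_mul_gapDeviation (hrun : IsNoisyOracleRun ν δ P e η a b)
    (hO : IsRegularOracle ν F μ c g) (hy : y ∈ stdSimplex ℝ (Fin (m + 1))) (k : ℕ) {w : ℝ → ℝ}
    (hw : Measurable w) {B : ℝ} (hB : ∀ s, |w s| ≤ B) :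
    Integrable (fun ω => w (∑ j ∈ Finset.range k,
        gapDeviation F M μ g y (e · ω) (η · ω) (a · ω) (b · ω) j) *
        gapDeviation F M μ g y (e · ω) (η · ω) (a · ω) (b · ω) k) P ∧
      ∫ ω, w (∑ j ∈ Finset.range k,
        gapDeviation F M μ g y (e · ω) (η · ω) (a · ω) (b · ω) j) *
        gapDeviation F M μ g y (e · ω) (η · ω) (a · ω) (b · ω) k ∂P = 0 := by
  have hσ := hrun.isProbabilityMeasure
  obtain ⟨S, hS, h⟩ := exists_measurable_state hσ hO.measurable M μ hO.continuous y k
  set T : Ω → Fin k → (Fin (m + 1) → ℝ) × H × ℝ × ℝ :=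
    fun ω j => (e j ω, η j ω, a j ω, b j ω) with hTdef
  have hT : Measurable T :=
    measurable_pi_lambda _ fun j => (hrun.measurable_e j).prodMk ((hrun.measurable_η j).prodMk
      ((hrun.measurable_a j).prodMk (hrun.measurable_b j)))
  set x : (Fin k → (Fin (m + 1) → ℝ) × H × ℝ × ℝ) → Fin (m + 1) → ℝ :=
    fun z => entropicPoint (stepParam (m + 1) M (k + 1)) (S z).1 with hxdef
  have hxm : Measurable x := (measurable_entropicPoint _).comp (measurable_fst.comp hS)
  have hxs : ∀ z, x z ∈ stdSimplex ℝ (Fin (m + 1)) := fun z => entropicPoint_mem_stdSimplex _ _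
  have hx : ∀ ω, iterate F M μ (e · ω) (η · ω) (a · ω) (b · ω) k = x (T ω) := fun ω => by
    rw [hxdef, hTdef]
    simp only []
    rw [← h (e · ω) (η · ω) (a · ω) (b · ω)]; rfl
  have hsum : ∀ ω, ∑ j ∈ Finset.range k,
      gapDeviation F M μ g y (e · ω) (η · ω) (a · ω) (b · ω) j = (S (T ω)).2 := fun ω => by
    rw [hTdef]
    simp only []
    rw [← h (e · ω) (η · ω) (a · ω) (b · ω)]
  set D : Ω → ℝ := fun ω => F (x (T ω) + μ • e k ω) (η k ω) - F (x (T ω)) (η k ω) with hD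
  have hDinc : ∀ ω, increment F M μ (e · ω) (η · ω) (a · ω) (b · ω) k = D ω := fun ω => by
    simp only [increment, hx, hD]
  have hDm : Measurable D := by
    simpa only [hDinc] using hrun.measurable_increment (M := M) hO k
  have hDint : Integrable D P := by
    have h2 := (hrun.integral_increment_sq_le (M := M) hO k).1
    simp only [hDinc] at h2
    exact ((memLp_two_iff_integrable_sq hDm.aestronglyMeasurable).2 h2).integrable (by norm_num)
  have hsm : ∀ i, Measurable fun ω => Real.sign (e k ω i) := fun i =>
    measurable_realSign.comp ((measurable_pi_apply i).comp (hrun.measurable_e k))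
  have hnoise : Integrable (fun ω => b k ω - a k ω) P := by
    refine Integrable.of_bound
      ((hrun.measurable_b k).sub (hrun.measurable_a k)).aestronglyMeasurable (δ + δ) ?_
    filter_upwards [hrun.noise_le k] with ω hω
    exact (abs_sub _ _).trans (add_le_add hω.2 hω.1)
  -- The test function times the coordinate of `x - y`: a function of the past, bounded by `B`
  -- because coordinates of simplex points differ by at most `1`.
  set wi : Fin (m + 1) → (Fin k → (Fin (m + 1) → ℝ) × H × ℝ × ℝ) → ℝ :=
    fun i z => w (S z).2 * (x z i - y i) with hwi
  have hwm : Measurable fun z => w (S z).2 := hw.comp (measurable_snd.comp hS)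
  have hwim : ∀ i, Measurable (wi i) := fun i =>
    hwm.mul (((measurable_pi_apply i).comp hxm).sub_const _)
  have hwib : ∀ i z, |wi i z| ≤ B := fun i z => by
    rw [hwi]
    simp only []
    rw [abs_mul]
    exact (mul_le_of_le_one_right (abs_nonneg _)
      (abs_sub_le_one_of_mem_stdSimplex (hxs z) hy i)).trans (hB _)
  have hwiT : ∀ i, AEStronglyMeasurable (fun ω => wi i (T ω)) P := fun i =>
    ((hwim i).comp hT).aestronglyMeasurable
  have hI1 : ∀ i, Integrable (fun ω => wi i (T ω) * (D ω * Real.sign (e k ω i))) P := fun i =>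
    (hDint.mul_bdd (c := 1) (hsm i).aestronglyMeasurable
      (Filter.Eventually.of_forall fun ω => abs_sign_le_one _)).bdd_mul (hwiT i)
      (Filter.Eventually.of_forall fun ω => hwib i _)
  have hI2 : ∀ i, Integrable (fun ω => wi i (T ω) * (b k ω - a k ω) * Real.sign (e k ω i)) P :=
    fun i => (hnoise.bdd_mul (hwiT i) (Filter.Eventually.of_forall fun ω => hwib i _)).mul_bdd
      (c := 1) (hsm i).aestronglyMeasurable (Filter.Eventually.of_forall fun ω => abs_sign_le_one _)
  have hI3 : ∀ i, Integrable (fun ω => wi i (T ω) * meanSign μ g i (x (T ω))) P := fun i => by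
    refine Integrable.bdd_mul (c := B) ?_ (hwiT i) (Filter.Eventually.of_forall fun ω => hwib i _)
    refine Integrable.of_bound (((measurable_meanSign hσ μ hO.continuous i).comp hxm).comp
      hT).aestronglyMeasurable c (Filter.Eventually.of_forall fun ω => ?_)
    exact abs_meanSign_le hσ hO.continuous i _ (hO.abs_sub_le _ (hxs _))
  have hE1 : ∀ i, ∫ ω, wi i (T ω) * (D ω * Real.sign (e k ω i)) ∂P
      = ∫ ω, wi i (T ω) * meanSign μ g i (x (T ω)) ∂P := fun i =>
    integral_mul_difference_mul_sign hσ hO.measurable (hrun.measurable_e k) (hrun.measurable_η k)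
      hT (hrun.map_draw_eq k) hxm (fun z => hO.lintegral_sq_le _ (hxs z)) hO.continuous
      (fun z => hO.integral_sub _ (hxs z)) (fun z => hO.abs_sub_le _ (hxs z)) (hwim i) (hwib i) i
  -- The direction is independent of the past and the noises jointly, so the weighted noise may be
  -- correlated with the past and still averages out.
  have hE2 : ∀ i, ∫ ω, wi i (T ω) * (b k ω - a k ω) * Real.sign (e k ω i) ∂P = 0 := fun i => by
    refine integral_mul_noise_mul_sign hσ (hrun.measurable_e k) (hrun.law_e k)
      (((hwim i).comp hT).mul ((hrun.measurable_b k).sub (hrun.measurable_a k))) ?_ i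
    exact (hrun.indep_e k).comp measurable_id
      (ψ := fun p => wi i p.1 * (p.2.2.2 - p.2.2.1))
      (((hwim i).comp measurable_fst).mul (by fun_prop))
  have hsplit : ∀ ω, w (∑ j ∈ Finset.range k,
        gapDeviation F M μ g y (e · ω) (η · ω) (a · ω) (b · ω) j) *
        gapDeviation F M μ g y (e · ω) (η · ω) (a · ω) (b · ω) k
      = ∑ i, ((m + 1) / μ) * (wi i (T ω) * meanSign μ g i (x (T ω))
        - wi i (T ω) * (D ω * Real.sign (e k ω i))
        - wi i (T ω) * (b k ω - a k ω) * Real.sign (e k ω i)) := by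
    intro ω
    rw [hsum, gapDeviation, meanGap, ← Finset.sum_sub_distrib, Finset.mul_sum]
    refine Finset.sum_congr rfl fun i _ => ?_
    simp only [hx, estimator, hwi, hD]
    push_cast
    ring
  simp only [hsplit]
  have hI : ∀ i, Integrable (fun ω => (m + 1) / μ * (wi i (T ω) * meanSign μ g i (x (T ω))
        - wi i (T ω) * (D ω * Real.sign (e k ω i))
        - wi i (T ω) * (b k ω - a k ω) * Real.sign (e k ω i))) P := fun i =>
    (((hI3 i).sub (hI1 i)).sub (hI2 i)).const_mul _
  have hI31 : ∀ i, Integrable (fun ω => wi i (T ω) * meanSign μ g i (x (T ω))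
        - wi i (T ω) * (D ω * Real.sign (e k ω i))) P := fun i => (hI3 i).sub (hI1 i)
  refine ⟨integrable_finsetSum _ fun i _ => hI i, ?_⟩
  rw [integral_finsetSum _ fun i _ => hI i]
  refine Finset.sum_eq_zero fun i _ => ?_
  rw [integral_const_mul, integral_sub (hI31 i) (hI2 i),
    integral_sub (hI3 i) (hI1 i), hE1, hE2]
  simp

end StochasticRun

/-! ### Step sizes and the number of iterations -/

section Rates

theorem stepParam_pos {n : ℕ} (hn : 2 ≤ n) {M : ℝ} (hM : 0 < M) (t : ℕ) :
    0 < stepParam n M (t + 1) := by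
  have h1 : (1 : ℝ) < n := by exact_mod_cast hn
  have h2 : 0 < √(Real.log n) := Real.sqrt_pos.2 (Real.log_pos h1)
  have h3 : 0 < √((t + 1 : ℕ) : ℝ) := Real.sqrt_pos.2 (by positivity)
  unfold stepParam
  positivity

theorem stepParam_mono {n : ℕ} {M : ℝ} (hM : 0 ≤ M) : Monotone (stepParam n M) := by
  intro s t hst
  unfold stepParam
  have : √(s : ℝ) ≤ √(t : ℝ) := Real.sqrt_le_sqrt (by exact_mod_cast hst)
  gcongr

/-- `2 M n` bounds the root mean square of the estimators. The choice of `β_t` balances the two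
terms: each is at most `2 M n √(ln n) √N`. -/
theorem stepParam_mul_log_add_sum_le {n : ℕ} (hn : 2 ≤ n) {M : ℝ} (hM : 0 < M) (N : ℕ) :
    stepParam n M N * Real.log n +
        ∑ t ∈ Finset.range N, (2 * M * n) ^ 2 / (2 * stepParam n M (t + 1))
      ≤ 4 * M * n * √(Real.log n) * √(N : ℝ) := by
  have h1 : (1 : ℝ) < n := by exact_mod_cast hn
  have hl := Real.log_pos h1
  have h2 : 0 < √(Real.log n) := Real.sqrt_pos.2 hl
  have hsq : √(Real.log n) * √(Real.log n) = Real.log n := Real.mul_self_sqrt hl.le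
  have hfst : stepParam n M N * Real.log n = 2 * M * n * √(Real.log n) * √(N : ℝ) := by
    unfold stepParam
    rw [div_mul_eq_mul_div, div_eq_iff h2.ne']
    linear_combination -(2 * M * n * √(N : ℝ)) * hsq
  have hterm : ∀ t : ℕ, (2 * M * n) ^ 2 / (2 * stepParam n M (t + 1))
      = M * n * √(Real.log n) * (1 / √((t : ℝ) + 1)) := by
    intro t
    have h3 : 0 < √((t : ℝ) + 1) := Real.sqrt_pos.2 (by positivity)
    unfold stepParam
    push_cast
    field_simp
  have hsnd := mul_le_mul_of_nonneg_left (sum_one_div_sqrt_le N)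
    (show 0 ≤ M * n * √(Real.log n) by positivity)
  rw [hfst, Finset.sum_congr rfl fun t _ => hterm t, ← Finset.mul_sum]
  linarith

/-- Used with `A = M n`, and with `s = √(ln n)` for the mean or `s = √(ln n) + √(8 ln σ⁻¹)` for the
tail. -/
theorem rate_le {A s ε N : ℝ} (hε : 0 < ε) (hN : 0 ≤ N)
    (h : 64 * A ^ 2 * s ^ 2 ≤ N * ε ^ 2) : 4 * A * s * √N ≤ N * (ε / 2) := by
  have h1 : √N ^ 2 = N := Real.sq_sqrt hN
  have h2 : 8 * A * s ≤ √N * ε := by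
    refine le_of_sq_le_sq ?_ (by positivity)
    rw [mul_pow √N, h1]
    linarith
  nlinarith [mul_le_mul_of_nonneg_left h2 (Real.sqrt_nonneg N)]

end Rates

/-! ### The error in expectation and with high probability -/

section Convergence

theorem averagedPoint_mem_stdSimplex {m : ℕ} {H : Type*} (F : (Fin (m + 1) → ℝ) → H → ℝ) (M μ : ℝ)
    (e : ℕ → Fin (m + 1) → ℝ) (h : ℕ → H) (a b : ℕ → ℝ) {N : ℕ} (hN : 0 < N) :
    averagedPoint F M μ e h a b N ∈ stdSimplex ℝ (Fin (m + 1)) := by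
  rw [averagedPoint, Finset.smul_sum]
  refine (convex_stdSimplex ℝ (Fin (m + 1))).sum_mem (fun _ _ => by positivity) ?_
    fun t _ => iterate_mem_stdSimplex F M μ e h a b t
  have : (N : ℝ) ≠ 0 := by positivity
  simp [this]

theorem abs_estimator_le {n : ℕ} {H : Type*} {F : (Fin n → ℝ) → H → ℝ} {μ c : ℝ} (hμ : 0 < μ)
    {x e : Fin n → ℝ} {h : H} {a b : ℝ} (ha : |a| ≤ c / 2) (hb : |b| ≤ c / 2) (i : Fin n) :
    |estimator F μ x e h a b i| ≤ n / μ * (|F (x + μ • e) h - F x h| + c) := by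
  rw [estimator, abs_mul, abs_mul, abs_of_nonneg (by positivity : 0 ≤ (n : ℝ) / μ)]
  refine (mul_le_of_le_one_right (by positivity) (abs_sign_le_one _)).trans ?_
  refine mul_le_mul_of_nonneg_left ?_ (by positivity)
  have : F (x + μ • e) h + b - (F x h + a) = (F (x + μ • e) h - F x h) + (b - a) := by ring
  rw [this]
  refine (abs_add_le _ _).trans (add_le_add_right ((abs_sub _ _).trans ?_) _)
  linarith

theorem IsNoisyOracleRun.ae_noise_le {n : ℕ} {H Ω : Type*}
    [MeasurableSpace H] [MeasurableSpace Ω] {P : Measure Ω} {ν : Measure H} {δ : ℝ}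
    {e : ℕ → Ω → Fin n → ℝ} {η : ℕ → Ω → H} {a b : ℕ → Ω → ℝ} (hrun : IsNoisyOracleRun ν δ P e η a b) {c : ℝ}
    (hδ : δ ≤ c / 2) : ∀ᵐ ω ∂P, (∀ k, |a k ω| ≤ c / 2) ∧ ∀ k, |b k ω| ≤ c / 2 := by
  filter_upwards [ae_all_iff.2 hrun.noise_le] with ω hω
  exact ⟨fun k => (hω k).1.trans hδ, fun k => (hω k).2.trans hδ⟩

variable {m : ℕ} {H : Type*}

/-- The error bound along a single run. -/
theorem mul_averagedPoint_sub_le (hm : 2 ≤ m + 1) {F : (Fin (m + 1) → ℝ) → H → ℝ} {M μ c : ℝ}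
    (hM : 0 < M) (hμ : 0 < μ) {g : (Fin (m + 1) → ℝ) → ℝ}
    (hconv : ConvexOn ℝ (stdSimplex ℝ (Fin (m + 1))) g) {y : Fin (m + 1) → ℝ}
    (hy : y ∈ stdSimplex ℝ (Fin (m + 1)))
    (hsub : ∀ x ∈ stdSimplex ℝ (Fin (m + 1)), g x - g y - c ≤ meanGap μ g y x)
    {e : ℕ → Fin (m + 1) → ℝ} {h : ℕ → H} {a b : ℕ → ℝ} (ha : ∀ k, |a k| ≤ c / 2)
    (hb : ∀ k, |b k| ≤ c / 2) {N : ℕ} (hN : 0 < N) :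
    N * (g (averagedPoint F M μ e h a b N) - g y) ≤ N * c +
      ∑ t ∈ Finset.range N, gapDeviation F M μ g y e h a b t +
      (stepParam (m + 1) M N * Real.log (m + 1 : ℕ) + ∑ t ∈ Finset.range N,
        ((m + 1 : ℕ) / μ * (|increment F M μ e h a b t| + c)) ^ 2 /
          (2 * stepParam (m + 1) M (t + 1))) := by
  have hN' : (0 : ℝ) < N := Nat.cast_pos.2 hN
  have hreg : ∑ t ∈ Finset.range N,
      ∑ i, estimator F μ (iterate F M μ e h a b t) (e t) (h t) (a t) (b t) i *
        (iterate F M μ e h a b t i - y i)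
      ≤ stepParam (m + 1) M N * Real.log (m + 1 : ℕ) + ∑ t ∈ Finset.range N,
        ((m + 1 : ℕ) / μ * (|increment F M μ e h a b t| + c)) ^ 2 /
          (2 * stepParam (m + 1) M (t + 1)) := by
    -- With `N = K + 1` and draws indexed from `0`, the last parameter `β K` of the regret bound is
    -- `stepParam (m + 1) M N`.
    obtain ⟨K, rfl⟩ := Nat.exists_eq_add_of_lt hN
    rw [zero_add]
    exact regret_le (β := fun t => stepParam (m + 1) M (t + 1)) (fun t => stepParam_pos hm hM t)
      (fun s t hst => stepParam_mono hM.le (Nat.succ_le_succ hst))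
      (s := dualSum F M μ e h a b) rfl (fun t => rfl)
      (fun t i => abs_estimator_le hμ (ha t) (hb t) i) hy K
  have hJ : g (averagedPoint F M μ e h a b N)
      ≤ ∑ t ∈ Finset.range N, (1 / (N : ℝ)) * g (iterate F M μ e h a b t) := by
    rw [averagedPoint, Finset.smul_sum]
    exact hconv.map_sum_le (fun _ _ => by positivity) (by simp [hN'.ne'])
      fun t _ => iterate_mem_stdSimplex F M μ e h a b t
  rw [← Finset.mul_sum, one_div, ← div_eq_inv_mul, le_div_iff₀ hN'] at hJ
  have hgap : ∑ t ∈ Finset.range N, (g (iterate F M μ e h a b t) - g y - c)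
      ≤ ∑ t ∈ Finset.range N, meanGap μ g y (iterate F M μ e h a b t) :=
    Finset.sum_le_sum fun t _ => hsub _ (iterate_mem_stdSimplex F M μ e h a b t)
  simp only [gapDeviation, Finset.sum_sub_distrib, Finset.sum_const, Finset.card_range,
    nsmul_eq_mul] at hgap ⊢
  linarith

variable {Ω : Type*} [MeasurableSpace H] [MeasurableSpace Ω]
  {P : Measure Ω} [IsProbabilityMeasure P] {ν : Measure H}
  {F : (Fin (m + 1) → ℝ) → H → ℝ} {M μ δ : ℝ} {g : (Fin (m + 1) → ℝ) → ℝ}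
  {e : ℕ → Ω → Fin (m + 1) → ℝ} {η : ℕ → Ω → H} {a b : ℕ → Ω → ℝ} {y : Fin (m + 1) → ℝ}

theorem IsNoisyOracleRun.integrable_comp_averagedPoint (hrun : IsNoisyOracleRun ν δ P e η a b)
    {c : ℝ} (hO : IsRegularOracle ν F μ c g) {N : ℕ} (hN : 0 < N) :
    Integrable (fun ω => g (averagedPoint F M μ (e · ω) (η · ω) (a · ω) (b · ω) N)) P := by
  obtain ⟨C, hC⟩ := (isCompact_stdSimplex ℝ (Fin (m + 1))).exists_bound_of_continuousOn
    hO.continuous.continuousOn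
  have hs : Measurable fun ω => ∑ t ∈ Finset.range N,
      iterate F M μ (e · ω) (η · ω) (a · ω) (b · ω) t :=
    Finset.measurable_fun_sum _ fun t _ => hrun.measurable_iterate hO t
  have hm : Measurable fun ω => averagedPoint F M μ (e · ω) (η · ω) (a · ω) (b · ω) N :=
    hs.const_smul (1 / (N : ℝ))
  exact Integrable.of_bound (hO.continuous.measurable.comp hm).aestronglyMeasurable C
    (Filter.Eventually.of_forall fun ω => hC _ (averagedPoint_mem_stdSimplex _ _ _ _ _ _ _ hN))

variable [IsProbabilityMeasure ν]

theorem IsNoisyOracleRun.integrable_gapDeviation (hrun : IsNoisyOracleRun ν δ P e η a b)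
    {c : ℝ} (hO : IsRegularOracle ν F μ c g) (hy : y ∈ stdSimplex ℝ (Fin (m + 1))) (k : ℕ) :
    Integrable (fun ω => gapDeviation F M μ g y (e · ω) (η · ω) (a · ω) (b · ω) k) P ∧
      ∫ ω, gapDeviation F M μ g y (e · ω) (η · ω) (a · ω) (b · ω) k ∂P = 0 := by
  simpa using hrun.integral_mul_gapDeviation (M := M) hO hy k (w := fun _ => 1) measurable_const
    (B := 1) (by simp)

theorem IsNoisyOracleRun.integral_averagedPoint_le (hrun : IsNoisyOracleRun ν δ P e η a b)
    (hm : 2 ≤ m + 1) (hM : 0 < M) (hμ : 0 < μ) (hδ : δ ≤ M * μ / 2)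
    (hO : IsRegularOracle ν F μ (M * μ) g) (hconv : ConvexOn ℝ (stdSimplex ℝ (Fin (m + 1))) g)
    (hy : y ∈ stdSimplex ℝ (Fin (m + 1)))
    (hsub : ∀ x ∈ stdSimplex ℝ (Fin (m + 1)), g x - g y - M * μ ≤ meanGap μ g y x)
    {ε : ℝ} (hε : 0 < ε) {N : ℕ} (hN : 0 < N)
    (hrate : 64 * (M * (m + 1 : ℕ)) ^ 2 * Real.log (m + 1 : ℕ) ≤ N * ε ^ 2) :
    ∫ ω, g (averagedPoint F M μ (e · ω) (η · ω) (a · ω) (b · ω) N) ∂P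
      ≤ g y + M * μ + ε / 2 := by
  have hN' : (0 : ℝ) < N := Nat.cast_pos.2 hN
  set inc : ℕ → Ω → ℝ := fun t ω => increment F M μ (e · ω) (η · ω) (a · ω) (b · ω) t
  have hinc : ∀ t, Integrable (fun ω => inc t ω ^ 2) P ∧ ∫ ω, inc t ω ^ 2 ∂P ≤ (M * μ) ^ 2 :=
    fun t => hrun.integral_increment_sq_le hO t
  set κ : ℝ := ((m + 1 : ℕ) / μ) ^ 2 with hκ
  set β : ℕ → ℝ := fun t => 2 * stepParam (m + 1) M (t + 1) with hβ
  have hβpos : ∀ t, 0 < β t := fun t => mul_pos two_pos (stepParam_pos hm hM t)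
  have hqi : ∀ t, Integrable (fun ω => κ * (2 * inc t ω ^ 2 + 2 * (M * μ) ^ 2) / β t) P := fun t =>
    ((((hinc t).1.const_mul 2).add (integrable_const _)).const_mul κ).div_const _
  have hq : ∀ t, ∫ ω, κ * (2 * inc t ω ^ 2 + 2 * (M * μ) ^ 2) / β t ∂P
      ≤ (2 * M * (m + 1 : ℕ)) ^ 2 / β t := by
    intro t
    rw [integral_div, integral_const_mul,
      integral_add ((hinc t).1.const_mul 2) (integrable_const _), integral_const_mul]
    simp only [integral_const, probReal_univ, one_smul]
    refine div_le_div_of_nonneg_right ?_ (hβpos t).le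
    -- Increment and noise each contribute `2 (M μ)²` after `(p + q)² ≤ 2 p² + 2 q²`, so the scaled
    -- total is `(2 M n)²`.
    have h1 : κ * (2 * ∫ ω, inc t ω ^ 2 ∂P + 2 * (M * μ) ^ 2)
        ≤ κ * (2 * (M * μ) ^ 2 + 2 * (M * μ) ^ 2) :=
      mul_le_mul_of_nonneg_left (by linarith [(hinc t).2]) (sq_nonneg _)
    refine h1.trans_eq ?_
    rw [hκ]
    field_simp
    ring
  have hDi : ∀ t, Integrable
      (fun ω => gapDeviation F M μ g y (e · ω) (η · ω) (a · ω) (b · ω) t) P := fun t =>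
    (hrun.integrable_gapDeviation hO hy t).1
  have hgi := hrun.integrable_comp_averagedPoint (M := M) hO hN
  have hle : ∀ᵐ ω ∂P, N * (g (averagedPoint F M μ (e · ω) (η · ω) (a · ω) (b · ω) N) - g y) ≤
      (N * (M * μ) + stepParam (m + 1) M N * Real.log (m + 1 : ℕ)) +
      (∑ t ∈ Finset.range N, gapDeviation F M μ g y (e · ω) (η · ω) (a · ω) (b · ω) t +
      ∑ t ∈ Finset.range N, κ * (2 * inc t ω ^ 2 + 2 * (M * μ) ^ 2) / β t) := by
    filter_upwards [hrun.ae_noise_le hδ] with ω hω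
    have h1 := mul_averagedPoint_sub_le hm hM hμ hconv hy hsub (F := F) (e := (e · ω))
      (h := (η · ω)) hω.1 hω.2 hN
    have h2 : ∑ t ∈ Finset.range N, ((m + 1 : ℕ) / μ * (|inc t ω| + M * μ)) ^ 2 / β t
        ≤ ∑ t ∈ Finset.range N, κ * (2 * inc t ω ^ 2 + 2 * (M * μ) ^ 2) / β t := by
      refine Finset.sum_le_sum fun t _ => div_le_div_of_nonneg_right ?_ (hβpos t).le
      rw [mul_pow]
      refine mul_le_mul_of_nonneg_left ?_ (sq_nonneg _)
      rw [← sq_abs (inc t ω)]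
      nlinarith [sq_nonneg (|inc t ω| - M * μ)]
    linarith
  have hD0 : ∫ ω, ∑ t ∈ Finset.range N,
      gapDeviation F M μ g y (e · ω) (η · ω) (a · ω) (b · ω) t ∂P = 0 := by
    rw [integral_finsetSum _ fun t _ => hDi t]
    exact Finset.sum_eq_zero fun t _ => (hrun.integrable_gapDeviation hO hy t).2
  have hgs : Integrable (fun ω =>
      g (averagedPoint F M μ (e · ω) (η · ω) (a · ω) (b · ω) N) - g y) P :=
    hgi.sub (integrable_const _)
  have hDs := integrable_finsetSum (Finset.range N) fun t _ => hDi t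
  have hqs := integrable_finsetSum (Finset.range N) fun t _ => hqi t
  have hDq : Integrable (fun ω =>
      ∑ t ∈ Finset.range N, gapDeviation F M μ g y (e · ω) (η · ω) (a · ω) (b · ω) t +
      ∑ t ∈ Finset.range N, κ * (2 * inc t ω ^ 2 + 2 * (M * μ) ^ 2) / β t) P := hDs.add hqs
  have hint := integral_mono_ae (hgs.const_mul (N : ℝ)) ((integrable_const _).add hDq) hle
  simp only [Pi.add_apply] at hint
  rw [integral_const_mul, integral_sub hgi (integrable_const _),
    integral_add (integrable_const _) hDq, integral_add hDs hqs, hD0,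
    integral_finsetSum _ fun t _ => hqi t] at hint
  simp only [integral_const, probReal_univ, one_smul] at hint
  have hsum := Finset.sum_le_sum fun t (_ : t ∈ Finset.range N) => hq t
  have hstep := stepParam_mul_log_add_sum_le hm hM N
  have hl : 0 ≤ Real.log (m + 1 : ℕ) := Real.log_natCast_nonneg _
  have hfin := rate_le (A := M * (m + 1 : ℕ)) (s := √(Real.log (m + 1 : ℕ))) hε hN'.le (by rwa [Real.sq_sqrt hl])
  have : N * (∫ ω, g (averagedPoint F M μ (e · ω) (η · ω) (a · ω) (b · ω) N) ∂P)
      ≤ N * (g y + M * μ + ε / 2) := by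
    linarith
  exact le_of_mul_le_mul_left this hN'

theorem IsNoisyOracleRun.le_measureReal_averagedPoint (hrun : IsNoisyOracleRun ν δ P e η a b)
    (hm : 2 ≤ m + 1) (hM : 0 < M) (hμ : 0 < μ) (hδ : δ ≤ M * μ / 2)
    (hO : IsRegularOracle ν F μ (M * μ) g) (hconv : ConvexOn ℝ (stdSimplex ℝ (Fin (m + 1))) g)
    (hy : y ∈ stdSimplex ℝ (Fin (m + 1)))
    (hsub : ∀ x ∈ stdSimplex ℝ (Fin (m + 1)), g x - g y - M * μ ≤ meanGap μ g y x)
    (hbdd : ∀ᵐ h ∂ν, ∀ x ∈ stdSimplex ℝ (Fin (m + 1)), ∀ e : Fin (m + 1) → ℝ, ∑ i, |e i| = 1 →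
      |F (x + μ • e) h - F x h| ≤ M * μ)
    {ε : ℝ} (hε : 0 < ε) {σ : ℝ} (hσ0 : 0 < σ) (hσ1 : σ < 1) {N : ℕ} (hN : 0 < N)
    (hrate : 128 * (M * (m + 1 : ℕ)) ^ 2 * (Real.log (m + 1 : ℕ) + 8 * Real.log σ⁻¹)
      ≤ N * ε ^ 2) :
    1 - σ ≤ P.real {ω | g (averagedPoint F M μ (e · ω) (η · ω) (a · ω) (b · ω) N)
      ≤ g y + M * μ + ε / 2} := by
  have hσm := hrun.isProbabilityMeasure
  have hN' : (0 : ℝ) < N := Nat.cast_pos.2 hN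
  have hl : 0 ≤ Real.log (m + 1 : ℕ) := Real.log_natCast_nonneg _
  have hL : 0 ≤ Real.log σ⁻¹ := (Real.log_pos ((one_lt_inv₀ hσ0).2 hσ1)).le
  set D : ℕ → Ω → ℝ := fun t ω => gapDeviation F M μ g y (e · ω) (η · ω) (a · ω) (b · ω) t with hD
  -- Chosen so that Azuma with the bound `8 M n` gives exactly `σ`, and of the form `4 A s √N`, so
  -- that it adds to the regret term in `rate_le`.
  set r : ℝ := 4 * (M * (m + 1 : ℕ)) * √(8 * Real.log σ⁻¹) * √(N : ℝ) with hr
  have hinc : ∀ᵐ ω ∂P, ∀ t,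
      |increment F M μ (e · ω) (η · ω) (a · ω) (b · ω) t| ≤ M * μ := by
    rw [ae_all_iff]
    intro t
    have h1 := hbdd
    rw [← hrun.law_η t] at h1
    have h2 := ae_uniformL1Sphere hσm
    rw [← hrun.law_e t] at h2
    filter_upwards [ae_of_ae_map (hrun.measurable_η t).aemeasurable h1,
      ae_of_ae_map (hrun.measurable_e t).aemeasurable h2] with ω hω1 hω2
    exact hω1 _ (iterate_mem_stdSimplex _ _ _ _ _ _ _ _) _ hω2
  -- Points of the simplex are at ℓ¹ distance at most `2`; the mean estimator is at most `M n` and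
  -- the estimator at most `2 M n`. The sum `6 M n` is rounded up to `8 M n`.
  have hDb : ∀ t, ∀ᵐ ω ∂P, |D t ω| ≤ 8 * (M * (m + 1 : ℕ)) := by
    intro t
    filter_upwards [hinc, hrun.ae_noise_le hδ] with ω hω1 hω2
    set x := iterate F M μ (e · ω) (η · ω) (a · ω) (b · ω) t with hxd
    have hx : x ∈ stdSimplex ℝ (Fin (m + 1)) := iterate_mem_stdSimplex _ _ _ _ _ _ _ _
    have hxy : ∑ i, |x i - y i| ≤ 2 := by
      have : ∑ i, |x i - y i| ≤ ∑ i, (x i + y i) := Finset.sum_le_sum fun i _ => by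
        have := abs_sub (x i) (y i)
        rwa [abs_of_nonneg (hx.1 i), abs_of_nonneg (hy.1 i)] at this
      rw [Finset.sum_add_distrib, hx.2, hy.2] at this
      linarith
    have hsum : ∀ v : Fin (m + 1) → ℝ, ∀ B : ℝ, 0 ≤ B → (∀ i, |v i| ≤ B) →
        |∑ i, v i * (x i - y i)| ≤ 2 * B := by
      intro v B hB hv
      refine (abs_sum_mul_le v fun i => x i - y i).trans ?_
      rw [mul_comm 2 B]
      exact mul_le_mul ((pi_norm_le_iff_of_nonneg hB).2 hv) hxy
        (Finset.sum_nonneg fun i _ => abs_nonneg _) hB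
    have h1 : |meanGap μ g y x| ≤ 2 * (M * (m + 1 : ℕ)) := by
      refine hsum _ _ (by positivity) fun i => ?_
      rw [abs_mul, abs_of_pos (by positivity : 0 < ((m : ℝ) + 1) / μ)]
      have := abs_meanSign_le hσm hO.continuous i x (hO.abs_sub_le x hx)
      refine (mul_le_mul_of_nonneg_left this (by positivity)).trans_eq ?_
      push_cast
      field_simp
    have h2 : |∑ i, estimator F μ x (e t ω) (η t ω) (a t ω) (b t ω) i * (x i - y i)|
        ≤ 2 * (2 * (M * (m + 1 : ℕ))) := by
      refine hsum _ _ (by positivity) fun i => ?_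
      refine (abs_estimator_le hμ (hω2.1 t) (hω2.2 t) i).trans ?_
      have h3 : |F (x + μ • e t ω) (η t ω) - F x (η t ω)| ≤ M * μ := hω1 t
      have h4 : ((m + 1 : ℕ) : ℝ) / μ * (|F (x + μ • e t ω) (η t ω) - F x (η t ω)| + M * μ)
          ≤ ((m + 1 : ℕ) : ℝ) / μ * (M * μ + M * μ) :=
        mul_le_mul_of_nonneg_left (by linarith) (by positivity)
      refine h4.trans_eq ?_
      field_simp
      ring
    have h5 : 0 ≤ M * (m + 1 : ℕ) := by positivity
    refine (abs_sub _ _).trans ((add_le_add h1 h2).trans ?_)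
    linarith
  have hazuma := measureReal_sum_ge_le (P := P) (D := D)
    (fun t => hrun.measurable_gapDeviation hO y t) (c := 8 * (M * (m + 1 : ℕ))) (by positivity) hDb
    (fun t w hw ⟨B, hB⟩ => (hrun.integral_mul_gapDeviation hO hy t hw hB).2) hN (r := r)
    (by positivity)
  have hexp : Real.exp (-(r ^ 2 / (2 * N * (8 * (M * (m + 1 : ℕ))) ^ 2))) = σ := by
    have h1 : r ^ 2 / (2 * N * (8 * (M * (m + 1 : ℕ))) ^ 2) = Real.log σ⁻¹ := by
      rw [hr, mul_pow, mul_pow, Real.sq_sqrt hN'.le, Real.sq_sqrt (by positivity)]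
      field_simp
      ring
    rw [h1, Real.log_inv, neg_neg, Real.exp_log hσ0]
  rw [hexp] at hazuma
  have hsub' : ∀ᵐ ω ∂P, ω ∈ {ω | r ≤ ∑ t ∈ Finset.range N, D t ω}ᶜ →
      ω ∈ {ω | g (averagedPoint F M μ (e · ω) (η · ω) (a · ω) (b · ω) N)
        ≤ g y + M * μ + ε / 2} := by
    filter_upwards [hinc, hrun.ae_noise_le hδ] with ω hω1 hω2 hω
    have hω3 : ∑ t ∈ Finset.range N, D t ω < r := not_le.1 hω
    have h1 := mul_averagedPoint_sub_le hm hM hμ hconv hy hsub (F := F) (e := (e · ω))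
      (h := (η · ω)) hω2.1 hω2.2 hN
    have h2 : ∑ t ∈ Finset.range N, ((m + 1 : ℕ) / μ *
        (|increment F M μ (e · ω) (η · ω) (a · ω) (b · ω) t| + M * μ)) ^ 2 /
          (2 * stepParam (m + 1) M (t + 1))
        ≤ ∑ t ∈ Finset.range N, (2 * M * (m + 1 : ℕ)) ^ 2 / (2 * stepParam (m + 1) M (t + 1)) := by
      refine Finset.sum_le_sum fun t _ => div_le_div_of_nonneg_right ?_
        (mul_pos two_pos (stepParam_pos hm hM t)).le
      refine pow_le_pow_left₀ (by positivity) ?_ 2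
      refine (mul_le_mul_of_nonneg_left (add_le_add_left (hω1 t) (M * μ)) (by positivity)).trans_eq ?_
      field_simp
      ring
    have hstep := stepParam_mul_log_add_sum_le hm hM N
    -- Squaring the sum of the two roots doubles the constant: hence `128` here and `64` for the
    -- mean.
    have hs : (√(Real.log (m + 1 : ℕ)) + √(8 * Real.log σ⁻¹)) ^ 2
        ≤ 2 * (Real.log (m + 1 : ℕ) + 8 * Real.log σ⁻¹) := by
      have e1 := Real.sq_sqrt hl
      have e2 := Real.sq_sqrt (by positivity : 0 ≤ 8 * Real.log σ⁻¹)
      nlinarith [sq_nonneg (√(Real.log (m + 1 : ℕ)) - √(8 * Real.log σ⁻¹))]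
    have hsM := mul_le_mul_of_nonneg_left hs
      (by positivity : 0 ≤ 64 * (M * ((m + 1 : ℕ) : ℝ)) ^ 2)
    have hfin := rate_le (A := M * (m + 1 : ℕ))
      (s := √(Real.log (m + 1 : ℕ)) + √(8 * Real.log σ⁻¹)) hε hN'.le (by linarith)
    have h3 : N * g (averagedPoint F M μ (e · ω) (η · ω) (a · ω) (b · ω) N)
        ≤ N * (g y + M * μ + ε / 2) := by
      rw [hr] at hω3
      linarith
    exact le_of_mul_le_mul_left h3 hN'
  have hmeas : MeasurableSet {ω | r ≤ ∑ t ∈ Finset.range N, D t ω} :=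
    measurableSet_le measurable_const
      (Finset.measurable_fun_sum _ fun t _ => hrun.measurable_gapDeviation hO y t)
  calc 1 - σ ≤ 1 - P.real {ω | r ≤ ∑ t ∈ Finset.range N, D t ω} := by linarith
    _ = P.real {ω | r ≤ ∑ t ∈ Finset.range N, D t ω}ᶜ := (probReal_compl_eq_one_sub hmeas).symm
    _ ≤ _ := ENNReal.toReal_mono (measure_ne_top _ _) (measure_mono_ae hsub')

end Convergence

/-! ### Change of version and construction of the regular oracle -/

section Transfer

variable {n : ℕ} {H : Type*}

theorem subdifferential_congr {U : Set (Fin n → ℝ)} {φ ψ : (Fin n → ℝ) → ℝ} (h : Set.EqOn φ ψ U)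
    {x : Fin n → ℝ} (hx : x ∈ U) : subdifferential U φ x = subdifferential U ψ x := by
  ext g
  refine forall₂_congr fun y hy => ?_
  rw [h hx, h hy]

theorem add_smul_mem_simplexNhd {μ r : ℝ} (hμ : 0 < μ) (hr : μ < r) {x d : Fin n → ℝ}
    (hx : x ∈ stdSimplex ℝ (Fin n)) (hd : ∑ i, |d i| ≤ 1) : x + μ • d ∈ simplexNhd n r := by
  refine add_mem_simplexNhd hx ?_
  simp only [Pi.smul_apply, smul_eq_mul, abs_mul, abs_of_pos hμ, ← Finset.mul_sum]
  nlinarith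

/-- The method queries only points of the simplex and their shifts of ℓ¹ length `μ < r`, so values
outside the neighbourhood never enter. -/
theorem averagedPoint_congr {m : ℕ} {F F' : (Fin (m + 1) → ℝ) → H → ℝ} {r μ : ℝ} (hμ : 0 < μ)
    (hr : μ < r) {e : ℕ → Fin (m + 1) → ℝ} {h : ℕ → H} (a b : ℕ → ℝ) (he : ∀ k, ∑ i, |e k i| = 1)
    (hF : ∀ k, ∀ x ∈ simplexNhd (m + 1) r, F' x (h k) = F x (h k)) (M : ℝ) (N : ℕ) :
    averagedPoint F' M μ e h a b N = averagedPoint F M μ e h a b N := by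
  have hdual : ∀ t, dualSum F' M μ e h a b t = dualSum F M μ e h a b t := by
    intro t
    induction t with
    | zero => rfl
    | succ t ih =>
      have hx := entropicPoint_mem_stdSimplex (stepParam (m + 1) M (t + 1))
        (dualSum F M μ e h a b t)
      rw [dualSum, dualSum, ih]
      unfold estimator
      rw [hF t _ (add_smul_mem_simplexNhd hμ hr hx (he t).le),
        hF t _ (stdSimplex_subset_simplexNhd (hμ.trans hr) hx)]
  simp only [averagedPoint, iterate, hdual]

variable [MeasurableSpace H] {U : Set (Fin n → ℝ)} {F F' : (Fin n → ℝ) → H → ℝ} {ν : Measure H}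
  {M : ℝ}

theorem IntegrableValues.congr (hF : IntegrableValues U F ν)
    (hF' : Measurable fun p : (Fin n → ℝ) × H => F' p.1 p.2)
    (h : ∀ᵐ h ∂ν, ∀ x ∈ U, F' x h = F x h) : IntegrableValues U F' ν := fun x hx =>
  ⟨hF'.comp (by fun_prop : Measurable fun h : H => (x, h)), (hF x hx).2.congr <| by
    filter_upwards [h] with h hh using (hh x hx).symm⟩

theorem ConvexRealizations.congr (h1 : ConvexRealizations U F ν)
    (h : ∀ᵐ h ∂ν, ∀ x ∈ U, F' x h = F x h) : ConvexRealizations U F' ν := by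
  filter_upwards [h1, h] with h hh h' using hh.congr fun x hx => (h' x hx).symm

theorem SquareBoundedSubgradients.congr (h3 : SquareBoundedSubgradients U F ν M)
    (h : ∀ᵐ h ∂ν, ∀ x ∈ U, F' x h = F x h) : SquareBoundedSubgradients U F' ν M := fun x hx => by
  refine le_of_eq_of_le (lintegral_congr_ae ?_) (h3 x hx)
  filter_upwards [h] with h hh
  rw [subdifferential_congr (fun y hy => hh y hy) hx]

theorem BoundedSubgradients.congr (h3 : BoundedSubgradients U F ν M)
    (h : ∀ᵐ h ∂ν, ∀ x ∈ U, F' x h = F x h) : BoundedSubgradients U F' ν M := by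
  filter_upwards [h3, h] with h hh h' x hx g hg
  rw [subdifferential_congr (fun y hy => h' y hy) hx] at hg
  exact hh x hx g hg

theorem objective_congr (h : ∀ᵐ h ∂ν, ∀ x ∈ U, F' x h = F x h) :
    Set.EqOn (objective F' ν) (objective F ν) U := fun x hx =>
  integral_congr_ae <| by filter_upwards [h] with h hh using hh x hx

theorem abs_sub_le_of_boundedSubgradients (hU : IsOpen U) {φ : (Fin n → ℝ) → ℝ}
    (hφ : ConvexOn ℝ U φ) (hb : ∀ x ∈ U, ∀ g ∈ subdifferential U φ x, ‖g‖ ≤ M)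
    {x y : Fin n → ℝ} (hx : x ∈ U) (hy : y ∈ U) : |φ y - φ x| ≤ M * ∑ i, |y i - x i| := by
  have key : ∀ u ∈ U, ∀ v ∈ U, φ u - φ v ≤ M * ∑ i, |v i - u i| := by
    intro u hu v hv
    obtain ⟨g, hg⟩ := subdifferential_nonempty hU hφ hu
    exact (sub_le_of_mem_subdifferential hg hv).trans (mul_le_mul_of_nonneg_right (hb u hu g hg)
      (Finset.sum_nonneg fun i _ => abs_nonneg _))
  rw [abs_sub_le_iff]
  refine ⟨?_, key x hx y hy⟩
  simpa only [abs_sub_comm] using key y hy x hx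

/-- The smoothing properties of a stochastic convex oracle with mean-square bounded subgradients. -/
theorem exists_isRegularOracle {m : ℕ} {F : (Fin (m + 1) → ℝ) → H → ℝ} [IsProbabilityMeasure ν]
    (hσ : IsProbabilityMeasure (uniformL1Sphere (m + 1))) {μ r : ℝ} (hM : 0 ≤ M) (hμ : 0 < μ)
    (hr : μ < r) (hFm : Measurable fun p : (Fin (m + 1) → ℝ) × H => F p.1 p.2)
    (hF : IntegrableValues (simplexNhd (m + 1) r) F ν)
    (h1 : ConvexRealizations (simplexNhd (m + 1) r) F ν)
    (h3 : SquareBoundedSubgradients (simplexNhd (m + 1) r) F ν M) :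
    ∃ g, IsRegularOracle ν F μ (M * μ) g ∧ Set.EqOn (objective F ν) g (simplexNhd (m + 1) r) ∧
      ConvexOn ℝ (simplexNhd (m + 1) r) g ∧
      ∀ x ∈ stdSimplex ℝ (Fin (m + 1)), ∀ y ∈ stdSimplex ℝ (Fin (m + 1)),
        g x - g y - M * μ ≤ meanGap μ g y x := by
  have hU := isOpen_simplexNhd (n := m + 1) r
  have hUc := convex_simplexNhd (n := m + 1) r
  have hlip := fun (x y : Fin (m + 1) → ℝ) (hx : x ∈ simplexNhd (m + 1) r)
    (hy : y ∈ simplexNhd (m + 1) r) => abs_objective_sub_le hU hUc hM hF h1 h3 hx hy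
  -- This crude constant for the sup norm only serves to extend the objective to the whole space;
  -- the estimates use the sharp ℓ¹ constant `M` from `hlip`.
  have hK : LipschitzOnWith (M * (m + 1)).toNNReal (objective F ν) (simplexNhd (m + 1) r) := by
    refine LipschitzOnWith.of_dist_le_mul fun x hx y hy => ?_
    rw [Real.coe_toNNReal _ (by positivity), Real.dist_eq, mul_assoc]
    refine (hlip y x hy hx).trans (mul_le_mul_of_nonneg_left ?_ hM)
    refine (Finset.sum_le_card_nsmul _ _ (dist x y) fun i _ => ?_).trans_eq (by simp)
    exact (Real.dist_eq (x i) (y i)).symm.le.trans (dist_le_pi_dist x y i)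
  obtain ⟨g, hg, hfg⟩ := hK.extend_real
  have hconv := (convexOn_objective hUc hF h1).congr hfg
  have hxU : ∀ x ∈ stdSimplex ℝ (Fin (m + 1)), x ∈ simplexNhd (m + 1) r :=
    fun x hx => stdSimplex_subset_simplexNhd (hμ.trans hr) hx
  have hxe : ∀ x ∈ stdSimplex ℝ (Fin (m + 1)), ∀ e : Fin (m + 1) → ℝ, ∑ i, |e i| ≤ 1 →
      x + μ • e ∈ simplexNhd (m + 1) r := fun x hx e he => add_smul_mem_simplexNhd hμ hr hx he
  have hdist : ∀ x e : Fin (m + 1) → ℝ, ∑ i, |(x + μ • e) i - x i| = μ * ∑ i, |e i| := by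
    intro x e
    simp [abs_mul, abs_of_pos hμ, Finset.mul_sum]
  have habs : ∀ x ∈ stdSimplex ℝ (Fin (m + 1)), ∀ e : Fin (m + 1) → ℝ, ∑ i, |e i| ≤ 1 →
      |g (x + μ • e) - g x| ≤ M * μ := by
    intro x hx e he
    have h := hlip x (x + μ • e) (hxU x hx) (hxe x hx e he)
    rw [hfg (hxU x hx), hfg (hxe x hx e he), hdist] at h
    refine h.trans (mul_le_mul_of_nonneg_left ?_ hM)
    nlinarith
  refine ⟨g, ⟨hFm, hg.continuous, fun x hx e he => ?_, fun x hx e he => ?_,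
    fun x hx e he => habs x hx e he.le⟩, hfg, hconv, fun x hx y hy => ?_⟩
  · have h := lintegral_sq_sub_le hU hUc (fun z hz => (hF z hz).1) h1 h3 (hxU x hx)
      (hxe x hx e he.le)
    rwa [hdist, he, mul_one] at h
  · rw [integral_sub (hF _ (hxe x hx e he.le)).2 (hF x (hxU x hx)).2, ← hfg (hxU x hx),
      ← hfg (hxe x hx e he.le)]
    rfl
  · refine sub_le_sum_integral_estimator hσ hg hconv hμ (fun d hd => hxe x hx d hd.le)
      (fun d hd => hxe y hy d hd.le) fun d hd => ?_
    have := (abs_le.1 (habs y hy d hd.le)).2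
    linarith

end Transfer

end GradientFree

/-! ### The convergence theorem -/

theorem mainTheorem1 {n : ℕ} (hn : 2 ≤ n) {H Ω : Type*} [MeasurableSpace H] [MeasurableSpace Ω]
    (ν : Measure H) [IsProbabilityMeasure ν] (P : Measure Ω) [IsProbabilityMeasure P]
    (F : (Fin n → ℝ) → H → ℝ) (M ε δ μ μ₀ : ℝ) (hM : 0 < M) (hε : 0 < ε)
    (hμ : μ = ε / (2 * M)) (hμ₀ : μ < μ₀) (hδ : δ ≤ ε / 4)
    (hF : GradientFree.IntegrableValues (GradientFree.simplexNhd n μ₀) F ν)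
    (h1 : GradientFree.ConvexRealizations (GradientFree.simplexNhd n μ₀) F ν)
    (h2 : GradientFree.ExpectedSubgradients (GradientFree.simplexNhd n μ₀) F ν)
    (h3a : GradientFree.SquareBoundedSubgradients (GradientFree.simplexNhd n μ₀) F ν M)
    (e : ℕ → Ω → Fin n → ℝ) (η : ℕ → Ω → H) (a b : ℕ → Ω → ℝ)
    (hrun : GradientFree.IsNoisyOracleRun ν δ P e η a b)
    (xbar : ℕ → Ω → Fin n → ℝ)
    (hxbar : ∀ N ω, xbar N ω = GradientFree.averagedPoint F M μ
      (fun k => e k ω) (fun k => η k ω) (fun k => a k ω) (fun k => b k ω) N) :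
    ∃ fmin : ℝ, IsLeast (GradientFree.objective F ν '' stdSimplex ℝ (Fin n)) fmin ∧
      (∀ N : ℕ, N = ⌈64 * M ^ 2 * (n : ℝ) ^ 2 * Real.log n / ε ^ 2⌉₊ →
        Integrable (fun ω => GradientFree.objective F ν (xbar N ω)) P ∧
        (∫ ω, GradientFree.objective F ν (xbar N ω) ∂P) - fmin ≤ ε) ∧
      (GradientFree.BoundedSubgradients (GradientFree.simplexNhd n μ₀) F ν M →
        ∀ σ : ℝ, 0 < σ → σ < 1 → ∀ N : ℕ,
          N = ⌈128 * M ^ 2 * (n : ℝ) ^ 2 / ε ^ 2 * (Real.log n + 8 * Real.log σ⁻¹)⌉₊ →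
          1 - σ ≤ P.real {ω | GradientFree.objective F ν (xbar N ω) - fmin ≤ ε}) := by
  obtain ⟨m, rfl⟩ : ∃ m, n = m + 1 := ⟨n - 1, by omega⟩
  have hσm := hrun.isProbabilityMeasure
  have hμ' : 0 < μ := by rw [hμ]; positivity
  have hc : M * μ = ε / 2 := by rw [hμ]; field_simp
  have hδ' : δ ≤ M * μ / 2 := by rw [hc]; linarith
  have hU := GradientFree.isOpen_simplexNhd (n := m + 1) μ₀
  obtain ⟨F', hF'm, hFF'⟩ := GradientFree.exists_measurable_version hU (fun x hx => (hF x hx).1) h1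
  have hF' := hF.congr hF'm hFF'
  have h1' := h1.congr hFF'
  obtain ⟨g, hO, hfg', hconv, hsub⟩ := GradientFree.exists_isRegularOracle hσm hM.le hμ' hμ₀ hF'm
    hF' h1' (h3a.congr hFF')
  have hSU : stdSimplex ℝ (Fin (m + 1)) ⊆ GradientFree.simplexNhd (m + 1) μ₀ :=
    GradientFree.stdSimplex_subset_simplexNhd (hμ'.trans hμ₀)
  have hfg : ∀ x ∈ stdSimplex ℝ (Fin (m + 1)), GradientFree.objective F ν x = g x := fun x hx =>
    (GradientFree.objective_congr hFF' (hSU hx)).symm.trans (hfg' (hSU hx))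
  have hconvS := hconv.subset hSU (convex_stdSimplex ℝ (Fin (m + 1)))
  obtain ⟨y, hy, hymin⟩ := (isCompact_stdSimplex ℝ (Fin (m + 1))).exists_isMinOn
    ⟨_, GradientFree.entropicPoint_mem_stdSimplex 1 0⟩ hO.continuous.continuousOn
  -- Almost surely all directions lie on the sphere and all realizations are ones where `F'` agrees
  -- with `F` on the neighbourhood, so both oracles produce the same run.
  have hbar : ∀ N, 0 < N → ∀ᵐ ω ∂P, GradientFree.objective F ν (xbar N ω)
      = g (GradientFree.averagedPoint F' M μ (e · ω) (η · ω) (a · ω) (b · ω) N) := by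
    intro N hN
    have he : ∀ᵐ ω ∂P, ∀ k, ∑ i, |e k ω i| = 1 := ae_all_iff.2 fun k =>
      ae_of_ae_map (hrun.measurable_e k).aemeasurable
        ((hrun.law_e k).symm ▸ GradientFree.ae_uniformL1Sphere hσm)
    have hη : ∀ᵐ ω ∂P, ∀ k, ∀ x ∈ GradientFree.simplexNhd (m + 1) μ₀,
        F' x (η k ω) = F x (η k ω) := ae_all_iff.2 fun k =>
      ae_of_ae_map (hrun.measurable_η k).aemeasurable ((hrun.law_η k).symm ▸ hFF')
    filter_upwards [he, hη] with ω h2 h3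
    rw [hxbar, ← GradientFree.averagedPoint_congr hμ' hμ₀ (a · ω) (b · ω) h2 h3]
    exact hfg _ (GradientFree.averagedPoint_mem_stdSimplex _ _ _ _ _ _ _ hN)
  have hlog : 0 < Real.log (m + 1 : ℕ) := Real.log_pos (by exact_mod_cast hn)
  refine ⟨g y, ⟨⟨y, hy, hfg y hy⟩, ?_⟩, fun N hN => ?_, fun hb σ hσ0 hσ1 N hN => ?_⟩
  · rintro _ ⟨x, hx, rfl⟩
    rw [hfg x hx]
    exact hymin hx
  · have hN0 : 0 < N := by rw [hN, Nat.ceil_pos]; positivity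
    have hle : 64 * M ^ 2 * ((m + 1 : ℕ) : ℝ) ^ 2 * Real.log (m + 1 : ℕ) / ε ^ 2 ≤ N :=
      hN ▸ Nat.le_ceil _
    rw [div_le_iff₀ (by positivity)] at hle
    refine ⟨(hrun.integrable_comp_averagedPoint (M := M) hO hN0).congr
      ((hbar N hN0).mono fun ω h => h.symm), ?_⟩
    rw [integral_congr_ae (hbar N hN0)]
    have := hrun.integral_averagedPoint_le hn hM hμ' hδ' hO hconvS hy
      (fun x hx => hsub x hx y hy) hε hN0 (by rwa [mul_pow, ← mul_assoc])
    linarith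
  · have hL : 0 < Real.log σ⁻¹ := Real.log_pos ((one_lt_inv₀ hσ0).2 hσ1)
    have hN0 : 0 < N := by rw [hN, Nat.ceil_pos]; positivity
    have hle : 128 * M ^ 2 * ((m + 1 : ℕ) : ℝ) ^ 2 / ε ^ 2 *
        (Real.log (m + 1 : ℕ) + 8 * Real.log σ⁻¹) ≤ N := hN ▸ Nat.le_ceil _
    rw [div_mul_eq_mul_div, div_le_iff₀ (by positivity)] at hle
    have hbdd : ∀ᵐ h ∂ν, ∀ x ∈ stdSimplex ℝ (Fin (m + 1)), ∀ e : Fin (m + 1) → ℝ,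
        ∑ i, |e i| = 1 → |F' (x + μ • e) h - F' x h| ≤ M * μ := by
      filter_upwards [h1', hb.congr hFF'] with h hh hbh x hx e he
      have := GradientFree.abs_sub_le_of_boundedSubgradients hU hh hbh (hSU hx)
        (GradientFree.add_smul_mem_simplexNhd hμ' hμ₀ hx he.le)
      simpa [abs_mul, abs_of_pos hμ', ← Finset.mul_sum, he] using this
    have := hrun.le_measureReal_averagedPoint hn hM hμ' hδ' hO hconvS hy
      (fun x hx => hsub x hx y hy) hbdd hε hσ0 hσ1 hN0 (by rwa [mul_pow, ← mul_assoc])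
    -- The events are compared through an almost sure inclusion, which does not need `objective F ν
    -- (xbar N ω)` to be measurable in `ω`.
    refine this.trans (ENNReal.toReal_mono (measure_ne_top _ _) (measure_mono_ae ?_))
    filter_upwards [hbar N hN0] with ω hω h
    change GradientFree.objective F ν (xbar N ω) - g y ≤ ε
    have h' : g (GradientFree.averagedPoint F' M μ (e · ω) (η · ω) (a · ω) (b · ω) N)
      ≤ g y + M * μ + ε / 2 := h
    rw [hω]
    linarith
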